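/- Two players alternate, player 1 first, in choosing a safe arm $S$ or a risky arm $R$; a period consists of one choice of each player, and payoffs are discounted by $\delta\in(0,1)$ per period. The state $\theta\in\{G,B\}$ is drawn once, with $p_0:=\mathbf P(\theta=G)\in(0,1]$. Choosing $S$ pays $0$. Choosing $R$ ("experimenting") costs $c>0$ and yields $m$ (a success) with probability $\lambda\in(0,1)$ and $0$ otherwise if $\theta=G$, and always yields $0$ if $\theta=B$. Assume $g:=\lambda m-c>0$. Choices are always observed by both players. Outcomes are either private (seen only by the experimenter) or public (seen by both). Set $\phi(p)=\frac{p(1-\lambda)}{p(1-\lambda)+1-p}$ and $$p^*=\frac{c(1-\delta)}{c(1-\delta)+g(1-\delta(1-\lambda))},\qquad \widehat p=\frac{c(1-\delta)}{c(1-\delta)+g\left(1-\delta+\lambda\delta(1+\delta-\lambda\delta)\right)}.$$ A sequential equilibrium $(\sigma,\pi)$ is a profile of behavior strategies together with a belief system that is sequentially rational and consistent (a pointwise limit of completely mixed profiles and their Bayesian beliefs). The belief of a player at one of his histories is the probability that he assigns there to $\theta=G$; let $p^i(h)$ be the belief of player $i$ after the sequence of choices $h$ if none of $i$'s experiments along $h$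 was successful, and let $n_{\mathrm e}(h)$ be the number of $R$'s in $h$. With private outcomes, a sequential equilibrium is reasonable if, for the active player $i$ at the history in question, $p^i(hS)=\phi^{n_{\mathrm e}(h)}(p_0)$ for every $h$, and $p^i(hSaR)=\phi^{n_{\mathrm e}(hSa)}(p_0)$ for every $h$ and $a\in\{S,R\}$. It is pure if the choice of the active player, when not successful, is deterministic after every sequence of choices. 1. Let outcomes be private and $p_0>p^*$. In every pure reasonable sequential equilibrium: (a) almost surely, if $\theta=B$, then the belief of each player converges along the play to a limit that is at most $\widehat p$; (b) at every history (on or off path) at which the belief of the active player is strictly below $\widehat p$, he chooses $R$ with probability $0$. 2. Let outcomes be public. In every Nash equilibrium: (a) almost surely, if $\theta=B$, then the belief of each player, computed by Bayes' rule, converges along the play to a limit that is at most $p^*$; (b) at every history that is reached with positive probability and at which the belief of the active player is strictly below $p^*$, he chooses $R$ with probability $0$. -/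

import Mathlib

noncomputable section

namespace Experimentation

/-- The two arms: the safe arm `S` and the risky arm `R`. -/
inductive Arm
  | safe
  | risky
  deriving DecidableEq

/-- The type `θ` of the risky arm: `G` or `B`. -/
inductive State
  | good
  | bad
  deriving DecidableEq

instance : Fintype State := ⟨{State.good, State.bad}, fun x => by cases x <;> simp⟩

/-- What happens at one move: the mover pulls the safe arm, or pulls the risky arm (experiments)
and the experiment fails (yields `0`) or succeeds (yields `m`). -/
inductive Step
  | safe
  | failure
  | success
  deriving DecidableEq

instance : Fintype Step :=
  ⟨{Step.safe, Step.failure, Step.success}, fun x => by cases x <;> simp⟩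

/-- The arm that is chosen at a move. -/
def Step.arm : Step → Arm
  | Step.safe => Arm.safe
  | Step.failure => Arm.risky
  | Step.success => Arm.risky

/-- Whether experiment outcomes are observed by both players or only by the experimenter.
Choices are always observed by both. -/
inductive Monitoring
  | isPrivate
  | isPublic
  deriving DecidableEq

/-- `0` is player 1 and `1` is player 2. -/
abbrev Player := Fin 2

/-- The player who moves after `n` moves: player 1 if `n` is even, player 2 if `n` is odd. -/
def mover (n : ℕ) : Player := if n % 2 = 0 then 0 else 1

/-- What a player observes of one move: the arm chosen, and whether he saw a success. -/
abbrev Obs := Arm × Bool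

/-- Player `i`'s observation of the step `s` that occurs after `n` moves. The success flag is raised
iff the experiment succeeds and its outcome is visible to `i`. -/
def observe (mon : Monitoring) (i : Player) (n : ℕ) (s : Step) : Obs :=
  (s.arm, decide (s = Step.success ∧ (mon = Monitoring.isPublic ∨ mover n = i)))

/-- The (private) history of player `i` when the full sequence of past steps is the given list.
All histories are lists with the most recent move at the head. -/
def view (mon : Monitoring) (i : Player) : List Step → List Obs
  | [] => []
  | s :: l => observe mon i l.length s :: view mon i l

/-- The private history of a player who observed the sequence `h` of choices and no success. -/
def unsuccessful (h : List Arm) : List Obs := h.map fun a => (a, false)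

/-- The number `n_e(h)` of experiments along a sequence of choices. -/
def numExperiments (h : List Arm) : ℕ := h.count Arm.risky

/-- All sequences of `n` steps. -/
def histories : ℕ → Finset (List Step)
  | 0 => {[]}
  | n + 1 => (Finset.univ ×ˢ histories n).image fun x => x.1 :: x.2

/-- The information set of player `i` with private history `o`: the step sequences that `i` cannot
tell apart when he observes `o`. -/
def infoSet (mon : Monitoring) (i : Player) (o : List Obs) : Finset (List Step) :=
  (histories o.length).filter fun l => view mon i l = o

/-- A behavior strategy: the probability of the risky arm at each private history. -/
abbrev Strategy := List Obs → unitInterval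

abbrev Profile := Player → Strategy

/-- A belief system: `π i o θ l` is the probability that player `i` with private history `o` assigns
to the full history consisting of the state `θ` and the past steps `l`. -/
abbrev BeliefSystem := Player → List Obs → State → List Step → ℝ

/-- The first-order belief of player `i` at private history `o`: the probability of `θ = G`. -/
def BeliefSystem.goodProb (π : BeliefSystem) (mon : Monitoring) (i : Player) (o : List Obs) : ℝ :=
  ∑ l ∈ infoSet mon i o, π i o State.good l

/-- A profile is completely mixed if both arms always have positive probability. -/
def Profile.CompletelyMixed (σ : Profile) : Prop :=
  ∀ (i : Player) (o : List Obs), 0 < (σ i o : ℝ) ∧ (σ i o : ℝ) < 1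

/-- A profile is pure if, after every sequence of choices, the move of the active player, when he
was not successful, is deterministic. -/
def Profile.Pure (σ : Profile) : Prop :=
  ∀ h : List Arm, σ (mover h.length) (unsuccessful h) = 0 ∨ σ (mover h.length) (unsuccessful h) = 1

/-- The parameters of the experimentation game. -/
structure Model where
  /-- cost of an experiment -/
  c : ℝ
  /-- payoff of a successful experiment -/
  m : ℝ
  /-- probability of success of an experiment in the good state -/
  lam : ℝ
  /-- discount factor between consecutive periods -/
  δ : ℝ
  /-- prior probability of the good state -/
  p0 : ℝ
  c_pos : 0 < c
  lam_pos : 0 < lam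
  lam_lt_one : lam < 1
  δ_pos : 0 < δ
  δ_lt_one : δ < 1
  p0_pos : 0 < p0
  p0_le_one : p0 ≤ 1
  gain_pos : 0 < lam * m - c

namespace Model

variable (M : Model)

/-- `g = λ m - c`. -/
def g : ℝ := M.lam * M.m - M.c

/-- The belief after a failed experiment, when the belief before is `p`. -/
def phi (p : ℝ) : ℝ := p * (1 - M.lam) / (p * (1 - M.lam) + (1 - p))

/-- The one-player cut-off `p*`. -/
def pStar : ℝ := M.c * (1 - M.δ) / (M.c * (1 - M.δ) + M.g * (1 - M.δ * (1 - M.lam)))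

/-- The encouragement cut-off `p̂`. -/
def pHat : ℝ :=
  M.c * (1 - M.δ) /
    (M.c * (1 - M.δ) + M.g * (1 - M.δ + M.lam * M.δ * (1 + M.δ - M.lam * M.δ)))

def prior : State → ℝ
  | State.good => M.p0
  | State.bad => 1 - M.p0

def successProb : State → ℝ
  | State.good => M.lam
  | State.bad => 0

/-- The payoff of the mover at a step. -/
def flow : Step → ℝ
  | Step.safe => 0
  | Step.failure => -M.c
  | Step.success => M.m - M.c

/-- The probability, given `θ` and the past steps `l`, that the next step is `s`. -/
def stepProb (mon : Monitoring) (σ : Profile) (θ : State) (l : List Step) : Step → ℝ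
  | Step.safe => 1 - (σ (mover l.length) (view mon (mover l.length) l) : ℝ)
  | Step.failure => (σ (mover l.length) (view mon (mover l.length) l) : ℝ) * (1 - M.successProb θ)
  | Step.success => (σ (mover l.length) (view mon (mover l.length) l) : ℝ) * M.successProb θ

theorem successProb_nonneg (θ : State) : 0 ≤ M.successProb θ := by
  cases θ
  · exact M.lam_pos.le
  · exact le_refl 0

theorem successProb_le_one (θ : State) : M.successProb θ ≤ 1 := by
  cases θ
  · exact M.lam_lt_one.le
  · exact zero_le_one

theorem prior_nonneg (θ : State) : 0 ≤ M.prior θ := by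
  cases θ
  · exact M.p0_pos.le
  · exact sub_nonneg.2 M.p0_le_one

theorem stepProb_nonneg (mon : Monitoring) (σ : Profile) (θ : State) (l : List Step) (s : Step) :
    0 ≤ M.stepProb mon σ θ l s := by
  have h := (σ (mover l.length) (view mon (mover l.length) l)).2
  cases s
  · exact sub_nonneg.2 h.2
  · exact mul_nonneg h.1 (sub_nonneg.2 (M.successProb_le_one θ))
  · exact mul_nonneg h.1 (M.successProb_nonneg θ)

theorem stepProb_sum (mon : Monitoring) (σ : Profile) (θ : State) (l : List Step) :
    ∑ s, M.stepProb mon σ θ l s = 1 := by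
  have h : (Finset.univ : Finset Step) = {Step.safe, Step.failure, Step.success} := rfl
  rw [h]
  simp [stepProb]
  ring

theorem prior_sum : ∑ θ, M.prior θ = 1 := by
  have h : (Finset.univ : Finset State) = {State.good, State.bad} := rfl
  rw [h]
  simp [prior]

/-- The probability, conditional on `θ`, that the first moves are as in the given list. -/
def pathProb (mon : Monitoring) (σ : Profile) (θ : State) : List Step → ℝ
  | [] => 1
  | s :: l => pathProb mon σ θ l * M.stepProb mon σ θ l s

/-- The probability that player `i` comes to observe `o`. -/
def obsProb (mon : Monitoring) (σ : Profile) (i : Player) (o : List Obs) : ℝ :=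
  ∑ θ, ∑ l ∈ infoSet mon i o, M.prior θ * M.pathProb mon σ θ l

/-- The beliefs derived from `σ` by Bayes' rule; meaningful where `obsProb` is positive. -/
def bayes (mon : Monitoring) (σ : Profile) : BeliefSystem := fun i o θ l =>
  M.prior θ * M.pathProb mon σ θ l / M.obsProb mon σ i o

/-- The expected flow payoff of player `i` at the move that comes `j` moves after the full history
`(θ, l)`; it is `0` when `i` is not the mover then. -/
def expFlow (mon : Monitoring) (σ : Profile) (i : Player) (θ : State) : ℕ → List Step → ℝ
  | 0, l => if mover l.length = i then ∑ s, M.stepProb mon σ θ l s * M.flow s else 0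
  | j + 1, l => ∑ s, M.stepProb mon σ θ l s * expFlow mon σ i θ j (s :: l)

/-- The expected discounted continuation payoff of player `i` from the full history `(θ, l)` on,
discounted to the current period. The move after `n` moves belongs to the period with index
`n / 2` (a period is a move of player 1 followed by one of player 2). -/
def contPayoff (mon : Monitoring) (σ : Profile) (i : Player) (θ : State) (l : List Step) : ℝ :=
  ∑' j : ℕ, (1 - M.δ) * M.δ ^ ((l.length + j) / 2 - l.length / 2) * M.expFlow mon σ i θ j l

/-- The ex-ante expected payoff of player `i`. -/
def payoff (mon : Monitoring) (σ : Profile) (i : Player) : ℝ :=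
  ∑ θ, M.prior θ * M.contPayoff mon σ i θ []

/-- Nash equilibrium (in behavior strategies). -/
def IsNash (mon : Monitoring) (σ : Profile) : Prop :=
  ∀ (i : Player) (τ : Strategy),
    M.payoff mon (Function.update σ i τ) i ≤ M.payoff mon σ i

/-- `σ` is sequentially rational given `π`: at every private history of the active player, no
strategy of his has a higher expected continuation payoff. -/
def SequentiallyRational (mon : Monitoring) (σ : Profile) (π : BeliefSystem) : Prop :=
  ∀ (i : Player) (l : List Step), mover l.length = i → ∀ τ : Strategy,
    ∑ θ, ∑ x ∈ infoSet mon i (view mon i l),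
        π i (view mon i l) θ x * M.contPayoff mon (Function.update σ i τ) i θ x ≤
      ∑ θ, ∑ x ∈ infoSet mon i (view mon i l),
        π i (view mon i l) θ x * M.contPayoff mon σ i θ x

/-- `π` is consistent with `σ`: the pair is a limit of completely mixed profiles together with the
beliefs that these induce by Bayes' rule. -/
def Consistent (mon : Monitoring) (σ : Profile) (π : BeliefSystem) : Prop :=
  ∃ τ : ℕ → Profile,
    (∀ n, (τ n).CompletelyMixed) ∧
    (∀ (i : Player) (o : List Obs),
      Filter.Tendsto (fun n => (τ n i o : ℝ)) Filter.atTop (nhds (σ i o : ℝ))) ∧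
    ∀ (i : Player) (l : List Step) (θ : State), ∀ x ∈ infoSet mon i (view mon i l),
      Filter.Tendsto (fun n => M.bayes mon (τ n) i (view mon i l) θ x) Filter.atTop
        (nhds (π i (view mon i l) θ x))

/-- Sequential equilibrium. -/
def IsSequentialEq (mon : Monitoring) (σ : Profile) (π : BeliefSystem) : Prop :=
  M.SequentiallyRational mon σ π ∧ M.Consistent mon σ π

/-- Reasonable beliefs (private outcomes), for the active player `i`, when not successful: a choice
of `S` by the other player reveals that all his past experiments failed, and a choice of `R` by the
other player whose previous choice was `S` is not informative. Lists have the last choice first. -/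
def Reasonable (π : BeliefSystem) : Prop :=
  (∀ h : List Arm,
    π.goodProb Monitoring.isPrivate (mover (Arm.safe :: h).length)
        (unsuccessful (Arm.safe :: h)) = M.phi^[numExperiments h] M.p0) ∧
  ∀ (h : List Arm) (a : Arm),
    π.goodProb Monitoring.isPrivate (mover (Arm.risky :: a :: Arm.safe :: h).length)
        (unsuccessful (Arm.risky :: a :: Arm.safe :: h)) =
      M.phi^[numExperiments (a :: Arm.safe :: h)] M.p0

/-- Reasonable sequential equilibrium of the game with private outcomes. -/
def IsReasonableSE (σ : Profile) (π : BeliefSystem) : Prop :=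
  M.IsSequentialEq Monitoring.isPrivate σ π ∧ M.Reasonable π

/-- A full history: the state and the list of past steps. -/
abbrev _root_.Experimentation.Node := State × List Step

instance _root_.Experimentation.instMeasurableSpaceState : MeasurableSpace State := ⊤

instance _root_.Experimentation.instMeasurableSpaceHistory : MeasurableSpace (List Step) := ⊤

instance _root_.Experimentation.instDiscreteState : DiscreteMeasurableSpace State :=
  ⟨fun _ => trivial⟩

instance _root_.Experimentation.instDiscreteHistory : DiscreteMeasurableSpace (List Step) :=
  ⟨fun _ => trivial⟩

/-- The law of the state. -/
def priorPMF : PMF State :=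
  PMF.ofFintype (fun θ => ENNReal.ofReal (M.prior θ)) (by
    rw [← ENNReal.ofReal_sum_of_nonneg fun θ _ => M.prior_nonneg θ, M.prior_sum,
      ENNReal.ofReal_one])

/-- The law of the next step at a full history. -/
def stepPMF (mon : Monitoring) (σ : Profile) (x : Node) : PMF Step :=
  PMF.ofFintype (fun s => ENNReal.ofReal (M.stepProb mon σ x.1 x.2 s)) (by
    rw [← ENNReal.ofReal_sum_of_nonneg fun s _ => M.stepProb_nonneg mon σ x.1 x.2 s,
      M.stepProb_sum, ENNReal.ofReal_one])

/-- The transition law of the full history. -/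
def nodePMF (mon : Monitoring) (σ : Profile) (x : Node) : PMF Node :=
  (M.stepPMF mon σ x).map fun s => (x.1, s :: x.2)

def transition (mon : Monitoring) (σ : Profile) : ProbabilityTheory.Kernel Node Node :=
  ProbabilityTheory.Kernel.ofFunOfCountable fun x => (M.nodePMF mon σ x).toMeasure

instance (mon : Monitoring) (σ : Profile) :
    ProbabilityTheory.IsMarkovKernel (M.transition mon σ) :=
  ⟨fun x => PMF.toMeasure.isProbabilityMeasure (M.nodePMF mon σ x)⟩

/-- The law `P_σ` of the play: of the sequence, for `t = 0, 1, 2, …`, of the full histories after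
`t` moves. -/
def law (mon : Monitoring) (σ : Profile) : MeasureTheory.Measure (ℕ → Node) :=
  ProbabilityTheory.Kernel.trajMeasure (X := fun _ => Node)
    (M.priorPMF.map fun θ => ((θ, []) : Node)).toMeasure
    fun n => (M.transition mon σ).comap
      (fun y : (Finset.Iic n → Node) => y ⟨n, Finset.mem_Iic.2 le_rfl⟩)
      (measurable_pi_apply _)

end Model

end Experimentation

end

/-! ### Moves, private histories and failing paths -/

noncomputable section

namespace Experimentation

/-! Along choices without any success, the two states give the same probability up to the factor `(1
- λ) ^ n_e` (`pathProb_good_failing`), so the beliefs that matter are `φ^n(p₀)`, which decrease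
strictly to `0` when `p₀ < 1`. Even if every later move paid `g`, an experiment would require a
belief of at least `c(1 - δ) / (c(1 - δ) + g)`. Hence the exponents `n` at which somebody
experiments are bounded, and both parts (b) are proved at the greatest one, that is, at the lowest
belief at which anybody experiments.

Public outcomes. At that lowest belief `p` one more failure ends all experimentation, so an
experiment is worth at most `p g (1 - δ(1 - λ)) - (1 - p) c (1 - δ)`, and `p ≥ p*` follows.
Conversely, suppose that play stops for good with positive probability at a belief above `p*`. After
longer and longer runs of safe choices the probability of any further experiment, and with it the
equilibrium payoff, tends to `0`, while experimenting once and going on only after a success earns a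
fixed positive amount (`IsNash.quit_bound`). So along a play in the bad state either the number of
experiments tends to infinity, and beliefs to `0`, or play stops at a belief of at most `p*`.

Private outcomes, (b). A successful player is certain of `G` and experiments for ever. Hence a
prescribed `R` brings no news, an unprescribed one reveals a success if one is deemed possible, and
with reasonable beliefs `S` reveals that everything failed; beliefs are `1` or of the form `φ^n(p₀)`
(`belief_cases`). At the lowest belief `p` with an experiment, let `s` be the probability of `G`
together with a success of the opponent. Playing `S` makes the opponent reveal himself, and copying
him is worth `s g δ`. If the mover experiments and fails, an unsuccessful opponent either stops,
which leads to the comparison that defines `p*`, or experiments in turn. In the latter case the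
mover learns nothing from this `R`, plays `S`, and profits two periods later if the opponent
succeeded. This adds at most `λ(1 - λ) g δ²` per unit of belief, which is the difference between the
two cut-offs: `1 - δ + λδ(1 + δ - λδ) = 1 - δ(1 - λ) + λ(1 - λ)δ²`. See `pHat_le_of_least`.

Private outcomes, (a). In the bad state the choices are deterministic, and (b) bounds the number of
each player's experiments, so play stops; since `p₀ > p*`, it does not stop before the first
experiment. After the opponent's first `S`, the last experimenter could pretend to be successful: he
plays `R` again, the opponent becomes certain of `G`, and experiments as long as the pretender does.
When own failures have brought the pretender down to `p̂`, he plays `S`. The opponent now counts the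
failures of both, is below `p̂`, and by (b) reveals whether he succeeded. If play had stopped above
`p̂`, this deviation would pay, by the inequality `rounds_payoff_bound`. -/

theorem sum_step (f : Step → ℝ) : ∑ s, f s = f Step.safe + f Step.failure + f Step.success := by
  have h : (Finset.univ : Finset Step) = {Step.safe, Step.failure, Step.success} := rfl
  rw [h]
  simp
  ring

theorem sum_state (f : State → ℝ) : ∑ θ, f θ = f State.good + f State.bad := by
  have h : (Finset.univ : Finset State) = {State.good, State.bad} := rfl
  rw [h]
  simp

theorem mover_succ_ne (n : ℕ) : mover (n + 1) ≠ mover n := by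
  unfold mover
  rcases Nat.mod_two_eq_zero_or_one n with h | h
  · have : (n + 1) % 2 = 1 := by omega
    simp [h, this]
  · have : (n + 1) % 2 = 0 := by omega
    simp [h, this]

theorem mover_add_two (n : ℕ) : mover (n + 2) = mover n := by
  unfold mover
  simp

theorem eq_of_ne_of_ne {i j k : Player} (hij : i ≠ j) (hik : i ≠ k) : j = k := by
  fin_cases i <;> fin_cases j <;> fin_cases k <;> simp_all

theorem mover_succ_eq {n : ℕ} {i : Player} (h : mover n ≠ i) : mover (n + 1) = i :=
  eq_of_ne_of_ne (mover_succ_ne n).symm h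

theorem mem_histories {n : ℕ} {l : List Step} : l ∈ histories n ↔ l.length = n := by
  induction n generalizing l with
  | zero => simp [histories]
  | succ n ih =>
    cases l with
    | nil => simp [histories]
    | cons s l => simp [histories, ih]

@[simp] theorem length_view (mon : Monitoring) (i : Player) (l : List Step) :
    (view mon i l).length = l.length := by
  induction l with
  | nil => rfl
  | cons s l ih => simp [view, ih]

theorem mem_infoSet {mon : Monitoring} {i : Player} {o : List Obs} {l : List Step} :
    l ∈ infoSet mon i o ↔ view mon i l = o := by
  simp only [infoSet, Finset.mem_filter, mem_histories]
  constructor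
  · exact fun h => h.2
  · exact fun h => ⟨by rw [← h, length_view], h⟩

theorem view_append (mon : Monitoring) (i : Player) (y l : List Step) :
    ∃ o, o.length = y.length ∧ view mon i (y ++ l) = o ++ view mon i l := by
  induction y with
  | nil => exact ⟨[], rfl, rfl⟩
  | cons s y ih =>
    obtain ⟨o, ho, h⟩ := ih
    exact ⟨observe mon i (y ++ l).length s :: o, by simp [ho], by simp [view, h]⟩

/-- The sequence of steps along a sequence of choices when all experiments fail. -/
def failing (h : List Arm) : List Step :=
  h.map fun a => if a = Arm.risky then Step.failure else Step.safe

@[simp] theorem failing_nil : failing [] = [] := rfl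

@[simp] theorem failing_risky (h : List Arm) :
    failing (Arm.risky :: h) = Step.failure :: failing h := by
  simp [failing]

@[simp] theorem failing_safe (h : List Arm) :
    failing (Arm.safe :: h) = Step.safe :: failing h := by
  simp [failing]

@[simp] theorem length_failing (h : List Arm) : (failing h).length = h.length := by
  simp [failing]

@[simp] theorem unsuccessful_nil : unsuccessful [] = [] := rfl

@[simp] theorem unsuccessful_cons (a : Arm) (h : List Arm) :
    unsuccessful (a :: h) = (a, false) :: unsuccessful h := rfl

@[simp] theorem length_unsuccessful (h : List Arm) : (unsuccessful h).length = h.length := by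
  simp [unsuccessful]

theorem view_failing (mon : Monitoring) (i : Player) (h : List Arm) :
    view mon i (failing h) = unsuccessful h := by
  induction h with
  | nil => rfl
  | cons a h ih => cases a <;> simp [view, observe, Step.arm, ih]

@[simp] theorem numExperiments_nil : numExperiments [] = 0 := rfl

@[simp] theorem numExperiments_risky (h : List Arm) :
    numExperiments (Arm.risky :: h) = numExperiments h + 1 := by
  simp [numExperiments]

@[simp] theorem numExperiments_safe (h : List Arm) :
    numExperiments (Arm.safe :: h) = numExperiments h := by
  simp [numExperiments]

theorem exists_failing_eq {l : List Step} (hl : Step.success ∉ l) :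
    failing (l.map Step.arm) = l := by
  induction l with
  | nil => rfl
  | cons s l ih =>
    simp only [List.mem_cons, not_or] at hl
    cases s
    · simp [Step.arm, ih hl.2]
    · simp [Step.arm, ih hl.2]
    · exact absurd rfl hl.1

/-! ### Discounting, continuation values and path probabilities -/

namespace Model

variable (M : Model)

theorem g_pos : 0 < M.g := M.gain_pos

theorem one_sub_lam_pos : 0 < 1 - M.lam := sub_pos.2 M.lam_lt_one

/-- The expected flow payoff of an experiment in state `θ`. -/
def experimentFlow (θ : State) : ℝ := M.successProb θ * M.m - M.c

@[simp] theorem experimentFlow_good : M.experimentFlow State.good = M.g := rfl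

@[simp] theorem experimentFlow_bad : M.experimentFlow State.bad = -M.c := by
  simp [experimentFlow, successProb]

/-- The present value, discounted to the initial period, of a unit flow at all moves of player `i`
from the move number `n` on. -/
def annuity (i : Player) (n : ℕ) : ℝ :=
  if mover n = i then M.δ ^ (n / 2) else M.δ ^ ((n + 1) / 2)

theorem annuity_nonneg (i : Player) (n : ℕ) : 0 ≤ M.annuity i n := by
  unfold annuity
  have := M.δ_pos
  split_ifs <;> positivity

theorem annuity_of_mover {i : Player} {n : ℕ} (h : mover n = i) :
    M.annuity i n = M.δ ^ (n / 2) := by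
  simp [annuity, h]

theorem annuity_of_ne {i : Player} {n : ℕ} (h : mover n ≠ i) :
    M.annuity i n = M.annuity i (n + 1) := by
  rw [annuity, if_neg h, M.annuity_of_mover (mover_succ_eq h)]

theorem annuity_add_two {i : Player} (n : ℕ) :
    M.annuity i (n + 2) = M.δ * M.annuity i n := by
  have h1 : (n + 2) / 2 = n / 2 + 1 := by omega
  have h2 : (n + 2 + 1) / 2 = (n + 1) / 2 + 1 := by omega
  simp only [annuity, mover_add_two, h1, h2]
  split_ifs <;> ring

theorem annuity_succ_of_mover {i : Player} {n : ℕ} (h : mover n = i) :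
    M.annuity i (n + 1) = M.δ * M.annuity i n := by
  rw [← annuity_add_two, M.annuity_of_ne]
  exact fun h' => mover_succ_ne n (h'.trans h.symm)

theorem annuity_eq (i : Player) (n : ℕ) :
    M.annuity i n =
      (if mover n = i then (1 - M.δ) * M.δ ^ (n / 2) else 0) + M.annuity i (n + 1) := by
  by_cases h : mover n = i
  · rw [if_pos h, M.annuity_succ_of_mover h, M.annuity_of_mover h]
    ring
  · rw [if_neg h, zero_add, M.annuity_of_ne h]

theorem tendsto_annuity (i : Player) (n : ℕ) :
    Filter.Tendsto (fun j => M.annuity i (n + j)) Filter.atTop (nhds 0) := by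
  have h1 : Filter.Tendsto (fun j : ℕ => M.δ ^ (j / 2)) Filter.atTop (nhds 0) :=
    (tendsto_pow_atTop_nhds_zero_of_lt_one M.δ_pos.le M.δ_lt_one).comp
      (Nat.tendsto_div_const_atTop two_ne_zero)
  refine squeeze_zero (fun j => M.annuity_nonneg i _) (fun j => ?_) h1
  unfold annuity
  split_ifs
  · exact pow_le_pow_of_le_one M.δ_pos.le M.δ_lt_one.le (by omega)
  · exact pow_le_pow_of_le_one M.δ_pos.le M.δ_lt_one.le (by omega)

/-- The partial sums telescope: `annuity_eq` makes each term a difference of consecutive annuities.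
-/
theorem hasSum_annuity (i : Player) (n : ℕ) :
    HasSum (fun j => if mover (n + j) = i then (1 - M.δ) * M.δ ^ ((n + j) / 2) else 0)
      (M.annuity i n) := by
  have h0 : ∀ j, 0 ≤ if mover (n + j) = i then (1 - M.δ) * M.δ ^ ((n + j) / 2) else 0 := by
    intro j
    have := M.δ_pos
    have := sub_pos.2 M.δ_lt_one
    split_ifs <;> positivity
  rw [hasSum_iff_tendsto_nat_of_nonneg h0]
  have h1 : ∀ N, ∑ j ∈ Finset.range N,
      (if mover (n + j) = i then (1 - M.δ) * M.δ ^ ((n + j) / 2) else 0) =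
        M.annuity i n - M.annuity i (n + N) := by
    intro N
    induction N with
    | zero => simp
    | succ N ih =>
      rw [Finset.sum_range_succ, ih, M.annuity_eq i (n + N)]
      ring_nf
  simp_rw [h1]
  simpa using (M.tendsto_annuity i n).const_sub (M.annuity i n)

variable (mon : Monitoring) (σ : Profile) (i : Player) (θ : State)

theorem sum_stepProb_flow (l : List Step) :
    ∑ s, M.stepProb mon σ θ l s * M.flow s =
      (σ (mover l.length) (view mon (mover l.length) l) : ℝ) * M.experimentFlow θ := by
  rw [sum_step]
  simp only [stepProb, flow, experimentFlow]
  ring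

/-- The continuation payoff at a full history, discounted to the initial period. -/
def value (l : List Step) : ℝ := M.δ ^ (l.length / 2) * M.contPayoff mon σ i θ l

theorem value_eq_tsum (l : List Step) :
    M.value mon σ i θ l =
      ∑' j : ℕ, (1 - M.δ) * M.δ ^ ((l.length + j) / 2) * M.expFlow mon σ i θ j l := by
  rw [value, contPayoff, ← tsum_mul_left]
  refine tsum_congr fun j => ?_
  have h : (l.length + j) / 2 = l.length / 2 + ((l.length + j) / 2 - l.length / 2) := by omega
  conv_rhs => rw [h, pow_add]
  ring

variable {mon σ i θ}

/-- The expected flow is an average over extensions of `l`, so a bound that holds at each of them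
survives; at the opponent's moves the flow is zero. -/
theorem expFlow_le {C : ℝ} {l : List Step}
    (h : ∀ y : List Step, mover (y ++ l).length = i →
      (σ i (view mon i (y ++ l)) : ℝ) * M.experimentFlow θ ≤ C) (j : ℕ) :
    M.expFlow mon σ i θ j l ≤ if mover (l.length + j) = i then C else 0 := by
  induction j generalizing l with
  | zero =>
    simp only [expFlow, add_zero]
    split_ifs with hm
    · rw [sum_stepProb_flow, hm]
      exact h [] hm
    · rfl
  | succ j ih =>
    simp only [expFlow]
    calc _ ≤ ∑ s, M.stepProb mon σ θ l s * (if mover (l.length + (j + 1)) = i then C else 0) := by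
          refine Finset.sum_le_sum fun s _ =>
            mul_le_mul_of_nonneg_left ?_ (M.stepProb_nonneg mon σ θ l s)
          have := ih (l := s :: l) fun y hy => by
            have := h (y ++ [s])
            simp only [List.append_assoc, List.singleton_append] at this
            exact this hy
          rwa [List.length_cons, add_right_comm, add_assoc] at this
      _ = _ := by rw [← Finset.sum_mul, M.stepProb_sum, one_mul]

theorem le_expFlow {C : ℝ} {l : List Step}
    (h : ∀ y : List Step, mover (y ++ l).length = i →
      C ≤ (σ i (view mon i (y ++ l)) : ℝ) * M.experimentFlow θ) (j : ℕ) :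
    (if mover (l.length + j) = i then C else 0) ≤ M.expFlow mon σ i θ j l := by
  induction j generalizing l with
  | zero =>
    simp only [expFlow, add_zero]
    split_ifs with hm
    · rw [sum_stepProb_flow, hm]
      exact h [] hm
    · rfl
  | succ j ih =>
    simp only [expFlow]
    calc _ = ∑ s, M.stepProb mon σ θ l s * (if mover (l.length + (j + 1)) = i then C else 0) := by
          rw [← Finset.sum_mul, M.stepProb_sum, one_mul]
      _ ≤ _ := by
          refine Finset.sum_le_sum fun s _ =>
            mul_le_mul_of_nonneg_left ?_ (M.stepProb_nonneg mon σ θ l s)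
          have := ih (l := s :: l) fun y hy => by
            have := h (y ++ [s])
            simp only [List.append_assoc, List.singleton_append] at this
            exact this hy
          rwa [List.length_cons, add_right_comm, add_assoc] at this

theorem strategy_mul_le (p : unitInterval) : (p : ℝ) * M.experimentFlow θ ≤ M.g := by
  have h1 := p.2.1
  have h2 := p.2.2
  have := M.g_pos
  have := M.c_pos
  cases θ
  · simp only [experimentFlow_good]
    nlinarith
  · simp only [experimentFlow_bad]
    nlinarith

theorem le_strategy_mul (p : unitInterval) : -M.c ≤ (p : ℝ) * M.experimentFlow θ := by
  have h1 := p.2.1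
  have h2 := p.2.2
  have := M.g_pos
  have := M.c_pos
  cases θ
  · simp only [experimentFlow_good]
    nlinarith
  · simp only [experimentFlow_bad]
    nlinarith

theorem summable_value (l : List Step) :
    Summable fun j : ℕ =>
      (1 - M.δ) * M.δ ^ ((l.length + j) / 2) * M.expFlow mon σ i θ j l := by
  refine Summable.of_norm_bounded
    ((M.hasSum_annuity i l.length).summable.mul_left (M.g + M.c)) fun j => ?_
  have h1 := M.expFlow_le (mon := mon) (σ := σ) (i := i) (θ := θ) (l := l)
    (fun y _ => M.strategy_mul_le _) j
  have h2 := M.le_expFlow (mon := mon) (σ := σ) (i := i) (θ := θ) (l := l)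
    (fun y _ => M.le_strategy_mul _) j
  have h3 := M.g_pos
  have h4 := M.c_pos
  have h5 : 0 ≤ (1 - M.δ) * M.δ ^ ((l.length + j) / 2) :=
    mul_nonneg (sub_pos.2 M.δ_lt_one).le (pow_nonneg M.δ_pos.le _)
  rw [Real.norm_eq_abs, abs_mul, abs_of_nonneg h5]
  split_ifs at h1 h2 ⊢
  · rw [mul_comm (M.g + M.c)]
    exact mul_le_mul_of_nonneg_left (abs_le.2 ⟨by linarith, by linarith⟩) h5
  · rw [le_antisymm h1 h2]
    simp

theorem value_le_of_expFlow_le {C : ℝ} {l : List Step}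
    (h : ∀ j, M.expFlow mon σ i θ j l ≤ if mover (l.length + j) = i then C else 0) :
    M.value mon σ i θ l ≤ C * M.annuity i l.length := by
  rw [value_eq_tsum, ← (M.hasSum_annuity i l.length).tsum_eq, ← tsum_mul_left]
  refine (M.summable_value l).tsum_le_tsum (fun j => ?_)
    ((M.hasSum_annuity i l.length).summable.mul_left C)
  have h5 : 0 ≤ (1 - M.δ) * M.δ ^ ((l.length + j) / 2) :=
    mul_nonneg (sub_pos.2 M.δ_lt_one).le (pow_nonneg M.δ_pos.le _)
  refine (mul_le_mul_of_nonneg_left (h j) h5).trans (le_of_eq ?_)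
  split_ifs <;> ring

theorem le_value_of_le_expFlow {C : ℝ} {l : List Step}
    (h : ∀ j, (if mover (l.length + j) = i then C else 0) ≤ M.expFlow mon σ i θ j l) :
    C * M.annuity i l.length ≤ M.value mon σ i θ l := by
  rw [value_eq_tsum, ← (M.hasSum_annuity i l.length).tsum_eq, ← tsum_mul_left]
  refine ((M.hasSum_annuity i l.length).summable.mul_left C).tsum_le_tsum (fun j => ?_)
    (M.summable_value l)
  have h5 : 0 ≤ (1 - M.δ) * M.δ ^ ((l.length + j) / 2) :=
    mul_nonneg (sub_pos.2 M.δ_lt_one).le (pow_nonneg M.δ_pos.le _)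
  refine le_trans (le_of_eq ?_) (mul_le_mul_of_nonneg_left (h j) h5)
  split_ifs <;> ring

theorem value_le (l : List Step) : M.value mon σ i θ l ≤ M.g * M.annuity i l.length :=
  M.value_le_of_expFlow_le (M.expFlow_le fun _ _ => M.strategy_mul_le _)

theorem value_bad_nonpos (l : List Step) : M.value mon σ i State.bad l ≤ 0 := by
  have := M.value_le_of_expFlow_le (C := 0)
    (M.expFlow_le (mon := mon) (σ := σ) (i := i) (θ := State.bad) (l := l) fun y _ => by
      rw [experimentFlow_bad]
      exact mul_nonpos_of_nonneg_of_nonpos (σ i _).2.1 (neg_nonpos.2 M.c_pos.le))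
  rwa [zero_mul] at this

theorem value_eq_zero_of_abstains {l : List Step}
    (h : ∀ y : List Step, mover (y ++ l).length = i → σ i (view mon i (y ++ l)) = 0) :
    M.value mon σ i θ l = 0 := by
  have h0 : ∀ y : List Step, mover (y ++ l).length = i →
      (σ i (view mon i (y ++ l)) : ℝ) * M.experimentFlow θ = 0 := fun y hy => by
    rw [h y hy, Set.Icc.coe_zero, zero_mul]
  refine le_antisymm ?_ ?_
  · have := M.value_le_of_expFlow_le (M.expFlow_le fun y hy => (h0 y hy).le)
    rwa [zero_mul] at this
  · have := M.le_value_of_le_expFlow (M.le_expFlow fun y hy => (h0 y hy).ge)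
    rwa [zero_mul] at this

theorem value_eq_of_experiments {l : List Step}
    (h : ∀ y : List Step, mover (y ++ l).length = i → σ i (view mon i (y ++ l)) = 1) :
    M.value mon σ i State.good l = M.g * M.annuity i l.length := by
  refine le_antisymm (M.value_le l) ?_
  exact M.le_value_of_le_expFlow (M.le_expFlow fun y hy => by simp [h y hy])

/-- The Bellman equation. As `value` is discounted to the initial period, no discount factor appears
between a history and its successors. -/
theorem value_eq_step (l : List Step) :
    M.value mon σ i θ l =
      (if mover l.length = i then
        (1 - M.δ) * M.δ ^ (l.length / 2) *
          ((σ (mover l.length) (view mon (mover l.length) l) : ℝ) * M.experimentFlow θ) else 0) +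
      ∑ s, M.stepProb mon σ θ l s * M.value mon σ i θ (s :: l) := by
  rw [value_eq_tsum, (M.summable_value l).tsum_eq_zero_add]
  congr 1
  · simp only [expFlow, add_zero, sum_stepProb_flow]
    split_ifs <;> ring
  · simp_rw [value_eq_tsum, ← tsum_mul_left]
    rw [← Summable.tsum_finsetSum fun s _ => (M.summable_value (s :: l)).mul_left _]
    refine tsum_congr fun j => ?_
    rw [expFlow, Finset.mul_sum]
    refine Finset.sum_congr rfl fun s _ => ?_
    rw [List.length_cons, add_right_comm l.length 1 j, ← add_assoc]
    ring

theorem value_of_safe {l : List Step}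
    (h : σ (mover l.length) (view mon (mover l.length) l) = 0) :
    M.value mon σ i θ l = M.value mon σ i θ (Step.safe :: l) := by
  rw [value_eq_step, sum_step]
  simp [stepProb, h]

theorem value_of_risky {l : List Step}
    (h : σ (mover l.length) (view mon (mover l.length) l) = 1) :
    M.value mon σ i θ l =
      (if mover l.length = i then (1 - M.δ) * M.annuity i l.length * M.experimentFlow θ else 0) +
      ((1 - M.successProb θ) * M.value mon σ i θ (Step.failure :: l) +
        M.successProb θ * M.value mon σ i θ (Step.success :: l)) := by
  rw [value_eq_step, sum_step]
  simp only [stepProb, h, Set.Icc.coe_one, one_mul, sub_self, zero_mul, zero_add]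
  congr 1
  split_ifs with hm
  · rw [M.annuity_of_mover hm]
  · rfl

/-- Only the all-safe continuation has positive probability, so nothing need be known about
behaviour off it. -/
theorem value_eq_zero_of_safe_path {l : List Step}
    (h : ∀ k : ℕ, σ (mover (List.replicate k Step.safe ++ l).length)
      (view mon (mover (List.replicate k Step.safe ++ l).length)
        (List.replicate k Step.safe ++ l)) = 0) :
    M.value mon σ i θ l = 0 := by
  have key : ∀ j, M.expFlow mon σ i θ j l = 0 := by
    intro j
    induction j generalizing l with
    | zero =>
      have := h 0
      simp only [List.replicate_zero, List.nil_append] at this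
      simp [expFlow, sum_stepProb_flow, this]
    | succ j ih =>
      have h0 := h 0
      simp only [List.replicate_zero, List.nil_append] at h0
      have h1 := ih (l := Step.safe :: l) fun k => by
        have := h (k + 1)
        rwa [List.replicate_succ', List.append_assoc, List.singleton_append] at this
      rw [expFlow, sum_step]
      simp [stepProb, h0, h1]
  rw [value_eq_tsum]
  simp [key]

theorem value_congr {σ' : Profile} {l : List Step}
    (h : ∀ y : List Step, σ (mover (y ++ l).length) (view mon (mover (y ++ l).length) (y ++ l)) =
      σ' (mover (y ++ l).length) (view mon (mover (y ++ l).length) (y ++ l))) :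
    M.value mon σ i θ l = M.value mon σ' i θ l := by
  have key : ∀ j, M.expFlow mon σ i θ j l = M.expFlow mon σ' i θ j l := by
    intro j
    induction j generalizing l with
    | zero =>
      have := h []
      simp only [List.nil_append] at this
      simp only [expFlow, sum_stepProb_flow, this]
    | succ j ih =>
      have h0 := h []
      simp only [List.nil_append] at h0
      simp only [expFlow]
      refine Finset.sum_congr rfl fun s _ => ?_
      rw [ih (l := s :: l) fun y => by
        have := h (y ++ [s])
        rwa [List.append_assoc, List.singleton_append] at this]
      congr 1
      cases s <;> simp [stepProb, h0]
  simp_rw [value_eq_tsum, key]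

theorem pathProb_nonneg (mon : Monitoring) (σ : Profile) (θ : State) (l : List Step) :
    0 ≤ M.pathProb mon σ θ l := by
  induction l with
  | nil => exact zero_le_one
  | cons s l ih => exact mul_nonneg ih (M.stepProb_nonneg mon σ θ l s)

theorem pathProb_bad_of_success {l : List Step} (h : Step.success ∈ l) :
    M.pathProb mon σ State.bad l = 0 := by
  induction l with
  | nil => simp at h
  | cons s l ih =>
    rw [pathProb]
    rcases List.mem_cons.1 h with h | h
    · simp [← h, stepProb, successProb]
    · simp [ih h]

/-- Choice probabilities depend on the past steps but not on the state; only the probabilities of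
failure differ between the states. -/
theorem pathProb_good_failing (h : List Arm) :
    M.pathProb mon σ State.good (failing h) =
      (1 - M.lam) ^ numExperiments h * M.pathProb mon σ State.bad (failing h) := by
  induction h with
  | nil => simp [pathProb]
  | cons a h ih =>
    cases a
    · simp only [failing_safe, pathProb, ih, numExperiments_safe, stepProb]
      ring
    · simp only [failing_risky, pathProb, ih, numExperiments_risky, stepProb, successProb]
      ring

/-! ### The updating map -/

/-- In terms of the odds `p / (1 - p)`, the map `phi` is multiplication by `1 - λ`. -/
theorem phi_iterate (hp : M.p0 < 1) (n : ℕ) :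
    M.phi^[n] M.p0 =
      M.p0 * (1 - M.lam) ^ n / (M.p0 * (1 - M.lam) ^ n + (1 - M.p0)) := by
  have hx := M.one_sub_lam_pos
  have hp0 := M.p0_pos
  induction n with
  | zero => simp
  | succ n ih =>
    have h1 : 0 < M.p0 * (1 - M.lam) ^ n := by positivity
    have h2 : 0 < M.p0 * (1 - M.lam) ^ n + (1 - M.p0) := by linarith
    have h3 : 0 < M.p0 * (1 - M.lam) ^ (n + 1) := by positivity
    have h4 : 0 < M.p0 * (1 - M.lam) ^ (n + 1) + (1 - M.p0) := by linarith
    rw [Function.iterate_succ_apply', ih, phi]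
    have h5 : M.p0 * (1 - M.lam) ^ n / (M.p0 * (1 - M.lam) ^ n + (1 - M.p0)) * (1 - M.lam) +
        (1 - M.p0 * (1 - M.lam) ^ n / (M.p0 * (1 - M.lam) ^ n + (1 - M.p0))) =
        (M.p0 * (1 - M.lam) ^ (n + 1) + (1 - M.p0)) /
          (M.p0 * (1 - M.lam) ^ n + (1 - M.p0)) := by
      field_simp
      ring
    rw [h5, pow_succ]
    field_simp

theorem phi_iterate_denom_pos (hp : M.p0 < 1) (n : ℕ) :
    0 < M.p0 * (1 - M.lam) ^ n + (1 - M.p0) := by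
  have hx := M.one_sub_lam_pos
  have hp0 := M.p0_pos
  have h1 : 0 < M.p0 * (1 - M.lam) ^ n := by positivity
  linarith

theorem phi_iterate_pos (hp : M.p0 < 1) (n : ℕ) : 0 < M.phi^[n] M.p0 := by
  rw [M.phi_iterate hp]
  exact div_pos (mul_pos M.p0_pos (pow_pos M.one_sub_lam_pos n)) (M.phi_iterate_denom_pos hp n)

theorem phi_iterate_lt_one (hp : M.p0 < 1) (n : ℕ) : M.phi^[n] M.p0 < 1 := by
  rw [M.phi_iterate hp, div_lt_one (M.phi_iterate_denom_pos hp n)]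
  linarith

theorem phi_lt {p : ℝ} (h0 : 0 < p) (h1 : p < 1) : M.phi p < p := by
  have hx := M.one_sub_lam_pos
  have hl := M.lam_pos
  rw [phi, div_lt_iff₀ (by nlinarith)]
  have : 0 < p * (1 - p) * M.lam := by
    have := sub_pos.2 h1
    positivity
  nlinarith

theorem phi_one : M.phi 1 = 1 := by
  have := M.one_sub_lam_pos
  rw [phi]
  field_simp
  ring

theorem phi_iterate_strictAnti (hp : M.p0 < 1) : StrictAnti fun n => M.phi^[n] M.p0 :=
  strictAnti_nat_of_succ_lt fun n => by
    rw [Function.iterate_succ_apply']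
    exact M.phi_lt (M.phi_iterate_pos hp n) (M.phi_iterate_lt_one hp n)

theorem tendsto_phi_iterate (hp : M.p0 < 1) :
    Filter.Tendsto (fun n => M.phi^[n] M.p0) Filter.atTop (nhds 0) := by
  simp_rw [M.phi_iterate hp]
  have h1 : Filter.Tendsto (fun n : ℕ => M.p0 * (1 - M.lam) ^ n) Filter.atTop (nhds 0) := by
    simpa using (tendsto_pow_atTop_nhds_zero_of_lt_one M.one_sub_lam_pos.le
      (by linarith [M.lam_pos])).const_mul M.p0
  have h2 : (0 : ℝ) + (1 - M.p0) ≠ 0 := by linarith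
  have h3 := h1.div (h1.add_const (1 - M.p0)) h2
  rw [zero_div] at h3
  exact h3

theorem exists_phi_iterate_lt (hp : M.p0 < 1) {q : ℝ} (hq : 0 < q) :
    ∃ n, ∀ k, n ≤ k → M.phi^[k] M.p0 < q := by
  have := (M.tendsto_phi_iterate hp).eventually (gt_mem_nhds hq)
  exact Filter.eventually_atTop.1 this

theorem pHat_denom_pos :
    0 < M.c * (1 - M.δ) + M.g * (1 - M.δ + M.lam * M.δ * (1 + M.δ - M.lam * M.δ)) := by
  have h1 := sub_pos.2 M.δ_lt_one
  have h2 := M.δ_pos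
  have h3 := M.lam_pos
  have h4 := M.one_sub_lam_pos
  have h5 := M.g_pos
  have h6 := M.c_pos
  have : 1 + M.δ - M.lam * M.δ = 1 + M.δ * (1 - M.lam) := by ring
  rw [this]
  positivity

theorem pStar_denom_pos : 0 < M.c * (1 - M.δ) + M.g * (1 - M.δ * (1 - M.lam)) := by
  have h1 := sub_pos.2 M.δ_lt_one
  have h2 := M.δ_pos
  have h3 := M.lam_pos
  have h5 := M.g_pos
  have h6 := M.c_pos
  have : 1 - M.δ * (1 - M.lam) = 1 - M.δ + M.δ * M.lam := by ring
  rw [this]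
  positivity

theorem pHat_pos : 0 < M.pHat :=
  div_pos (mul_pos M.c_pos (sub_pos.2 M.δ_lt_one)) M.pHat_denom_pos

theorem pStar_pos : 0 < M.pStar :=
  div_pos (mul_pos M.c_pos (sub_pos.2 M.δ_lt_one)) M.pStar_denom_pos

/-- Without denominators the cut-off compares discounted gains in the good state with the cost of
one experiment in the bad state; incentive constraints appear in this form below. -/
theorem lt_pHat_iff {p : ℝ} : p < M.pHat ↔
    p * M.g * (1 - M.δ + M.lam * M.δ * (1 + M.δ - M.lam * M.δ)) <
      M.c * (1 - M.δ) * (1 - p) := by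
  rw [pHat, lt_div_iff₀ M.pHat_denom_pos]
  constructor <;> intro h <;> linarith

theorem lt_pStar_iff {p : ℝ} : p < M.pStar ↔
    p * M.g * (1 - M.δ * (1 - M.lam)) < M.c * (1 - M.δ) * (1 - p) := by
  rw [pStar, lt_div_iff₀ M.pStar_denom_pos]
  constructor <;> intro h <;> linarith

theorem pHat_lt_iff {p : ℝ} : M.pHat < p ↔ M.c * (1 - M.δ) * (1 - p) <
    p * M.g * (1 - M.δ + M.lam * M.δ * (1 + M.δ - M.lam * M.δ)) := by
  rw [pHat, div_lt_iff₀ M.pHat_denom_pos]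
  constructor <;> intro h <;> linarith

theorem pStar_lt_iff {p : ℝ} : M.pStar < p ↔ M.c * (1 - M.δ) * (1 - p) <
    p * M.g * (1 - M.δ * (1 - M.lam)) := by
  rw [pStar, div_lt_iff₀ M.pStar_denom_pos]
  constructor <;> intro h <;> linarith

theorem pHat_lt_one : M.pHat < 1 := by
  rw [pHat, div_lt_one M.pHat_denom_pos]
  have h1 := sub_pos.2 M.δ_lt_one
  have h2 := M.δ_pos
  have h3 := M.lam_pos
  have h4 := M.one_sub_lam_pos
  have h5 := M.g_pos
  have : 1 + M.δ - M.lam * M.δ = 1 + M.δ * (1 - M.lam) := by ring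
  rw [this]
  simp only [lt_add_iff_pos_right]
  positivity

theorem pStar_lt_one : M.pStar < 1 := by
  rw [pStar, div_lt_one M.pStar_denom_pos]
  have h1 := sub_pos.2 M.δ_lt_one
  have h2 := M.δ_pos
  have h3 := M.lam_pos
  have h5 := M.g_pos
  have : 1 - M.δ * (1 - M.lam) = 1 - M.δ + M.δ * M.lam := by ring
  rw [this]
  simp only [lt_add_iff_pos_right]
  positivity

end Model

namespace Model
open MeasureTheory ProbabilityTheory

variable (M : Model) (mon : Monitoring) (σ : Profile)

/-! ### The law of the play -/

instance : Countable State := Finite.to_countable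

instance : Countable Step := Finite.to_countable

instance : IsProbabilityMeasure
    (M.priorPMF.map fun θ => ((θ, []) : Node)).toMeasure :=
  PMF.toMeasure.isProbabilityMeasure _

/-- The one-step Markov property: the kernel looks only at the last coordinate, hence is constant on
the event that this coordinate is `x`. -/
theorem law_step_apply (n : ℕ) (x y : Node) :
    M.law mon σ {ω | ω n = x ∧ ω (n + 1) = y} =
      M.law mon σ {ω | ω n = x} * M.nodePMF mon σ x y := by
  have h := Kernel.map_frestrictLe_trajMeasure_compProd_eq_map_trajMeasure
    (X := fun _ => Node)
    (μ₀ := (M.priorPMF.map fun θ => ((θ, []) : Node)).toMeasure)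
    (κ := fun n => (M.transition mon σ).comap
      (fun y : (Finset.Iic n → Node) => y ⟨n, Finset.mem_Iic.2 le_rfl⟩)
      (measurable_pi_apply _)) (a := n)
  have hm : Measurable fun z : (Finset.Iic n → Node) => z ⟨n, Finset.mem_Iic.2 le_rfl⟩ :=
    measurable_pi_apply _
  have hs : MeasurableSet {z : (Finset.Iic n → Node) | z ⟨n, Finset.mem_Iic.2 le_rfl⟩ = x} :=
    hm (MeasurableSet.singleton x)
  have h1 := DFunLike.congr_fun h ({z : (Finset.Iic n → Node) |
    z ⟨n, Finset.mem_Iic.2 le_rfl⟩ = x} ×ˢ {y})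
  rw [Measure.compProd_apply_prod hs (MeasurableSet.singleton y),
    Measure.map_apply (by fun_prop) (hs.prod (MeasurableSet.singleton y))] at h1
  have h2 : (fun ω : ℕ → Node => (Preorder.frestrictLe (π := fun _ => Node) n ω, ω (n + 1))) ⁻¹'
      ({z : (Finset.Iic n → Node) | z ⟨n, Finset.mem_Iic.2 le_rfl⟩ = x} ×ˢ {y}) =
      {ω | ω n = x ∧ ω (n + 1) = y} := by
    ext ω
    simp [Preorder.frestrictLe]
  rw [h2] at h1
  rw [law, ← h1, setLIntegral_congr_fun (g := fun _ => M.nodePMF mon σ x y) hs,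
    setLIntegral_const, Measure.map_apply (by fun_prop) hs, mul_comm]
  · rfl
  · intro z hz
    simp only [Set.mem_ofPred_eq] at hz
    simp only [Kernel.comap_apply, hz, transition, Kernel.ofFunOfCountable]
    exact PMF.toMeasure_apply_singleton _ _ (MeasurableSet.singleton y)

theorem nodePMF_cons (θ : State) (l : List Step) (s : Step) :
    M.nodePMF mon σ (θ, l) (θ, s :: l) = ENNReal.ofReal (M.stepProb mon σ θ l s) := by
  rw [nodePMF, PMF.map_apply, tsum_eq_single s]
  · simp [stepPMF]
  · intro s' hs'
    simp [hs'.symm]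

theorem exists_step_of_nodePMF_ne_zero {x y : Node} (h : M.nodePMF mon σ x y ≠ 0) :
    ∃ s, y = (x.1, s :: x.2) ∧ 0 < M.stepProb mon σ x.1 x.2 s := by
  have h1 : y ∈ (M.nodePMF mon σ x).support := h
  rw [nodePMF, PMF.support_map] at h1
  obtain ⟨s, hs, rfl⟩ := h1
  refine ⟨s, rfl, ?_⟩
  simpa [stepPMF] using hs

/-- There are countably many pairs of nodes, so all transitions of probability zero can be discarded
together. -/
theorem ae_law_step : ∀ᵐ ω ∂(M.law mon σ), ∀ n, ∃ s, ω (n + 1) = ((ω n).1, s :: (ω n).2) ∧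
    0 < M.stepProb mon σ (ω n).1 (ω n).2 s := by
  refine ae_all_iff.2 fun n => ?_
  have h : ∀ᵐ ω ∂(M.law mon σ), ∀ x y : Node, M.nodePMF mon σ x y = 0 →
      ¬ (ω n = x ∧ ω (n + 1) = y) := by
    refine ae_all_iff.2 fun x => ae_all_iff.2 fun y => ?_
    by_cases hxy : M.nodePMF mon σ x y = 0
    · have h0 := M.law_step_apply mon σ n x y
      rw [hxy, mul_zero] at h0
      filter_upwards [measure_eq_zero_iff_ae_notMem.1 h0] with ω hω _ using hω
    · exact Filter.Eventually.of_forall fun ω h => absurd h hxy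
  filter_upwards [h] with ω hω
  exact M.exists_step_of_nodePMF_ne_zero mon σ fun h0 => hω _ _ h0 ⟨rfl, rfl⟩

theorem law_map_zero : (M.law mon σ).map (fun ω => ω 0) =
    (M.priorPMF.map fun θ => ((θ, []) : Node)).toMeasure := by
  have h : (fun ω : ℕ → Node => ω 0) =
      (fun z : (Finset.Iic 0 → Node) => z ⟨0, Finset.mem_Iic.2 le_rfl⟩) ∘
        Preorder.frestrictLe (π := fun _ => Node) 0 := rfl
  rw [h, ← Measure.map_map (by fun_prop) (by fun_prop), law, Kernel.trajMeasure,
    Measure.map_comp _ _ (by fun_prop), Kernel.traj_map_frestrictLe, Kernel.partialTraj_self,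
    Measure.id_comp, Measure.map_map (by fun_prop) (by fun_prop)]
  exact Measure.map_id

theorem law_zero_apply (x : Node) : M.law mon σ {ω | ω 0 = x} =
    (M.priorPMF.map fun θ => ((θ, []) : Node)) x := by
  rw [← PMF.toMeasure_apply_singleton _ _ (MeasurableSet.singleton x), ← M.law_map_zero mon σ,
    Measure.map_apply (measurable_pi_apply 0) (MeasurableSet.singleton x)]
  rfl

theorem ae_law_zero : ∀ᵐ ω ∂(M.law mon σ), (ω 0).2 = [] ∧ 0 < M.prior (ω 0).1 := by
  have h : ∀ᵐ ω ∂(M.law mon σ), ∀ x : Node,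
      (M.priorPMF.map fun θ => ((θ, []) : Node)) x = 0 → ω 0 ≠ x := by
    refine ae_all_iff.2 fun x => ?_
    by_cases hx : (M.priorPMF.map fun θ => ((θ, []) : Node)) x = 0
    · have h0 := M.law_zero_apply mon σ x
      rw [hx] at h0
      filter_upwards [measure_eq_zero_iff_ae_notMem.1 h0] with ω hω _ using hω
    · exact Filter.Eventually.of_forall fun ω h => absurd h hx
  filter_upwards [h] with ω hω
  have h1 : (ω 0) ∈ (M.priorPMF.map fun θ => ((θ, []) : Node)).support :=
    fun h0 => hω _ h0 rfl
  rw [PMF.support_map] at h1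
  obtain ⟨θ, hθ, h2⟩ := h1
  rw [← h2]
  exact ⟨rfl, by simpa [priorPMF] using hθ⟩

/-- An upper bound is enough for its purpose, which is to show that stopping too early is a null
event. -/
theorem law_apply_le (θ : State) (l : List Step) :
    M.law mon σ {ω | ω l.length = (θ, l)} ≤
      ENNReal.ofReal (M.prior θ * M.pathProb mon σ θ l) := by
  induction l with
  | nil =>
    rw [List.length_nil, law_zero_apply, PMF.map_apply, tsum_eq_single θ]
    · simp [priorPMF, pathProb]
    · intro θ' h
      simp [h.symm]
  | cons s l ih =>
    calc _ ≤ M.law mon σ {ω | ω l.length = (θ, l) ∧ ω (l.length + 1) = (θ, s :: l)} := by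
          refine measure_mono_ae ?_
          filter_upwards [M.ae_law_step mon σ] with ω hω h
          obtain ⟨s', h1, -⟩ := hω l.length
          have h2 : ω (l.length + 1) = (θ, s :: l) := h
          rw [h2] at h1
          simp only [Prod.mk.injEq, List.cons.injEq] at h1
          exact ⟨Prod.ext h1.1.symm h1.2.2.symm, h2⟩
      _ ≤ _ := by
          rw [law_step_apply, nodePMF_cons, pathProb, ← mul_assoc, ENNReal.ofReal_mul
            (mul_nonneg (M.prior_nonneg θ) (M.pathProb_nonneg mon σ θ l))]
          gcongr

/-- Along almost every play, the state is constant, and the history after `n` moves has length `n`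
and positive probability. -/
theorem ae_law_path : ∀ᵐ ω ∂(M.law mon σ), ∀ n, (ω n).1 = (ω 0).1 ∧ (ω n).2.length = n ∧
    0 < M.prior (ω n).1 * M.pathProb mon σ (ω n).1 (ω n).2 := by
  filter_upwards [M.ae_law_step mon σ, M.ae_law_zero mon σ] with ω h1 h2 n
  induction n with
  | zero => simp [h2.1, h2.2, pathProb]
  | succ n ih =>
    obtain ⟨s, hs, hpos⟩ := h1 n
    rw [hs]
    refine ⟨ih.1, by simp [ih.2.1], ?_⟩
    rw [pathProb, ← mul_assoc]
    exact mul_pos ih.2.2 hpos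

end Model

/-! ### Public outcomes: deviations at full histories and no experiments below `p*` -/

theorem failing_replicate_append (k : ℕ) (h : List Arm) :
    failing (List.replicate k Arm.safe ++ h) = List.replicate k Step.safe ++ failing h := by
  induction k with
  | zero => rfl
  | succ k ih => simp [List.replicate_succ, ih]

theorem numExperiments_replicate_append (k : ℕ) (h : List Arm) :
    numExperiments (List.replicate k Arm.safe ++ h) = numExperiments h := by
  induction k with
  | zero => rfl
  | succ k ih => simp [List.replicate_succ, ih]

/-- A public observation determines the step. Information sets are therefore singletons, and a
strategy may be given as a function of the full past. -/
theorem view_isPublic_injective (i : Player) :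
    Function.Injective (view Monitoring.isPublic i) := by
  intro x
  induction x with
  | nil =>
    intro y h
    cases y with
    | nil => rfl
    | cons s y => simp [view] at h
  | cons s x ih =>
    intro y h
    cases y with
    | nil => simp [view] at h
    | cons s' y =>
      simp only [view, List.cons.injEq] at h
      rw [ih h.2]
      congr 1
      have h1 := h.1
      cases s <;> cases s' <;> simp [observe, Step.arm] at h1 ⊢

theorem infoSet_isPublic (i : Player) (l : List Step) :
    infoSet Monitoring.isPublic i (view Monitoring.isPublic i l) = {l} := by
  ext x
  rw [mem_infoSet, Finset.mem_singleton]
  exact ⟨fun h => view_isPublic_injective i h, fun h => by rw [h]⟩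

namespace Model

variable (M : Model)

/-- The probability of a full history. -/
def joint (mon : Monitoring) (σ : Profile) (θ : State) (l : List Step) : ℝ :=
  M.prior θ * M.pathProb mon σ θ l

theorem joint_nonneg (mon : Monitoring) (σ : Profile) (θ : State) (l : List Step) :
    0 ≤ M.joint mon σ θ l :=
  mul_nonneg (M.prior_nonneg θ) (M.pathProb_nonneg mon σ θ l)

theorem joint_good_failing (mon : Monitoring) (σ : Profile) (h : List Arm) :
    (1 - M.p0) * M.joint mon σ State.good (failing h) =
      M.p0 * (1 - M.lam) ^ numExperiments h * M.joint mon σ State.bad (failing h) := by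
  simp only [joint, pathProb_good_failing, prior]
  ring

theorem obsProb_isPublic (σ : Profile) (i : Player) (l : List Step) :
    M.obsProb Monitoring.isPublic σ i (view Monitoring.isPublic i l) =
      M.joint Monitoring.isPublic σ State.good l + M.joint Monitoring.isPublic σ State.bad l := by
  rw [obsProb, infoSet_isPublic, sum_state]
  simp [joint]

theorem goodProb_isPublic (σ : Profile) (i : Player) (l : List Step) :
    (M.bayes Monitoring.isPublic σ).goodProb Monitoring.isPublic i
        (view Monitoring.isPublic i l) =
      M.joint Monitoring.isPublic σ State.good l /
        (M.joint Monitoring.isPublic σ State.good l +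
          M.joint Monitoring.isPublic σ State.bad l) := by
  rw [BeliefSystem.goodProb, infoSet_isPublic, Finset.sum_singleton, bayes, obsProb_isPublic]
  rfl

theorem goodProb_isPublic_failing (hp : M.p0 < 1) {σ : Profile} (i : Player) {h : List Arm}
    (hpos : 0 < M.joint Monitoring.isPublic σ State.bad (failing h)) :
    (M.bayes Monitoring.isPublic σ).goodProb Monitoring.isPublic i
        (view Monitoring.isPublic i (failing h)) = M.phi^[numExperiments h] M.p0 := by
  have h1 := M.joint_good_failing Monitoring.isPublic σ h
  have h2 := M.joint_nonneg Monitoring.isPublic σ State.good (failing h)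
  rw [goodProb_isPublic, M.phi_iterate hp, div_eq_div_iff (by linarith)
    (M.phi_iterate_denom_pos hp _).ne']
  linear_combination h1

variable {M} {mon : Monitoring} {σ σ' : Profile} {i : Player}

/-- In the Bellman equation only the branch towards `l` contributes to the difference, and the step
probabilities along this branch multiply to the path probability. -/
theorem value_sub_value {l : List Step} (θ : State)
    (h : ∀ y, ¬ l <:+ y → σ (mover y.length) (view mon (mover y.length) y) =
      σ' (mover y.length) (view mon (mover y.length) y)) :
    M.value mon σ i θ [] - M.value mon σ' i θ [] =
      M.pathProb mon σ θ l * (M.value mon σ i θ l - M.value mon σ' i θ l) := by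
  induction l with
  | nil => simp [pathProb]
  | cons s l ih =>
    rw [ih fun y hy => h y fun hy' => hy ((List.suffix_cons s l).trans hy'), pathProb, mul_assoc]
    congr 1
    have hl := h l fun h' => by simpa using h'.length_le
    have hstep : ∀ s, M.stepProb mon σ' θ l s = M.stepProb mon σ θ l s := fun s => by
      cases s <;> simp [stepProb, hl]
    have hne : ∀ s', s' ≠ s → M.value mon σ i θ (s' :: l) = M.value mon σ' i θ (s' :: l) := by
      intro s' hs'
      refine M.value_congr fun y => h _ fun hy => ?_
      have h1 := List.suffix_of_suffix_length_le hy (List.suffix_append y (s' :: l)) (by simp)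
      have h2 := h1.eq_of_length (by simp)
      simp only [List.cons.injEq] at h2
      exact hs' h2.1.symm
    rw [value_eq_step, value_eq_step M (σ := σ') l, hl]
    simp only [hstep]
    rw [add_sub_add_left_eq_sub, ← Finset.sum_sub_distrib, Finset.sum_eq_single s]
    · ring
    · intro s' _ hs'
      rw [hne s' hs', sub_self]
    · simp

theorem payoff_eq : M.payoff mon σ i = ∑ θ, M.prior θ * M.value mon σ i θ [] := by
  simp [payoff, value]

/-- The strategy of player `i` that plays `f` as a function of the full past. -/
def publicStrategy (i : Player) (f : List Step → unitInterval) : Strategy :=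
  Function.extend (view Monitoring.isPublic i) f 0

theorem publicStrategy_view (i : Player) (f : List Step → unitInterval) (l : List Step) :
    publicStrategy i f (view Monitoring.isPublic i l) = f l :=
  (view_isPublic_injective i).extend_apply f 0 l

/-- Nash equilibrium is an ex-ante condition. A deviation confined to the extensions of `l` gains
its advantage at `l` times the probability of `l`, which gives sequential rationality at the
histories that are reached. -/
theorem IsNash.joint_value_le (hσ : M.IsNash Monitoring.isPublic σ) {l : List Step}
    {f : List Step → unitInterval}
    (hf : ∀ y, ¬ l <:+ y → f y = σ i (view Monitoring.isPublic i y)) :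
    ∑ θ, M.joint Monitoring.isPublic σ θ l *
        M.value Monitoring.isPublic (Function.update σ i (publicStrategy i f)) i θ l ≤
      ∑ θ, M.joint Monitoring.isPublic σ θ l * M.value Monitoring.isPublic σ i θ l := by
  have h := hσ i (publicStrategy i f)
  rw [payoff_eq, payoff_eq, ← sub_nonneg, ← Finset.sum_sub_distrib] at h
  rw [← sub_nonneg, ← Finset.sum_sub_distrib]
  refine h.trans (le_of_eq (Finset.sum_congr rfl fun θ _ => ?_))
  rw [← mul_sub, ← mul_sub, value_sub_value (l := l) θ, joint, mul_assoc]
  intro y hy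
  by_cases hi : mover y.length = i
  · rw [hi, Function.update_self, publicStrategy_view, hf y hy]
  · rw [Function.update_of_ne hi]

/-- The expected payoff of player `i` at a full history at which he experiments. -/
def riskyValue (M : Model) (mon : Monitoring) (σ : Profile) (i : Player) (θ : State)
    (l : List Step) : ℝ :=
  (1 - M.δ) * M.annuity i l.length * M.experimentFlow θ +
    ((1 - M.successProb θ) * M.value mon σ i θ (Step.failure :: l) +
      M.successProb θ * M.value mon σ i θ (Step.success :: l))

theorem value_eq_mix {l : List Step} (hl : mover l.length = i) (θ : State) :
    M.value mon σ i θ l = (σ i (view mon i l) : ℝ) * M.riskyValue mon σ i θ l +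
      (1 - (σ i (view mon i l) : ℝ)) * M.value mon σ i θ (Step.safe :: l) := by
  rw [value_eq_step, sum_step, if_pos hl, riskyValue, M.annuity_of_mover hl]
  simp only [stepProb, hl]
  ring

theorem annuity_pos (M : Model) (i : Player) (n : ℕ) : 0 < M.annuity i n := by
  have := M.δ_pos
  unfold annuity
  split_ifs <;> positivity

/-- The coefficient of `g` combines the current flow `1 - δ` with the payoff after a success, which
has probability `λ` and is at most `g` from the next period on. -/
theorem riskyValue_good_le {l : List Step} (hl : mover l.length = i) {v : ℝ}
    (hv : M.value mon σ i State.good (Step.failure :: l) ≤ v * M.annuity i l.length) :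
    M.riskyValue mon σ i State.good l ≤
      (M.g * (1 - M.δ * (1 - M.lam)) + (1 - M.lam) * v) * M.annuity i l.length := by
  have h1 := M.value_le (mon := mon) (σ := σ) (i := i) (θ := State.good) (Step.success :: l)
  rw [List.length_cons, M.annuity_succ_of_mover hl] at h1
  simp only [riskyValue, experimentFlow_good, successProb]
  have h2 := mul_le_mul_of_nonneg_left hv M.one_sub_lam_pos.le
  have h3 := mul_le_mul_of_nonneg_left h1 M.lam_pos.le
  linarith

theorem riskyValue_bad_le (M : Model) (mon : Monitoring) (σ : Profile) (i : Player)
    (l : List Step) :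
    M.riskyValue mon σ i State.bad l ≤ -(M.c * (1 - M.δ)) * M.annuity i l.length := by
  have h1 := M.value_bad_nonpos (mon := mon) (σ := σ) (i := i) (Step.failure :: l)
  simp only [riskyValue, experimentFlow_bad, successProb]
  linarith

/-- Two deviations are used: safe once and then as before, and safe for ever. By the first,
experimenting is at least as good as the safe arm; by the second, the mixture of the two is worth at
least `0`. So the better of them is. -/
theorem IsNash.joint_riskyValue_nonneg (hσ : M.IsNash Monitoring.isPublic σ) {l : List Step}
    (hl : mover l.length = i) (hpos : σ i (view Monitoring.isPublic i l) ≠ 0) :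
    0 ≤ ∑ θ, M.joint Monitoring.isPublic σ θ l * M.riskyValue Monitoring.isPublic σ i θ l := by
  classical
  have hp : 0 < (σ i (view Monitoring.isPublic i l) : ℝ) :=
    lt_of_le_of_ne (σ i _).2.1 fun h => hpos (Subtype.ext h.symm)
  have d1 := hσ.joint_value_le (i := i) (l := l)
    (f := fun y => if y = l then 0 else σ i (view Monitoring.isPublic i y)) fun y hy => by
      rw [if_neg]
      rintro rfl
      exact hy List.suffix_rfl
  have d2 := hσ.joint_value_le (i := i) (l := l)
    (f := fun y => if l <:+ y then 0 else σ i (view Monitoring.isPublic i y))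
    fun y hy => by rw [if_neg hy]
  have h2 : ∀ θ, M.value Monitoring.isPublic (Function.update σ i (publicStrategy i
      fun y => if l <:+ y then 0 else σ i (view Monitoring.isPublic i y))) i θ l = 0 := by
    refine fun θ => M.value_eq_zero_of_abstains fun y _ => ?_
    rw [Function.update_self, publicStrategy_view, if_pos (List.suffix_append y l)]
  have h1 : ∀ θ, M.value Monitoring.isPublic (Function.update σ i (publicStrategy i
      fun y => if y = l then 0 else σ i (view Monitoring.isPublic i y))) i θ l =
      M.value Monitoring.isPublic σ i θ (Step.safe :: l) := by
    intro θ
    rw [M.value_of_safe]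
    · refine M.value_congr fun y => ?_
      by_cases hi : mover (y ++ Step.safe :: l).length = i
      · rw [hi, Function.update_self, publicStrategy_view, if_neg]
        intro h
        have := congrArg List.length h
        simp at this
        omega
      · rw [Function.update_of_ne hi]
    · rw [hl, Function.update_self, publicStrategy_view, if_pos rfl]
  simp only [h1] at d1
  simp only [h2, mul_zero, Finset.sum_const_zero] at d2
  simp only [value_eq_mix hl, sum_state] at d1 d2
  rw [sum_state]
  set p := (σ i (view Monitoring.isPublic i l) : ℝ)
  set R := M.joint Monitoring.isPublic σ State.good l *
      M.riskyValue Monitoring.isPublic σ i State.good l +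
    M.joint Monitoring.isPublic σ State.bad l *
      M.riskyValue Monitoring.isPublic σ i State.bad l with hR
  set S := M.joint Monitoring.isPublic σ State.good l *
      M.value Monitoring.isPublic σ i State.good (Step.safe :: l) +
    M.joint Monitoring.isPublic σ State.bad l *
      M.value Monitoring.isPublic σ i State.bad (Step.safe :: l) with hS
  have d1' : S ≤ p * R + (1 - p) * S := by
    rw [hR, hS]
    linarith
  have d2' : 0 ≤ p * R + (1 - p) * S := by
    rw [hR, hS]
    linarith
  have hSR : S ≤ R := le_of_mul_le_mul_left (by linarith) hp
  by_contra hR0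
  have h1p : (1 - p) * S ≤ (1 - p) * R :=
    mul_le_mul_of_nonneg_left hSR (sub_nonneg.2 (σ i _).2.2)
  linarith

theorem IsNash.belief_bound (hσ : M.IsNash Monitoring.isPublic σ) (hp : M.p0 < 1)
    {h : List Arm} (hi : mover h.length = i)
    (hpath : 0 < M.joint Monitoring.isPublic σ State.bad (failing h))
    (hpos : σ i (view Monitoring.isPublic i (failing h)) ≠ 0) {v : ℝ}
    (hv : M.value Monitoring.isPublic σ i State.good (Step.failure :: failing h) ≤
      v * M.annuity i h.length) :
    M.c * (1 - M.δ) * (1 - M.phi^[numExperiments h] M.p0) ≤ M.phi^[numExperiments h] M.p0 *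
      (M.g * (1 - M.δ * (1 - M.lam)) + (1 - M.lam) * v) := by
  have h0 := hσ.joint_riskyValue_nonneg (l := failing h) (by simpa using hi) hpos
  rw [sum_state] at h0
  have h1 := riskyValue_good_le (M := M) (l := failing h) (mon := Monitoring.isPublic) (σ := σ)
    (by simpa using hi) (by simpa using hv)
  have h2 := riskyValue_bad_le M Monitoring.isPublic σ i (failing h)
  rw [length_failing] at h1 h2
  have h3 := mul_le_mul_of_nonneg_left h1 (M.joint_nonneg Monitoring.isPublic σ State.good
    (failing h))
  have h4 := mul_le_mul_of_nonneg_left h2 hpath.le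
  have hA := M.annuity_pos i h.length
  have hG := M.joint_good_failing Monitoring.isPublic σ h
  have hD := M.phi_iterate_denom_pos hp (numExperiments h)
  set JG := M.joint Monitoring.isPublic σ State.good (failing h)
  set JB := M.joint Monitoring.isPublic σ State.bad (failing h)
  set N := numExperiments h
  set X := M.g * (1 - M.δ * (1 - M.lam)) + (1 - M.lam) * v
  have h5 : 0 ≤ (JG * X - JB * (M.c * (1 - M.δ))) * M.annuity i h.length := by linarith
  have h6 := nonneg_of_mul_nonneg_left h5 hA
  -- Multiplication by `1 - p₀` allows `joint_good_failing` to express `JG` through `JB`, which is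
  -- positive and can be cancelled.
  have h7 : 0 ≤ JB * (M.p0 * (1 - M.lam) ^ N * X - (1 - M.p0) * (M.c * (1 - M.δ))) := by
    have := mul_nonneg (sub_pos.2 hp).le h6
    linear_combination this + X * hG
  have h8 := nonneg_of_mul_nonneg_right h7 hpath
  rw [M.phi_iterate hp, one_sub_div hD.ne', ← sub_nonneg]
  have h9 := div_nonneg h8 hD.le
  refine h9.trans (le_of_eq ?_)
  field_simp
  ring

/-- With the crude bound `g` for everything after a failure, an experiment still needs a belief of
at least `c(1 - δ) / (c(1 - δ) + g)`, and `φ^n(p₀)` tends to `0`. -/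
theorem IsNash.experiments_bounded (hσ : M.IsNash Monitoring.isPublic σ) (hp : M.p0 < 1) :
    ∃ n, ∀ h : List Arm, 0 < M.joint Monitoring.isPublic σ State.bad (failing h) →
      σ (mover h.length) (view Monitoring.isPublic (mover h.length) (failing h)) ≠ 0 →
      numExperiments h < n := by
  have hc : 0 < M.c * (1 - M.δ) := mul_pos M.c_pos (sub_pos.2 M.δ_lt_one)
  have hg := M.g_pos
  obtain ⟨n, hn⟩ := M.exists_phi_iterate_lt hp
    (q := M.c * (1 - M.δ) / (M.c * (1 - M.δ) + M.g)) (by positivity)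
  refine ⟨n, fun h hpath hpos => ?_⟩
  by_contra hlt
  have h1 := hn _ (not_lt.1 hlt)
  rw [lt_div_iff₀ (by positivity)] at h1
  have hv := M.value_le (mon := Monitoring.isPublic) (σ := σ) (i := mover h.length)
    (θ := State.good) (Step.failure :: failing h)
  rw [List.length_cons, length_failing, M.annuity_succ_of_mover rfl, ← mul_assoc] at hv
  have h2 := hσ.belief_bound hp rfl hpath hpos hv
  have h3 : M.g * (1 - M.δ * (1 - M.lam)) + (1 - M.lam) * (M.g * M.δ) = M.g := by ring
  rw [h3] at h2
  linarith

theorem joint_bad_safe_pos {h : List Arm}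
    (hpath : 0 < M.joint mon σ State.bad (failing h))
    (h0 : σ (mover h.length) (view mon (mover h.length) (failing h)) = 0) :
    0 < M.joint mon σ State.bad (failing (Arm.safe :: h)) := by
  rw [failing_safe, joint, pathProb, ← mul_assoc]
  refine mul_pos hpath ?_
  simp [stepProb, h0]

theorem joint_bad_risky_pos {h : List Arm}
    (hpath : 0 < M.joint mon σ State.bad (failing h))
    (h0 : σ (mover h.length) (view mon (mover h.length) (failing h)) ≠ 0) :
    0 < M.joint mon σ State.bad (failing (Arm.risky :: h)) := by
  rw [failing_risky, joint, pathProb, ← mul_assoc]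
  refine mul_pos hpath ?_
  simpa [stepProb, successProb] using unitInterval.pos_iff_ne_zero.2 h0

/-- With public outcomes, no experiments take place on path at beliefs below `p*`. -/
theorem IsNash.eq_zero_of_phi_lt (hσ : M.IsNash Monitoring.isPublic σ) (hp : M.p0 < 1)
    {h : List Arm} (hpath : 0 < M.joint Monitoring.isPublic σ State.bad (failing h))
    (hlt : M.phi^[numExperiments h] M.p0 < M.pStar) :
    σ (mover h.length) (view Monitoring.isPublic (mover h.length) (failing h)) = 0 := by
  by_contra hpos
  -- Pass to a history `k` with the greatest number of experiments among those that are on path in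
  -- the bad state and at which the active player may experiment. The belief there is no higher than
  -- at `h`.
  let S : Set ℕ := {n | ∃ h : List Arm, 0 < M.joint Monitoring.isPublic σ State.bad (failing h) ∧
      σ (mover h.length) (view Monitoring.isPublic (mover h.length) (failing h)) ≠ 0 ∧
      numExperiments h = n}
  obtain ⟨n, hn⟩ := hσ.experiments_bounded hp
  have hbdd : BddAbove S := ⟨n, by
    rintro _ ⟨h, h1, h2, rfl⟩
    exact (hn h h1 h2).le⟩
  have hmem : numExperiments h ∈ S := ⟨h, hpath, hpos, rfl⟩
  obtain ⟨k, hk1, hk2, hk3⟩ := Nat.sSup_mem ⟨_, hmem⟩ hbdd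
  have hle : numExperiments h ≤ numExperiments k := hk3 ▸ le_csSup hbdd hmem
  have hklt : M.phi^[numExperiments k] M.p0 < M.pStar :=
    ((M.phi_iterate_strictAnti hp).antitone hle).trans_lt hlt
  have hquit : ∀ h : List Arm, 0 < M.joint Monitoring.isPublic σ State.bad (failing h) →
      numExperiments k < numExperiments h →
      σ (mover h.length) (view Monitoring.isPublic (mover h.length) (failing h)) = 0 := by
    intro h h1 h2
    by_contra h3
    exact absurd (le_csSup hbdd (⟨h, h1, h3, rfl⟩ : numExperiments h ∈ S)) (by omega)
  have hpath' : ∀ m, 0 < M.joint Monitoring.isPublic σ State.bad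
      (failing (List.replicate m Arm.safe ++ Arm.risky :: k)) := by
    intro m
    induction m with
    | zero => exact joint_bad_risky_pos hk1 hk2
    | succ m ih =>
      rw [List.replicate_succ, List.cons_append]
      refine joint_bad_safe_pos ih (hquit _ ih ?_)
      rw [numExperiments_replicate_append, numExperiments_risky]
      exact Nat.lt_succ_self _
  -- By maximality a failure at `k` is followed by safe choices only, so the continuation is
  -- worthless.
  have hv : M.value Monitoring.isPublic σ (mover k.length) State.good
      (Step.failure :: failing k) = 0 := by
    refine M.value_eq_zero_of_safe_path fun m => ?_
    rw [← failing_risky, ← failing_replicate_append, length_failing]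
    refine hquit _ (hpath' m) ?_
    rw [numExperiments_replicate_append, numExperiments_risky]
    exact Nat.lt_succ_self _
  have hb := hσ.belief_bound hp rfl hk1 hk2 (v := 0) (by rw [hv, zero_mul])
  rw [lt_pStar_iff] at hklt
  linarith

theorem goodProb_isPublic_eq_one {l : List Step}
    (hobs : 0 < M.obsProb Monitoring.isPublic σ i (view Monitoring.isPublic i l))
    (h : M.joint Monitoring.isPublic σ State.bad l = 0) :
    (M.bayes Monitoring.isPublic σ).goodProb Monitoring.isPublic i
        (view Monitoring.isPublic i l) = 1 := by
  rw [obsProb_isPublic, h, add_zero] at hobs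
  rw [goodProb_isPublic, h, add_zero, div_self hobs.ne']

theorem IsNash.eq_zero_of_lt_pStar (hσ : M.IsNash Monitoring.isPublic σ) {l : List Step}
    (hl : mover l.length = i)
    (hobs : 0 < M.obsProb Monitoring.isPublic σ i (view Monitoring.isPublic i l))
    (hlt : (M.bayes Monitoring.isPublic σ).goodProb Monitoring.isPublic i
        (view Monitoring.isPublic i l) < M.pStar) :
    σ i (view Monitoring.isPublic i l) = 0 := by
  -- A history that is impossible in the bad state would have belief `1 > p*`. So `l` contains no
  -- success and `p₀ < 1`.
  have hbad : M.joint Monitoring.isPublic σ State.bad l ≠ 0 := fun h => by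
    rw [goodProb_isPublic_eq_one hobs h] at hlt
    exact absurd hlt M.pStar_lt_one.not_gt
  have hpos := lt_of_le_of_ne (M.joint_nonneg Monitoring.isPublic σ State.bad l) hbad.symm
  have hp : M.p0 < 1 := sub_pos.1 (pos_of_mul_pos_left hpos (M.pathProb_nonneg _ _ _ _))
  have hs : Step.success ∉ l := fun h => by
    rw [joint, M.pathProb_bad_of_success h, mul_zero] at hbad
    exact hbad rfl
  obtain ⟨h, rfl⟩ : ∃ h, failing h = l := ⟨_, exists_failing_eq hs⟩
  rw [M.goodProb_isPublic_failing hp i hpos] at hlt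
  rw [← hl, length_failing]
  exact hσ.eq_zero_of_phi_lt hp hpos hlt

end Model

/-! ### Public outcomes: play does not stop above `p*` -/

namespace Model
open MeasureTheory Filter

variable {M : Model} {mon : Monitoring} {σ : Profile} {i : Player}

theorem expFlow_le_g (θ : State) (j : ℕ) (l : List Step) : M.expFlow mon σ i θ j l ≤ M.g := by
  refine (M.expFlow_le (fun y _ => M.strategy_mul_le _) j).trans ?_
  have := M.g_pos
  split_ifs <;> linarith

/-- The flow payoffs are bounded by the probability that somebody experiments. -/
theorem pathProb_mul_expFlow_le (θ : State) (j : ℕ) (l : List Step) :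
    M.pathProb mon σ State.bad l * M.expFlow mon σ i θ j l ≤
      M.g * (M.pathProb mon σ State.bad l -
        M.pathProb mon σ State.bad (List.replicate (j + 1) Step.safe ++ l)) := by
  have hP := M.pathProb_nonneg mon σ State.bad l
  -- The probability of a safe choice is the same in both states, which is why path probabilities of
  -- the bad state control the flows in either state.
  have hs : M.pathProb mon σ State.bad (Step.safe :: l) =
      M.pathProb mon σ State.bad l * M.stepProb mon σ θ l Step.safe := by
    simp [pathProb, stepProb]
  induction j generalizing l with
  | zero =>
    simp only [expFlow, zero_add, List.replicate_one, List.singleton_append]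
    rw [hs, sum_stepProb_flow]
    have h0 := (σ (mover l.length) (view mon (mover l.length) l)).2.1
    have h1 : (σ (mover l.length) (view mon (mover l.length) l) : ℝ) * M.experimentFlow θ ≤
        (σ (mover l.length) (view mon (mover l.length) l) : ℝ) * M.g := by
      refine mul_le_mul_of_nonneg_left ?_ h0
      simpa using M.strategy_mul_le (θ := θ) 1
    simp only [stepProb]
    split_ifs
    · linarith [mul_le_mul_of_nonneg_left h1 hP]
    · have := mul_nonneg hP (mul_nonneg h0 M.g_pos.le)
      linarith
  | succ j ih =>
    have h1 := ih (Step.safe :: l) (M.pathProb_nonneg _ _ _ _) (by simp [pathProb, stepProb])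
    have h2 := M.stepProb_sum mon σ θ l
    rw [sum_step] at h2
    have hf := mul_le_mul_of_nonneg_left (expFlow_le_g (M := M) (mon := mon) (σ := σ) (i := i) θ j
      (Step.failure :: l)) (mul_nonneg hP (M.stepProb_nonneg mon σ θ l Step.failure))
    have hsu := mul_le_mul_of_nonneg_left (expFlow_le_g (M := M) (mon := mon) (σ := σ) (i := i) θ j
      (Step.success :: l)) (mul_nonneg hP (M.stepProb_nonneg mon σ θ l Step.success))
    rw [List.replicate_succ', List.append_assoc, List.singleton_append, expFlow, sum_step]
    rw [hs] at h1
    set P := M.pathProb mon σ State.bad l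
    have h3 : P * M.stepProb mon σ θ l Step.failure + P * M.stepProb mon σ θ l Step.success =
        P - P * M.stepProb mon σ θ l Step.safe := by linear_combination P * h2
    have h4 := congrArg (fun r => r * M.g) h3
    beta_reduce at h4
    linarith

/-- `P - L` bounds the probability, in the bad state, of reaching `l` and leaving the all-safe
continuation later; without an experiment no flow is earned. -/
theorem value_le_of_replicate {L : ℝ} {l : List Step}
    (hP : 0 < M.pathProb mon σ State.bad l)
    (hL : ∀ k, L ≤ M.pathProb mon σ State.bad (List.replicate k Step.safe ++ l)) (θ : State) :
    M.pathProb mon σ State.bad l * M.value mon σ i θ l ≤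
      M.g * (M.pathProb mon σ State.bad l - L) * M.annuity i l.length := by
  have h : M.value mon σ i θ l ≤
      M.g * (M.pathProb mon σ State.bad l - L) / M.pathProb mon σ State.bad l *
        M.annuity i l.length := by
    refine M.value_le_of_expFlow_le fun j => ?_
    split_ifs with hm
    · rw [le_div_iff₀ hP, mul_comm]
      refine (pathProb_mul_expFlow_le θ j l).trans ?_
      have := hL (j + 1)
      gcongr
      exact M.g_pos.le
    · have := M.expFlow_le (mon := mon) (σ := σ) (i := i) (θ := θ) (l := l)
        (fun y _ => M.strategy_mul_le _) j
      rwa [if_neg hm] at this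
  have h2 := mul_le_mul_of_nonneg_left h hP.le
  refine h2.trans (le_of_eq ?_)
  field_simp

open Classical in
/-- Experiment once at the full history `l`, and then always or never, according to the outcome. -/
def experimentOnce (σ : Profile) (i : Player) (l y : List Step) : unitInterval :=
  if y = l then 1 else if Step.success :: l <:+ y then 1
    else if l <:+ y then 0 else σ i (view Monitoring.isPublic i y)

theorem experimentOnce_success (σ : Profile) (i : Player) (l y : List Step) :
    experimentOnce σ i l (y ++ Step.success :: l) = 1 := by
  rw [experimentOnce, if_neg, if_pos (List.suffix_append y _)]
  intro h
  have := congrArg List.length h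
  simp at this
  omega

theorem experimentOnce_failure (σ : Profile) (i : Player) (l y : List Step) :
    experimentOnce σ i l (y ++ Step.failure :: l) = 0 := by
  rw [experimentOnce, if_neg, if_neg, if_pos]
  · exact (List.suffix_cons Step.failure l).trans (List.suffix_append y _)
  · intro hy
    have h1 := List.suffix_of_suffix_length_le hy (List.suffix_append y (Step.failure :: l))
      (by simp)
    have h2 := h1.eq_of_length (by simp)
    simp at h2
  · intro h
    have := congrArg List.length h
    simp at this
    omega

theorem value_experimentOnce_good {l : List Step} (hl : mover l.length = i) :
    M.value Monitoring.isPublic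
        (Function.update σ i (publicStrategy i (experimentOnce σ i l))) i State.good l =
      M.g * (1 - M.δ * (1 - M.lam)) * M.annuity i l.length := by
  rw [M.value_of_risky, if_pos hl]
  · rw [M.value_eq_zero_of_abstains (l := Step.failure :: l), M.value_eq_of_experiments,
      List.length_cons, M.annuity_succ_of_mover hl]
    · simp only [experimentFlow_good, successProb]
      ring
    · intro y _
      rw [Function.update_self, publicStrategy_view, experimentOnce_success]
    · intro y _
      rw [Function.update_self, publicStrategy_view, experimentOnce_failure]
  · rw [hl, Function.update_self, publicStrategy_view, experimentOnce, if_pos rfl]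

theorem value_experimentOnce_bad {l : List Step} (hl : mover l.length = i) :
    M.value Monitoring.isPublic
        (Function.update σ i (publicStrategy i (experimentOnce σ i l))) i State.bad l =
      -(M.c * (1 - M.δ)) * M.annuity i l.length := by
  rw [M.value_of_risky, if_pos hl]
  · rw [M.value_eq_zero_of_abstains (l := Step.failure :: l)]
    · simp only [experimentFlow_bad, successProb]
      ring
    · intro y _
      rw [Function.update_self, publicStrategy_view, experimentOnce_failure]
  · rw [hl, Function.update_self, publicStrategy_view, experimentOnce, if_pos rfl]

/-- Up to the annuity factor, the left side is the payoff from `experimentOnce`, and the right side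
bounds the equilibrium payoff by the probability that the run of safe choices ends. -/
theorem IsNash.quit_bound (hσ : M.IsNash Monitoring.isPublic σ) {h : List Arm} {L : ℝ}
    (hP : 0 < M.pathProb Monitoring.isPublic σ State.bad (failing h))
    (hL : ∀ k, L ≤ M.pathProb Monitoring.isPublic σ State.bad
      (List.replicate k Step.safe ++ failing h)) :
    (M.p0 * (1 - M.lam) ^ numExperiments h * (M.g * (1 - M.δ * (1 - M.lam))) -
        (1 - M.p0) * (M.c * (1 - M.δ))) * M.pathProb Monitoring.isPublic σ State.bad (failing h) ≤
      (M.p0 * (1 - M.lam) ^ numExperiments h + (1 - M.p0)) * M.g *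
        (M.pathProb Monitoring.isPublic σ State.bad (failing h) - L) := by
  set i := mover h.length with hi
  have hl : mover (failing h).length = i := by simp [hi]
  have h1 := hσ.joint_value_le (i := i) (l := failing h)
    (f := experimentOnce σ i (failing h)) fun y hy => by
      rw [experimentOnce, if_neg, if_neg, if_neg hy]
      · exact fun h' => hy ((List.suffix_cons _ _).trans h')
      · rintro rfl
        exact hy List.suffix_rfl
  have hx := pow_pos M.one_sub_lam_pos (numExperiments h)
  rw [sum_state, sum_state, value_experimentOnce_good hl, value_experimentOnce_bad hl] at h1
  have hA := M.annuity_pos i h.length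
  have v1 := value_le_of_replicate (i := i) hP hL State.good
  have v2 := value_le_of_replicate (i := i) hP hL State.bad
  simp only [joint, pathProb_good_failing, prior] at h1
  rw [length_failing] at h1 v1 v2
  set P := M.pathProb Monitoring.isPublic σ State.bad (failing h)
  have v3 := mul_le_mul_of_nonneg_left v1 (mul_pos M.p0_pos hx).le
  have v4 := mul_le_mul_of_nonneg_left v2 (sub_nonneg.2 M.p0_le_one)
  refine le_of_mul_le_mul_right ?_ hA
  linarith

/-- With public outcomes, on path the players do not stop for good at beliefs above `p*`. -/
theorem IsNash.law_quit_eq_zero (hσ : M.IsNash Monitoring.isPublic σ) (hp : M.p0 < 1)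
    {h : List Arm} (hlt : M.pStar < M.phi^[numExperiments h] M.p0) :
    M.law Monitoring.isPublic σ {ω | ∀ k, ω (h.length + k) =
      (State.bad, List.replicate k Step.safe ++ failing h)} = 0 := by
  set P : ℕ → ℝ := fun k => M.pathProb Monitoring.isPublic σ State.bad
    (List.replicate k Step.safe ++ failing h) with hPdef
  have hanti : Antitone P := antitone_nat_of_succ_le fun k => by
    simp only [hPdef, List.replicate_succ, List.cons_append, pathProb]
    refine mul_le_of_le_one_right (M.pathProb_nonneg _ _ _ _) ?_
    simp only [stepProb]
    linarith [(σ (mover (List.replicate k Step.safe ++ failing h).length)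
      (view Monitoring.isPublic (mover (List.replicate k Step.safe ++ failing h).length)
        (List.replicate k Step.safe ++ failing h))).2.1]
  have hbdd : BddBelow (Set.range P) := ⟨0, by
    rintro _ ⟨k, rfl⟩
    exact M.pathProb_nonneg _ _ _ _⟩
  have hlim := tendsto_atTop_ciInf hanti hbdd
  set L := ⨅ k, P k with hLdef
  have hL0 : 0 ≤ L := le_ciInf fun k => M.pathProb_nonneg _ _ _ _
  -- If `L > 0`, then `quit_bound` after `k` safe choices, in the limit `k → ∞`, bounds a positive
  -- multiple of `L` by zero.
  have hL : L = 0 := by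
    by_contra hne
    have hLpos : 0 < L := lt_of_le_of_ne hL0 (Ne.symm hne)
    have hD := M.phi_iterate_denom_pos hp (numExperiments h)
    have hC : 0 < M.p0 * (1 - M.lam) ^ numExperiments h * (M.g * (1 - M.δ * (1 - M.lam))) -
        (1 - M.p0) * (M.c * (1 - M.δ)) := by
      rw [pStar_lt_iff, M.phi_iterate hp, one_sub_div hD.ne', mul_div_assoc', div_mul_eq_mul_div,
        div_mul_eq_mul_div, div_lt_div_iff_of_pos_right hD] at hlt
      linarith
    have hk : ∀ k, (M.p0 * (1 - M.lam) ^ numExperiments h * (M.g * (1 - M.δ * (1 - M.lam))) -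
        (1 - M.p0) * (M.c * (1 - M.δ))) * P k ≤
        (M.p0 * (1 - M.lam) ^ numExperiments h + (1 - M.p0)) * M.g * (P k - L) := by
      intro k
      have h1 := hσ.quit_bound (h := List.replicate k Arm.safe ++ h) (L := L)
        (by
          rw [failing_replicate_append]
          exact hLpos.trans_le (ciInf_le hbdd k))
        (by
          intro m
          rw [failing_replicate_append, ← List.append_assoc, List.replicate_append_replicate]
          exact ciInf_le hbdd (m + k))
      rwa [failing_replicate_append, numExperiments_replicate_append] at h1
    have h2 := le_of_tendsto_of_tendsto' (hlim.const_mul _)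
      ((hlim.sub_const L).const_mul
        ((M.p0 * (1 - M.lam) ^ numExperiments h + (1 - M.p0)) * M.g)) hk
    rw [sub_self, mul_zero] at h2
    exact absurd h2 (mul_pos hC hLpos).not_ge
  rw [hL] at hlim
  have hle : ∀ k, M.law Monitoring.isPublic σ {ω | ∀ k, ω (h.length + k) =
      (State.bad, List.replicate k Step.safe ++ failing h)} ≤
      ENNReal.ofReal (M.prior State.bad * P k) := by
    intro k
    refine (measure_mono fun ω hω => ?_).trans (M.law_apply_le Monitoring.isPublic σ State.bad
      (List.replicate k Step.safe ++ failing h))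
    have h1 : ω (h.length + k) = _ := hω k
    change ω _ = _
    rw [List.length_append, List.length_replicate, length_failing, add_comm]
    exact h1
  have hlim2 := ENNReal.tendsto_ofReal (hlim.const_mul (M.prior State.bad))
  rw [mul_zero, ENNReal.ofReal_zero] at hlim2
  exact le_antisymm (ge_of_tendsto' hlim2 hle) zero_le

/-- The number of experiments is monotone along a play. If it is bounded, it attains its supremum,
and from then on all choices are safe. -/
theorem exists_numExperiments_eq_or_tendsto {h : ℕ → List Arm}
    (hh : ∀ t, ∃ a, h (t + 1) = a :: h t) :
    (∃ t, ∀ k, h (t + k) = List.replicate k Arm.safe ++ h t) ∨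
      Tendsto (fun t => numExperiments (h t)) atTop atTop := by
  have hmono : Monotone fun t => numExperiments (h t) := monotone_nat_of_le_succ fun t => by
    obtain ⟨a, ha⟩ := hh t
    rw [ha]
    cases a <;> simp
  by_cases hb : BddAbove (Set.range fun t => numExperiments (h t))
  · left
    obtain ⟨t, ht⟩ := Nat.sSup_mem (Set.range_nonempty fun t => numExperiments (h t)) hb
    have ht' : numExperiments (h t) = sSup (Set.range fun t => numExperiments (h t)) := ht
    refine ⟨t, fun k => ?_⟩
    induction k with
    | zero => rfl
    | succ k ih =>
      obtain ⟨a, ha⟩ := hh (t + k)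
      have h1 : numExperiments (h (t + k + 1)) ≤ numExperiments (h t) :=
        ht' ▸ le_csSup hb ⟨t + k + 1, rfl⟩
      rw [ha, ih] at h1
      cases a
      · rw [← add_assoc, ha, ih, List.replicate_succ, List.cons_append]
      · rw [numExperiments_risky, numExperiments_replicate_append] at h1
        omega
  · right
    refine tendsto_atTop_atTop_of_monotone hmono fun b => ?_
    by_contra hc
    push Not at hc
    exact hb ⟨b, by
      rintro _ ⟨t, rfl⟩
      exact (hc t).le⟩

theorem IsNash.ae_tendsto (hσ : M.IsNash Monitoring.isPublic σ) :
    ∀ᵐ ω ∂(M.law Monitoring.isPublic σ), (ω 0).1 = State.bad →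
      ∀ i : Player, ∃ q : ℝ, q ≤ M.pStar ∧
        Tendsto (fun t => (M.bayes Monitoring.isPublic σ).goodProb Monitoring.isPublic i
          (view Monitoring.isPublic i (ω t).2)) atTop (nhds q) := by
  have hquit : ∀ᵐ ω ∂(M.law Monitoring.isPublic σ), ∀ h : List Arm, M.p0 < 1 →
      M.pStar < M.phi^[numExperiments h] M.p0 →
      ¬ ∀ k, ω (h.length + k) = (State.bad, List.replicate k Step.safe ++ failing h) := by
    -- Finite sequences of choices are countable in number, so the null events of stopping above
    -- `p*` can be excluded for all of them at once.
    have : Countable Arm := Countable.of_equiv Bool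
      ⟨fun b => if b then Arm.risky else Arm.safe, fun a => decide (a = Arm.risky),
        fun b => by cases b <;> simp, fun a => by cases a <;> simp⟩
    refine ae_all_iff.2 fun h => ?_
    by_cases hc : M.p0 < 1 ∧ M.pStar < M.phi^[numExperiments h] M.p0
    · filter_upwards [measure_eq_zero_iff_ae_notMem.1 (hσ.law_quit_eq_zero hc.1 hc.2)] with ω hω
      exact fun _ _ => hω
    · exact Filter.Eventually.of_forall fun ω h1 h2 => absurd ⟨h1, h2⟩ hc
  filter_upwards [hquit, M.ae_law_path Monitoring.isPublic σ, M.ae_law_step Monitoring.isPublic σ]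
    with ω hω hpath hstep hbad i
  have hst : ∀ t, (ω t).1 = State.bad := fun t => (hpath t).1.trans hbad
  have hjoint : ∀ t, 0 < M.joint Monitoring.isPublic σ State.bad (ω t).2 := fun t => by
    have := (hpath t).2.2
    rwa [hst t] at this
  have hp : M.p0 < 1 :=
    sub_pos.1 (pos_of_mul_pos_left (hjoint 0) (M.pathProb_nonneg _ _ _ _))
  have hsucc : ∀ t, Step.success ∉ (ω t).2 := fun t hs => by
    have := hjoint t
    rw [joint, M.pathProb_bad_of_success hs, mul_zero] at this
    exact this.false
  set h : ℕ → List Arm := fun t => (ω t).2.map Step.arm with hdef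
  have hfail : ∀ t, failing (h t) = (ω t).2 := fun t => exists_failing_eq (hsucc t)
  have hbel : ∀ t, (M.bayes Monitoring.isPublic σ).goodProb Monitoring.isPublic i
      (view Monitoring.isPublic i (ω t).2) = M.phi^[numExperiments (h t)] M.p0 := fun t => by
    rw [← hfail t]
    refine M.goodProb_isPublic_failing hp i ?_
    rw [hfail t]
    exact hjoint t
  simp only [hbel]
  have hcons : ∀ t, ∃ a, h (t + 1) = a :: h t := fun t => by
    obtain ⟨s, hs, -⟩ := hstep t
    exact ⟨s.arm, by simp [hdef, hs]⟩
  rcases exists_numExperiments_eq_or_tendsto hcons with ⟨t, ht⟩ | ht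
  · refine ⟨M.phi^[numExperiments (h t)] M.p0, ?_, ?_⟩
    · by_contra hlt
      refine hω (h t) hp (not_le.1 hlt) fun k => ?_
      have hlen : (h t).length = t := by simp [hdef, (hpath t).2.1]
      rw [← failing_replicate_append, hlen, ← ht k, hfail]
      exact Prod.ext (hst _) rfl
    · refine tendsto_const_nhds.congr' ?_
      filter_upwards [eventually_ge_atTop t] with s hs
      obtain ⟨k, rfl⟩ := Nat.exists_eq_add_of_le hs
      rw [ht k, numExperiments_replicate_append]
  · exact ⟨0, M.pStar_pos.le, (M.tendsto_phi_iterate hp).comp ht⟩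

end Model

/-! ### Private outcomes: information sets -/

theorem sum_infoSet_cons (mon : Monitoring) (i : Player) (q : Obs) (o : List Obs)
    (f : List Step → ℝ) :
    ∑ y ∈ infoSet mon i (q :: o), f y =
      ∑ x ∈ infoSet mon i o, ∑ s, if observe mon i o.length s = q then f (s :: x) else 0 := by
  have h : infoSet mon i (q :: o) =
      ((infoSet mon i o ×ˢ (Finset.univ : Finset Step)).filter
        fun p => observe mon i o.length p.2 = q).image fun p => p.2 :: p.1 := by
    ext y
    simp only [mem_infoSet, Finset.mem_image, Finset.mem_filter, Finset.mem_product,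
      Finset.mem_univ, and_true, Prod.exists]
    constructor
    · intro hy
      cases y with
      | nil => simp [view] at hy
      | cons s x =>
        simp only [view, List.cons.injEq] at hy
        refine ⟨x, s, ⟨hy.2, ?_⟩, rfl⟩
        rw [← hy.2, length_view]
        exact hy.1
    · rintro ⟨x, s, ⟨hx, hs⟩, rfl⟩
      rw [view, hx, ← hs, ← hx, length_view]
  rw [h, Finset.sum_image, Finset.sum_filter, Finset.sum_product]
  intro p _ p' _ hpp
  simp only [List.cons.injEq] at hpp
  exact Prod.ext hpp.2 hpp.1

theorem sum_infoSet_safe {i : Player} {o : List Obs}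
    (f : List Step → ℝ) :
    ∑ y ∈ infoSet .isPrivate i ((Arm.safe, false) :: o), f y =
      ∑ x ∈ infoSet .isPrivate i o, f (Step.safe :: x) := by
  rw [sum_infoSet_cons]
  refine Finset.sum_congr rfl fun x _ => ?_
  rw [sum_step]
  simp [observe, Step.arm]

theorem sum_infoSet_own_risky {i : Player} {o : List Obs} (h : mover o.length = i)
    (f : List Step → ℝ) :
    ∑ y ∈ infoSet .isPrivate i ((Arm.risky, false) :: o), f y =
      ∑ x ∈ infoSet .isPrivate i o, f (Step.failure :: x) := by
  rw [sum_infoSet_cons]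
  refine Finset.sum_congr rfl fun x _ => ?_
  rw [sum_step]
  simp [observe, Step.arm, h]

/-- The outcome of the opponent's experiment is hidden, so every history in the information set has
two continuations; after an own experiment that failed, or a safe choice, it has one. -/
theorem sum_infoSet_other_risky {i : Player} {o : List Obs} (h : mover o.length ≠ i)
    (f : List Step → ℝ) :
    ∑ y ∈ infoSet .isPrivate i ((Arm.risky, false) :: o), f y =
      ∑ x ∈ infoSet .isPrivate i o, (f (Step.failure :: x) + f (Step.success :: x)) := by
  rw [sum_infoSet_cons]
  refine Finset.sum_congr rfl fun x _ => ?_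
  rw [sum_step]
  simp [observe, Step.arm, h]

theorem length_of_mem_infoSet {mon : Monitoring} {i : Player} {o : List Obs} {x : List Step}
    (hx : x ∈ infoSet mon i o) : x.length = o.length := by
  rw [← mem_infoSet.1 hx, length_view]

theorem failing_mem_infoSet (mon : Monitoring) (i : Player) (h : List Arm) :
    failing h ∈ infoSet mon i (unsuccessful h) :=
  mem_infoSet.2 (view_failing mon i h)

/-- Player `i` saw a success. -/
def Informed (i : Player) (l : List Step) : Prop :=
  (Arm.risky, true) ∈ view .isPrivate i l

theorem Informed.cons {i : Player} {l : List Step} (h : Informed i l) (s : Step) :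
    Informed i (s :: l) :=
  List.mem_cons_of_mem _ h

theorem informed_cons_success {i : Player} {l : List Step} (h : mover l.length = i) :
    Informed i (Step.success :: l) := by
  simp [Informed, view, observe, Step.arm, h]

theorem Informed.success_mem {i : Player} {l : List Step} (h : Informed i l) :
    Step.success ∈ l := by
  induction l with
  | nil => simp [Informed, view] at h
  | cons s l ih =>
    rcases List.mem_cons.1 h with h | h
    · cases s
      · simp [observe, Step.arm] at h
      · simp [observe, Step.arm] at h
      · simp
    · exact List.mem_cons_of_mem _ (ih h)

theorem exists_informed {l : List Step} (h : Step.success ∈ l) : ∃ i, Informed i l := by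
  induction l with
  | nil => simp at h
  | cons s l ih =>
    rcases List.mem_cons.1 h with h | h
    · subst h
      exact ⟨_, informed_cons_success rfl⟩
    · obtain ⟨i, hi⟩ := ih h
      exact ⟨i, hi.cons s⟩

theorem not_informed_of_mem_infoSet {i : Player} {h : List Arm} {x : List Step}
    (hx : x ∈ infoSet .isPrivate i (unsuccessful h)) : ¬ Informed i x := by
  rw [Informed, mem_infoSet.1 hx, unsuccessful]
  simp

theorem map_arm_of_view {mon : Monitoring} {i : Player} {x : List Step} {h : List Arm}
    (hx : view mon i x = unsuccessful h) : x.map Step.arm = h := by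
  induction x generalizing h with
  | nil =>
    cases h with
    | nil => rfl
    | cons a h => simp [view] at hx
  | cons s x ih =>
    cases h with
    | nil => simp [view] at hx
    | cons a h =>
      simp only [view, unsuccessful_cons, List.cons.injEq] at hx
      rw [List.map_cons, ih hx.2]
      congr 1
      exact congrArg Prod.fst hx.1

theorem success_mem_of_ne_failing {i : Player} {h : List Arm} {x : List Step}
    (hx : x ∈ infoSet .isPrivate i (unsuccessful h)) (hne : x ≠ failing h) :
    Step.success ∈ x := by
  by_contra hs
  exact hne (by rw [← map_arm_of_view (mem_infoSet.1 hx), exists_failing_eq hs])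

/-- Choices are public, so a history that differs from the failing one contains a success; `i` saw
none, hence `j` did. -/
theorem informed_of_ne_failing {i j : Player} (hij : i ≠ j) {h : List Arm} {x : List Step}
    (hx : x ∈ infoSet .isPrivate i (unsuccessful h)) (hne : x ≠ failing h) : Informed j x := by
  obtain ⟨k, hk⟩ := exists_informed (success_mem_of_ne_failing hx hne)
  have hik : i ≠ k := by
    rintro rfl
    exact not_informed_of_mem_infoSet hx hk
  rwa [eq_of_ne_of_ne hij hik]

theorem eq_unsuccessful_of_not_informed {i : Player} {l : List Step} (h : ¬ Informed i l) :
    view .isPrivate i l = unsuccessful (l.map Step.arm) := by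
  induction l with
  | nil => rfl
  | cons s l ih =>
    have h1 : ¬ Informed i l := fun h' => h (h'.cons s)
    rw [view, ih h1, List.map_cons, unsuccessful_cons]
    congr 1
    cases s
    · simp [observe]
    · simp [observe]
    · have : mover l.length ≠ i := fun hm => h (informed_cons_success hm)
      simp [observe, this]

/-! ### Private outcomes: consistent beliefs -/

namespace Model

variable {M : Model} {σ : Profile} {π : BeliefSystem} {i j : Player}

/-- The probability that the state is `θ` and player `i` comes to observe `o`. -/
def obsStateProb (M : Model) (τ : Profile) (i : Player) (o : List Obs) (θ : State) : ℝ :=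
  ∑ x ∈ infoSet .isPrivate i o, M.joint .isPrivate τ θ x

theorem obsProb_eq (τ : Profile) (i : Player) (o : List Obs) :
    M.obsProb .isPrivate τ i o = M.obsStateProb τ i o .good + M.obsStateProb τ i o .bad := by
  rw [obsProb, sum_state]
  rfl

theorem goodProb_bayes (τ : Profile) (i : Player) (o : List Obs) :
    (M.bayes .isPrivate τ).goodProb .isPrivate i o =
      M.obsStateProb τ i o .good / M.obsProb .isPrivate τ i o := by
  rw [BeliefSystem.goodProb, obsStateProb, Finset.sum_div]
  rfl

/-- The player's own choice probability is constant on his information set and factors out of the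
sum. -/
theorem obsStateProb_own_risky (τ : Profile) {o : List Obs} (h : mover o.length = i)
    (θ : State) : M.obsStateProb τ i ((Arm.risky, false) :: o) θ =
      (τ i o : ℝ) * (1 - M.successProb θ) * M.obsStateProb τ i o θ := by
  rw [obsStateProb, sum_infoSet_own_risky h, obsStateProb, Finset.mul_sum]
  refine Finset.sum_congr rfl fun x hx => ?_
  have h1 := length_of_mem_infoSet hx
  simp only [joint, pathProb, stepProb, h1, h, mem_infoSet.1 hx]
  ring

theorem obsStateProb_own_safe (τ : Profile) {o : List Obs} (h : mover o.length = i)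
    (θ : State) : M.obsStateProb τ i ((Arm.safe, false) :: o) θ =
      (1 - (τ i o : ℝ)) * M.obsStateProb τ i o θ := by
  rw [obsStateProb, sum_infoSet_safe, obsStateProb, Finset.mul_sum]
  refine Finset.sum_congr rfl fun x hx => ?_
  have h1 := length_of_mem_infoSet hx
  simp only [joint, pathProb, stepProb, h1, h, mem_infoSet.1 hx]
  ring

theorem obsStateProb_other_risky (τ : Profile) {o : List Obs} (hij : i ≠ j)
    (h : mover o.length = j) (θ : State) :
    M.obsStateProb τ i ((Arm.risky, false) :: o) θ =
      ∑ x ∈ infoSet .isPrivate i o, M.joint .isPrivate τ θ x * (τ j (view .isPrivate j x) : ℝ) := by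
  rw [obsStateProb, sum_infoSet_other_risky (h ▸ hij.symm)]
  refine Finset.sum_congr rfl fun x hx => ?_
  have h1 := length_of_mem_infoSet hx
  simp only [joint, pathProb, stepProb, h1, h]
  ring

theorem pathProb_good_pos {τ : Profile} (hτ : τ.CompletelyMixed) (mon : Monitoring)
    (l : List Step) : 0 < M.pathProb mon τ .good l := by
  induction l with
  | nil => exact zero_lt_one
  | cons s l ih =>
    refine mul_pos ih ?_
    have h := hτ (mover l.length) (view mon (mover l.length) l)
    cases s
    · exact sub_pos.2 h.2
    · exact mul_pos h.1 M.one_sub_lam_pos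
    · exact mul_pos h.1 M.lam_pos

theorem obsStateProb_nonneg (τ : Profile) (i : Player) (o : List Obs) (θ : State) :
    0 ≤ M.obsStateProb τ i o θ :=
  Finset.sum_nonneg fun _ _ => M.joint_nonneg _ _ _ _

theorem obsStateProb_good_pos {τ : Profile} (hτ : τ.CompletelyMixed) (i : Player)
    (l : List Step) : 0 < M.obsStateProb τ i (view .isPrivate i l) .good :=
  Finset.sum_pos (fun _ _ => mul_pos M.p0_pos (pathProb_good_pos hτ _ _))
    ⟨l, mem_infoSet.2 rfl⟩

theorem obsProb_pos {τ : Profile} (hτ : τ.CompletelyMixed) (i : Player)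
    (l : List Step) : 0 < M.obsProb .isPrivate τ i (view .isPrivate i l) := by
  rw [obsProb_eq]
  exact add_pos_of_pos_of_nonneg (obsStateProb_good_pos hτ i l) (obsStateProb_nonneg _ _ _ _)

open Filter

theorem Consistent.nonneg (hC : M.Consistent .isPrivate σ π) {l x : List Step} {θ : State}
    (hx : x ∈ infoSet .isPrivate i (view .isPrivate i l)) :
    0 ≤ π i (view .isPrivate i l) θ x := by
  obtain ⟨τ, hτ, -, hlim⟩ := hC
  refine ge_of_tendsto' (hlim i l θ x hx) fun n => ?_
  exact div_nonneg (M.joint_nonneg _ _ _ _) (obsProb_pos (hτ n) i l).le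

theorem Consistent.sum_eq_one (hC : M.Consistent .isPrivate σ π) (i : Player) (l : List Step) :
    ∑ x ∈ infoSet .isPrivate i (view .isPrivate i l), π i (view .isPrivate i l) .good x +
      ∑ x ∈ infoSet .isPrivate i (view .isPrivate i l), π i (view .isPrivate i l) .bad x = 1 := by
  obtain ⟨τ, hτ, -, hlim⟩ := hC
  have h := (tendsto_finsetSum _ fun x hx => hlim i l .good x hx).add
    (tendsto_finsetSum _ fun x hx => hlim i l .bad x hx)
  refine tendsto_nhds_unique h (tendsto_const_nhds.congr fun n => ?_)
  have h1 := (obsProb_pos (M := M) (hτ n) i l).ne'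
  simp only [bayes]
  rw [← Finset.sum_div, ← Finset.sum_div, ← add_div, eq_div_iff h1, one_mul, obsProb_eq]
  rfl

theorem Consistent.bad_eq_zero (hC : M.Consistent .isPrivate σ π) {l x : List Step}
    (hx : x ∈ infoSet .isPrivate i (view .isPrivate i l)) (hs : Step.success ∈ x) :
    π i (view .isPrivate i l) .bad x = 0 := by
  obtain ⟨τ, hτ, -, hlim⟩ := hC
  refine tendsto_nhds_unique (hlim i l .bad x hx) (tendsto_const_nhds.congr fun n => ?_)
  simp [bayes, M.pathProb_bad_of_success hs]

theorem Consistent.tendsto_goodProb {τ : ℕ → Profile}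
    (hlim : ∀ (i : Player) (l : List Step) (θ : State),
      ∀ x ∈ infoSet .isPrivate i (view .isPrivate i l),
      Tendsto (fun n => M.bayes .isPrivate (τ n) i (view .isPrivate i l) θ x) atTop
        (nhds (π i (view .isPrivate i l) θ x))) (i : Player) (l : List Step) :
    Tendsto (fun n => (M.bayes .isPrivate (τ n)).goodProb .isPrivate i (view .isPrivate i l))
      atTop (nhds (π.goodProb .isPrivate i (view .isPrivate i l))) :=
  tendsto_finsetSum _ fun x hx => hlim i l .good x hx

theorem Consistent.goodProb_nonneg (hC : M.Consistent .isPrivate σ π) (i : Player)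
    (l : List Step) : 0 ≤ π.goodProb .isPrivate i (view .isPrivate i l) :=
  Finset.sum_nonneg fun _ hx => hC.nonneg hx

theorem Consistent.goodProb_le_one (hC : M.Consistent .isPrivate σ π) (i : Player)
    (l : List Step) : π.goodProb .isPrivate i (view .isPrivate i l) ≤ 1 := by
  rw [← hC.sum_eq_one i l]
  exact le_add_of_nonneg_right (Finset.sum_nonneg fun _ hx => hC.nonneg hx)

theorem Consistent.goodProb_of_informed (hC : M.Consistent .isPrivate σ π) {l : List Step}
    (hl : Informed i l) : π.goodProb .isPrivate i (view .isPrivate i l) = 1 := by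
  have h := hC.sum_eq_one i l
  rw [Finset.sum_eq_zero (f := fun x => π i (view .isPrivate i l) .bad x), add_zero] at h
  · exact h
  · intro x hx
    refine hC.bad_eq_zero hx (Informed.success_mem (i := i) ?_)
    rw [Informed, mem_infoSet.1 hx]
    exact hl

theorem Consistent.goodProb_eq_one_of_prior (hC : M.Consistent .isPrivate σ π) (hp : M.p0 = 1)
    (i : Player) (l : List Step) : π.goodProb .isPrivate i (view .isPrivate i l) = 1 := by
  have h := hC.sum_eq_one i l
  rw [Finset.sum_eq_zero (f := fun x => π i (view .isPrivate i l) .bad x), add_zero] at h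
  · exact h
  · intro x hx
    obtain ⟨τ, hτ, -, hlim⟩ := hC
    refine tendsto_nhds_unique (hlim i l .bad x hx) (tendsto_const_nhds.congr fun n => ?_)
    simp [bayes, prior, hp]

/-- Along completely mixed profiles the own choice probability cancels from Bayes' rule, so the
update passes to the limit whether or not the choice is prescribed. -/
theorem Consistent.goodProb_own_risky (hC : M.Consistent .isPrivate σ π) {h : List Arm}
    (hi : mover h.length = i) :
    π.goodProb .isPrivate i (unsuccessful (Arm.risky :: h)) =
      M.phi (π.goodProb .isPrivate i (unsuccessful h)) := by
  have h0 := hC.goodProb_nonneg i (failing h)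
  have h1 := hC.goodProb_le_one i (failing h)
  obtain ⟨τ, hτ, -, hlim⟩ := hC
  have l1 := Consistent.tendsto_goodProb hlim i (failing (Arm.risky :: h))
  have l2 := Consistent.tendsto_goodProb hlim i (failing h)
  simp only [view_failing] at l1 l2 h0 h1
  set p := π.goodProb .isPrivate i (unsuccessful h)
  have hx := M.one_sub_lam_pos
  have hl := M.lam_pos
  have hden : p * (1 - M.lam) + (1 - p) ≠ 0 := by nlinarith
  have l3 := (l2.mul_const (1 - M.lam)).div
    ((l2.mul_const (1 - M.lam)).add (l2.const_sub 1)) hden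
  refine tendsto_nhds_unique l1 (l3.congr fun n => ?_)
  have hm : mover (unsuccessful h).length = i := by simpa using hi
  have hpos := obsProb_pos (M := M) (hτ n) i (failing h)
  have hG := obsStateProb_good_pos (M := M) (hτ n) i (failing h)
  have hB := obsStateProb_nonneg (M := M) (τ n) i (unsuccessful h) .bad
  have ht := (hτ n i (unsuccessful h)).1
  rw [view_failing] at hpos hG
  simp only [Pi.div_apply, goodProb_bayes]
  rw [unsuccessful_cons, obsProb_eq (o := _ :: _), obsStateProb_own_risky (τ n) hm,
    obsStateProb_own_risky (τ n) hm]
  rw [obsProb_eq] at hpos ⊢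
  simp only [successProb, sub_zero, mul_one]
  set G := M.obsStateProb (τ n) i (unsuccessful h) .good
  set B := M.obsStateProb (τ n) i (unsuccessful h) .bad
  have h2 : 1 - G / (G + B) = B / (G + B) := by field_simp; ring
  have h3 : 0 < G * (1 - M.lam) + B := by positivity
  have h4 : 0 < (τ n i (unsuccessful h) : ℝ) * (1 - M.lam) * G +
    (τ n i (unsuccessful h) : ℝ) * B := by positivity
  rw [h2, div_mul_eq_mul_div, ← add_div, div_div_div_cancel_right₀ hpos.ne', div_eq_div_iff h3.ne'
    h4.ne']
  ring

theorem Consistent.goodProb_own_safe (hC : M.Consistent .isPrivate σ π) {h : List Arm}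
    (hi : mover h.length = i) :
    π.goodProb .isPrivate i (unsuccessful (Arm.safe :: h)) =
      π.goodProb .isPrivate i (unsuccessful h) := by
  obtain ⟨τ, hτ, -, hlim⟩ := hC
  have l1 := Consistent.tendsto_goodProb hlim i (failing (Arm.safe :: h))
  have l2 := Consistent.tendsto_goodProb hlim i (failing h)
  simp only [view_failing] at l1 l2
  refine tendsto_nhds_unique l1 (l2.congr fun n => ?_)
  have hm : mover (unsuccessful h).length = i := by simpa using hi
  have ht := sub_pos.2 (hτ n i (unsuccessful h)).2
  simp only [goodProb_bayes]
  rw [unsuccessful_cons, obsProb_eq (o := _ :: _), obsStateProb_own_safe (τ n) hm,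
    obsStateProb_own_safe (τ n) hm, ← mul_add, ← obsProb_eq, mul_div_mul_left _ _ ht.ne']

/-- The probability that player `i`, after the sequence `h` of choices and without a success,
assigns to the event that the state is good and his opponent was successful. -/
def _root_.Experimentation.BeliefSystem.informedProb (π : BeliefSystem) (i : Player)
    (h : List Arm) : ℝ :=
  ∑ x ∈ (infoSet .isPrivate i (unsuccessful h)).erase (failing h), π i (unsuccessful h) .good x

theorem goodProb_eq_add (π : BeliefSystem) (i : Player) (h : List Arm) :
    π.goodProb .isPrivate i (unsuccessful h) =
      π i (unsuccessful h) .good (failing h) + π.informedProb i h :=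
  (Finset.add_sum_erase _ _ (failing_mem_infoSet .isPrivate i h)).symm

theorem Consistent.informedProb_nonneg (hC : M.Consistent .isPrivate σ π) (i : Player)
    (h : List Arm) : 0 ≤ π.informedProb i h := by
  refine Finset.sum_nonneg fun x hx => ?_
  have := hC.nonneg (i := i) (l := failing h) (x := x) (θ := .good)
  rw [view_failing] at this
  exact this (Finset.mem_of_mem_erase hx)

theorem Consistent.failing_nonneg (hC : M.Consistent .isPrivate σ π) (i : Player)
    (h : List Arm) (θ : State) : 0 ≤ π i (unsuccessful h) θ (failing h) := by
  have := hC.nonneg (i := i) (l := failing h) (x := failing h) (θ := θ)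
  rw [view_failing] at this
  exact this (failing_mem_infoSet _ i h)

theorem Consistent.sum_bad (hC : M.Consistent .isPrivate σ π) (i : Player) (h : List Arm)
    (f : List Step → ℝ) :
    ∑ x ∈ infoSet .isPrivate i (unsuccessful h), π i (unsuccessful h) .bad x * f x =
      π i (unsuccessful h) .bad (failing h) * f (failing h) := by
  refine Finset.sum_eq_single_of_mem _ (failing_mem_infoSet _ i h) fun x hx hne => ?_
  have := hC.bad_eq_zero (i := i) (l := failing h) (x := x)
  rw [view_failing] at this
  rw [this hx (success_mem_of_ne_failing hx hne), zero_mul]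

theorem Consistent.goodProb_add_bad (hC : M.Consistent .isPrivate σ π) (i : Player)
    (h : List Arm) : π.goodProb .isPrivate i (unsuccessful h) +
      π i (unsuccessful h) .bad (failing h) = 1 := by
  have h1 := hC.sum_eq_one i (failing h)
  have h2 := hC.sum_bad i h fun _ => 1
  simp only [mul_one] at h2
  rw [view_failing, h2] at h1
  exact h1

/-- The likelihood ratio of the failing history does not depend on the profile. It survives in the
limit and ties the two weights together on and off path. -/
theorem Consistent.good_failing (hC : M.Consistent .isPrivate σ π) (i : Player) (h : List Arm) :
    (1 - M.p0) * π i (unsuccessful h) .good (failing h) =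
      M.p0 * (1 - M.lam) ^ numExperiments h * π i (unsuccessful h) .bad (failing h) := by
  obtain ⟨τ, hτ, -, hlim⟩ := hC
  have l1 := hlim i (failing h) .good (failing h) (mem_infoSet.2 rfl)
  have l2 := hlim i (failing h) .bad (failing h) (mem_infoSet.2 rfl)
  rw [view_failing] at l1 l2
  refine tendsto_nhds_unique (l1.const_mul (1 - M.p0)) ((l2.const_mul _).congr fun n => ?_)
  have h1 := M.joint_good_failing .isPrivate (τ n) h
  simp only [bayes]
  rw [mul_div_assoc', mul_div_assoc']
  exact congrArg (· / _) h1.symm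

/-- Bayes' rule in the limit, when informed opponents experiment for sure and uninformed ones with
probability `σ j`; `hne` keeps the limiting denominator away from zero. -/
theorem Consistent.goodProb_other_risky (hC : M.Consistent .isPrivate σ π) {h : List Arm}
    (hij : i ≠ j) (hj : mover h.length = j)
    (hinf : ∀ x, Informed j x → mover x.length = j → σ j (view .isPrivate j x) = 1)
    (hne : π i (unsuccessful h) .good (failing h) * (σ j (unsuccessful h) : ℝ) +
      π.informedProb i h + π i (unsuccessful h) .bad (failing h) * (σ j (unsuccessful h) : ℝ) ≠ 0) :
    π.goodProb .isPrivate i (unsuccessful (Arm.risky :: h)) =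
      (π i (unsuccessful h) .good (failing h) * (σ j (unsuccessful h) : ℝ) + π.informedProb i h) /
      (π i (unsuccessful h) .good (failing h) * (σ j (unsuccessful h) : ℝ) +
      π.informedProb i h + π i (unsuccessful h) .bad (failing h) * (σ j (unsuccessful h) : ℝ)) := by
  have hgood : ∑ x ∈ infoSet .isPrivate i (unsuccessful h),
      π i (unsuccessful h) .good x * (σ j (view .isPrivate j x) : ℝ) =
      π i (unsuccessful h) .good (failing h) * (σ j (unsuccessful h) : ℝ) +
        π.informedProb i h := by
    rw [← Finset.add_sum_erase _ _ (failing_mem_infoSet .isPrivate i h), view_failing,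
      BeliefSystem.informedProb]
    congr 1
    refine Finset.sum_congr rfl fun x hx => ?_
    have h1 := Finset.mem_erase.1 hx
    have h2 := length_of_mem_infoSet h1.2
    rw [hinf x (informed_of_ne_failing hij h1.2 h1.1) (by rw [h2, length_unsuccessful, hj]),
      Set.Icc.coe_one, mul_one]
  have hbad := hC.sum_bad i h fun x => (σ j (view .isPrivate j x) : ℝ)
  rw [view_failing] at hbad
  obtain ⟨τ, hτ, hτσ, hlim⟩ := hC
  have l1 := Consistent.tendsto_goodProb hlim i (failing (Arm.risky :: h))
  have l2 : ∀ θ, Tendsto (fun n => ∑ x ∈ infoSet .isPrivate i (unsuccessful h),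
      M.bayes .isPrivate (τ n) i (unsuccessful h) θ x * (τ n j (view .isPrivate j x) : ℝ)) atTop
      (nhds (∑ x ∈ infoSet .isPrivate i (unsuccessful h),
        π i (unsuccessful h) θ x * (σ j (view .isPrivate j x) : ℝ))) := by
    intro θ
    refine tendsto_finsetSum _ fun x hx => Tendsto.mul ?_ (hτσ j _)
    have := hlim i (failing h) θ x
    rw [view_failing] at this
    exact this hx
  have lg := l2 .good
  have lb := l2 .bad
  rw [hgood] at lg
  rw [hbad] at lb
  rw [view_failing] at l1
  refine tendsto_nhds_unique l1 ((lg.div (lg.add lb) hne).congr fun n => ?_)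
  have hm : mover (unsuccessful h).length = j := by simpa using hj
  have hpos := obsProb_pos (M := M) (hτ n) i (failing h)
  rw [view_failing] at hpos
  have key : ∀ θ, ∑ x ∈ infoSet .isPrivate i (unsuccessful h),
      M.bayes .isPrivate (τ n) i (unsuccessful h) θ x * (τ n j (view .isPrivate j x) : ℝ) =
      M.obsStateProb (τ n) i ((Arm.risky, false) :: unsuccessful h) θ /
        M.obsProb .isPrivate (τ n) i (unsuccessful h) := by
    intro θ
    rw [obsStateProb_other_risky (τ n) hij hm, Finset.sum_div]
    refine Finset.sum_congr rfl fun x _ => ?_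
    rw [bayes, joint]
    ring
  simp only [Pi.div_apply, key]
  rw [goodProb_bayes, unsuccessful_cons, obsProb_eq (o := _ :: _), ← add_div,
    div_div_div_cancel_right₀ hpos.ne']

/-- If `i` knows the private history of `j`, then the trembles of `j` are constant on the
information set and cancel, so that even an unprescribed `R` brings no news. -/
theorem Consistent.goodProb_other_risky_of_view (hC : M.Consistent .isPrivate σ π) {h : List Arm}
    (hij : i ≠ j) (hj : mover h.length = j)
    (hview : ∀ x ∈ infoSet .isPrivate i (unsuccessful h),
      view .isPrivate j x = unsuccessful h) :
    π.goodProb .isPrivate i (unsuccessful (Arm.risky :: h)) =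
      π.goodProb .isPrivate i (unsuccessful h) := by
  obtain ⟨τ, hτ, -, hlim⟩ := hC
  have l1 := Consistent.tendsto_goodProb hlim i (failing (Arm.risky :: h))
  have l2 := Consistent.tendsto_goodProb hlim i (failing h)
  simp only [view_failing] at l1 l2
  refine tendsto_nhds_unique l1 (l2.congr fun n => ?_)
  have hm : mover (unsuccessful h).length = j := by simpa using hj
  have ht := (hτ n j (unsuccessful h)).1
  have key : ∀ θ, M.obsStateProb (τ n) i ((Arm.risky, false) :: unsuccessful h) θ =
      (τ n j (unsuccessful h) : ℝ) * M.obsStateProb (τ n) i (unsuccessful h) θ := by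
    intro θ
    rw [obsStateProb_other_risky (τ n) hij hm, obsStateProb, Finset.mul_sum]
    refine Finset.sum_congr rfl fun x hx => ?_
    rw [hview x hx, mul_comm]
  simp only [goodProb_bayes]
  rw [unsuccessful_cons, obsProb_eq (o := _ :: _), key, key, ← mul_add, ← obsProb_eq,
    mul_div_mul_left _ _ ht.ne']

theorem goodProb_nil (hC : M.Consistent .isPrivate σ π) (i : Player) :
    π.goodProb .isPrivate i [] = M.p0 := by
  obtain ⟨τ, hτ, -, hlim⟩ := hC
  have l1 := Consistent.tendsto_goodProb hlim i []
  refine tendsto_nhds_unique l1 (tendsto_const_nhds.congr fun n => ?_)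
  have h : infoSet .isPrivate i [] = {[]} := by
    ext x
    rw [mem_infoSet, Finset.mem_singleton]
    cases x <;> simp [view]
  simp [view, goodProb_bayes, obsProb_eq, obsStateProb, h, joint, prior, pathProb]

/-- A player whose opponent experimented at his last move does not exclude a success. -/
theorem Consistent.informedProb_ge (hC : M.Consistent .isPrivate σ π) {h : List Arm} (a : Arm)
    (hij : i ≠ j) (hj : mover h.length = j) :
    M.lam * π i (unsuccessful (a :: Arm.risky :: h)) .good (failing (a :: Arm.risky :: h)) ≤
      (1 - M.lam) * π.informedProb i (a :: Arm.risky :: h) := by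
  obtain ⟨s, hs⟩ : ∃ s, s ≠ Step.success ∧ ∀ h, failing (a :: h) = s :: failing h := by
    cases a
    · exact ⟨.safe, by simp, fun h => by simp⟩
    · exact ⟨.failure, by simp, fun h => by simp⟩
  have hm : mover (a :: Arm.risky :: h).length = j := by simp [mover_add_two, hj]
  have hi : mover (Arm.risky :: h).length = i := mover_succ_eq (by rw [hj]; exact hij.symm)
  -- The history `y` differs from the failing one only in the success of the latest experiment of
  -- `j`. Since then only `i` has moved, who cannot see the difference, so in the good state the
  -- probabilities are in the ratio `λ : 1 - λ` under every profile.
  set y := s :: Step.success :: failing h with hy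
  have hview : view .isPrivate i y = unsuccessful (a :: Arm.risky :: h) := by
    have h1 : view .isPrivate i (failing (a :: Arm.risky :: h)) = _ := view_failing _ _ _
    rw [← h1, hs.2, failing_risky, hy]
    simp [view, observe, Step.arm, hj, hij.symm]
  have hmem : y ∈ infoSet .isPrivate i (unsuccessful (a :: Arm.risky :: h)) :=
    mem_infoSet.2 hview
  have hne : y ≠ failing (a :: Arm.risky :: h) := by
    rw [hs.2, failing_risky, hy]
    simp
  have h2 : M.lam * π i (unsuccessful (a :: Arm.risky :: h)) .good
      (failing (a :: Arm.risky :: h)) =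
      (1 - M.lam) * π i (unsuccessful (a :: Arm.risky :: h)) .good y := by
    obtain ⟨τ, hτ, -, hlim⟩ := hC
    have l1 := hlim i (failing (a :: Arm.risky :: h)) .good (failing (a :: Arm.risky :: h))
      (mem_infoSet.2 rfl)
    have l2 := hlim i (failing (a :: Arm.risky :: h)) .good y
    rw [view_failing] at l1 l2
    refine tendsto_nhds_unique (l1.const_mul M.lam) (((l2 hmem).const_mul (1 - M.lam)).congr
      fun n => ?_)
    have hv : view .isPrivate i (Step.success :: failing h) =
        view .isPrivate i (Step.failure :: failing h) := by
      simp [view, observe, Step.arm, hj, hij.symm]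
    have hstep : M.stepProb .isPrivate (τ n) .good (Step.success :: failing h) s =
        M.stepProb .isPrivate (τ n) .good (Step.failure :: failing h) s := by
      have hi' : mover (h.length + 1) = i := hi
      cases s <;> simp [stepProb, hv, hi']
    simp only [bayes]
    rw [hs.2, failing_risky, hy, pathProb, pathProb, pathProb, pathProb, hstep]
    simp only [stepProb, successProb]
    ring
  rw [h2]
  refine mul_le_mul_of_nonneg_left ?_ M.one_sub_lam_pos.le
  refine Finset.single_le_sum (f := fun x => π i (unsuccessful (a :: Arm.risky :: h)) .good x)
    (fun x hx => ?_) (Finset.mem_erase.2 ⟨hne, hmem⟩)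
  have := hC.nonneg (i := i) (l := failing (a :: Arm.risky :: h)) (x := x) (θ := .good)
  rw [view_failing] at this
  exact this (Finset.mem_of_mem_erase hx)

end Model

/-! ### Private outcomes: sequential rationality and the possible beliefs -/

namespace Model

variable {M : Model} {σ : Profile} {π : BeliefSystem} {i j : Player}

theorem SequentiallyRational.value_le (hE : M.SequentiallyRational .isPrivate σ π) {l : List Step}
    (hl : mover l.length = i) (τ : Strategy) :
    ∑ θ, ∑ x ∈ infoSet .isPrivate i (view .isPrivate i l), π i (view .isPrivate i l) θ x *
        M.value .isPrivate (Function.update σ i τ) i θ x ≤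
      ∑ θ, ∑ x ∈ infoSet .isPrivate i (view .isPrivate i l), π i (view .isPrivate i l) θ x *
        M.value .isPrivate σ i θ x := by
  have key : ∀ σ' : Profile, ∑ θ, ∑ x ∈ infoSet .isPrivate i (view .isPrivate i l),
      π i (view .isPrivate i l) θ x * M.value .isPrivate σ' i θ x = M.δ ^ (l.length / 2) *
      ∑ θ, ∑ x ∈ infoSet .isPrivate i (view .isPrivate i l),
        π i (view .isPrivate i l) θ x * M.contPayoff .isPrivate σ' i θ x := by
    intro σ'
    simp only [Finset.mul_sum]
    refine Finset.sum_congr rfl fun θ _ => Finset.sum_congr rfl fun x hx => ?_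
    rw [value, length_of_mem_infoSet hx, length_view]
    ring
  rw [key, key]
  exact mul_le_mul_of_nonneg_left (hE i l hl τ) (pow_nonneg M.δ_pos.le _)

/-- Later moves earn at most `g` each, and the share `1 - δ` of the current move is earned only if
the experiment takes place. -/
theorem value_good_le {mon : Monitoring} {l : List Step} (hl : mover l.length = i) :
    M.value mon σ i .good l ≤
      M.g * ((σ i (view mon i l) : ℝ) * (1 - M.δ) + M.δ) * M.annuity i l.length := by
  have h1 := riskyValue_good_le (mon := mon) (σ := σ) hl (v := M.g * M.δ) (by
    have := M.value_le (mon := mon) (σ := σ) (i := i) (θ := .good) (Step.failure :: l)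
    rwa [List.length_cons, M.annuity_succ_of_mover hl, ← mul_assoc] at this)
  have h2 := M.value_le (mon := mon) (σ := σ) (i := i) (θ := .good) (Step.safe :: l)
  rw [List.length_cons, M.annuity_succ_of_mover hl] at h2
  rw [value_eq_mix hl]
  have h3 := mul_le_mul_of_nonneg_left h1 (σ i (view mon i l)).2.1
  have h4 := mul_le_mul_of_nonneg_left h2 (sub_nonneg.2 (σ i (view mon i l)).2.2)
  linarith

/-- A player who is certain of the good state experiments. -/
theorem IsSequentialEq.eq_one_of_goodProb_eq_one (hE : M.IsSequentialEq .isPrivate σ π)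
    {l : List Step} (hl : mover l.length = i)
    (h1 : π.goodProb .isPrivate i (view .isPrivate i l) = 1) :
    σ i (view .isPrivate i l) = 1 := by
  have hsum := hE.2.sum_eq_one i l
  have h1' : ∑ x ∈ infoSet .isPrivate i (view .isPrivate i l),
      π i (view .isPrivate i l) .good x = 1 := h1
  rw [h1', add_eq_left, Finset.sum_eq_zero_iff_of_nonneg fun x hx => hE.2.nonneg hx] at hsum
  -- The constant strategy `1` attains the maximum `g` in the good state; by `value_good_le` the
  -- equilibrium matches it only if the experiment is certain now.
  have h := hE.1.value_le hl 1
  rw [sum_state, sum_state, Finset.sum_eq_zero (s := infoSet _ _ _)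
    (f := fun x => π i (view .isPrivate i l) .bad x * _) fun x hx => by rw [hsum x hx, zero_mul],
    Finset.sum_eq_zero (s := infoSet _ _ _)
    (f := fun x => π i (view .isPrivate i l) .bad x * M.value .isPrivate σ i .bad x)
    fun x hx => by rw [hsum x hx, zero_mul], add_zero, add_zero] at h
  have hL : ∑ x ∈ infoSet .isPrivate i (view .isPrivate i l), π i (view .isPrivate i l) .good x *
      M.value .isPrivate (Function.update σ i 1) i .good x = M.g * M.annuity i l.length := by
    rw [← one_mul (M.g * _), ← h1', Finset.sum_mul]
    refine Finset.sum_congr rfl fun x hx => ?_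
    rw [M.value_eq_of_experiments, length_of_mem_infoSet hx, length_view]
    intro y _
    rw [Function.update_self]
    rfl
  have hR : ∑ x ∈ infoSet .isPrivate i (view .isPrivate i l), π i (view .isPrivate i l) .good x *
      M.value .isPrivate σ i .good x ≤ M.g *
        ((σ i (view .isPrivate i l) : ℝ) * (1 - M.δ) + M.δ) * M.annuity i l.length := by
    refine le_of_le_of_eq ?_ (one_mul (M.g * _ * _))
    refine le_of_le_of_eq ?_ (congrArg (fun r => r * _) h1')
    rw [Finset.sum_mul]
    refine Finset.sum_le_sum fun x hx => mul_le_mul_of_nonneg_left ?_ (hE.2.nonneg hx)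
    have hlen : x.length = l.length := by rw [length_of_mem_infoSet hx, length_view]
    have := value_good_le (M := M) (σ := σ) (i := i) (mon := .isPrivate) (l := x)
      (by rw [hlen, hl])
    rwa [mem_infoSet.1 hx, hlen] at this
  rw [hL] at h
  have h2 := le_of_mul_le_mul_right (h.trans hR) (M.annuity_pos i l.length)
  have h3 := le_of_mul_le_mul_left ((mul_one M.g).le.trans h2) M.g_pos
  have h4 : (1 : ℝ) ≤ σ i (view .isPrivate i l) := by
    have := sub_pos.2 M.δ_lt_one
    nlinarith
  exact Subtype.ext (le_antisymm (σ i _).2.2 h4)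

theorem IsSequentialEq.eq_one_of_informed (hE : M.IsSequentialEq .isPrivate σ π) {l : List Step}
    (hl : Informed i l) (hm : mover l.length = i) : σ i (view .isPrivate i l) = 1 :=
  hE.eq_one_of_goodProb_eq_one hm (hE.2.goodProb_of_informed hl)

/-- Successful and unsuccessful opponents both experiment, so `R` carries no information. -/
theorem IsSequentialEq.goodProb_of_prescribed (hE : M.IsSequentialEq .isPrivate σ π)
    {h : List Arm} (hij : i ≠ j) (hj : mover h.length = j) (hσ : σ j (unsuccessful h) = 1) :
    π.goodProb .isPrivate i (unsuccessful (Arm.risky :: h)) =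
      π.goodProb .isPrivate i (unsuccessful h) := by
  have h1 := hE.2.goodProb_add_bad i h
  have h2 := goodProb_eq_add π i h
  have h3 := hE.2.goodProb_other_risky hij hj (fun x => hE.eq_one_of_informed)
  rw [hσ, Set.Icc.coe_one, mul_one, mul_one, ← h2, h1, div_one] at h3
  exact h3 one_ne_zero

/-- Only a successful opponent experiments, and `hs` gives that event positive weight, so Bayes'
rule applies in the limit. -/
theorem IsSequentialEq.goodProb_of_unprescribed (hE : M.IsSequentialEq .isPrivate σ π)
    {h : List Arm} (hij : i ≠ j) (hj : mover h.length = j) (hσ : σ j (unsuccessful h) = 0)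
    (hs : π.informedProb i h ≠ 0) :
    π.goodProb .isPrivate i (unsuccessful (Arm.risky :: h)) = 1 := by
  have h3 := hE.2.goodProb_other_risky hij hj (fun x => hE.eq_one_of_informed)
  rw [hσ, Set.Icc.coe_zero, mul_zero, mul_zero, zero_add, add_zero, div_self hs] at h3
  exact h3 hs

/-- As `p₀ < 1`, the failing history has weight in the good state only if it has weight in the bad
one. Certainty therefore rests on a success of the opponent, after which `R` is expected. -/
theorem IsSequentialEq.goodProb_risky_eq_one (hE : M.IsSequentialEq .isPrivate σ π)
    (hp : M.p0 < 1) {h : List Arm} (hij : i ≠ j) (hj : mover h.length = j)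
    (h1 : π.goodProb .isPrivate i (unsuccessful h) = 1) :
    π.goodProb .isPrivate i (unsuccessful (Arm.risky :: h)) = 1 := by
  have hb := hE.2.goodProb_add_bad i h
  rw [h1, add_eq_left] at hb
  have ha := hE.2.good_failing i h
  rw [hb, mul_zero, mul_eq_zero_iff_left (sub_pos.2 hp).ne'] at ha
  have hs := goodProb_eq_add π i h
  rw [h1, ha, zero_add] at hs
  have h3 := hE.2.goodProb_other_risky hij hj (fun x => hE.eq_one_of_informed)
  rw [ha, hb, ← hs] at h3
  simpa using h3

/-- If no success were deemed possible, `informedProb_ge` would remove the failing history in the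
good state and `good_failing` in the bad one, leaving belief `1`. -/
theorem Consistent.informedProb_ne_zero (hC : M.Consistent .isPrivate σ π) {h : List Arm}
    {a : Arm} (hij : i ≠ j) (hj : mover h.length = j)
    (hlt : π.goodProb .isPrivate i (unsuccessful (a :: Arm.risky :: h)) ≠ 1) :
    π.informedProb i (a :: Arm.risky :: h) ≠ 0 := by
  intro hs
  have h1 := hC.informedProb_ge a hij hj
  rw [hs, mul_zero] at h1
  have h2 := hC.failing_nonneg i (a :: Arm.risky :: h) .good
  have h3 : π i (unsuccessful (a :: Arm.risky :: h)) .good (failing (a :: Arm.risky :: h)) = 0 :=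
    le_antisymm (nonpos_of_mul_nonpos_right h1 M.lam_pos) h2
  have h4 := goodProb_eq_add π i (a :: Arm.risky :: h)
  have h5 := hC.good_failing i (a :: Arm.risky :: h)
  have h6 := hC.goodProb_add_bad i (a :: Arm.risky :: h)
  rw [h3, mul_zero] at h5
  have h7 := mul_pos M.p0_pos (pow_pos M.one_sub_lam_pos (numExperiments (a :: Arm.risky :: h)))
  rcases mul_eq_zero.1 h5.symm with h8 | h8
  · exact h7.ne' h8
  · rw [h8, add_zero] at h6
    exact hlt h6

theorem IsReasonableSE.goodProb_safe (hE : M.IsReasonableSE σ π) {h : List Arm}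
    (hi : mover (Arm.safe :: h).length = i) :
    π.goodProb .isPrivate i (unsuccessful (Arm.safe :: h)) = M.phi^[numExperiments h] M.p0 :=
  hi ▸ hE.2.1 h

/-- Own failures apply `phi`, a choice of `S` by the opponent is governed by reasonableness, and a
prescribed `R` changes nothing. Only an unprescribed `R` needs a closer look. -/
theorem IsReasonableSE.belief_cases (hE : M.IsReasonableSE σ π) (hσ : σ.Pure) (hp : M.p0 < 1)
    (i : Player) (h : List Arm) : π.goodProb .isPrivate i (unsuccessful h) = 1 ∨
      ∃ n ≤ numExperiments h, π.goodProb .isPrivate i (unsuccessful h) = M.phi^[n] M.p0 := by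
  induction h with
  | nil => exact Or.inr ⟨0, le_rfl, goodProb_nil hE.1.2 i⟩
  | cons a h ih =>
    by_cases hi : mover h.length = i
    · cases a
      · rw [hE.1.2.goodProb_own_safe hi, numExperiments_safe]
        exact ih
      · rw [hE.1.2.goodProb_own_risky hi, numExperiments_risky]
        rcases ih with ih | ⟨n, hn, ih⟩
        · exact Or.inl (by rw [ih, phi_one])
        · exact Or.inr ⟨n + 1, by omega, by rw [ih, Function.iterate_succ_apply']⟩
    · have hi' : mover (a :: h).length = i := mover_succ_eq hi
      cases a
      · exact Or.inr ⟨numExperiments h, by simp, hE.goodProb_safe hi'⟩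
      · rcases hσ h with h0 | h1
        · match h, hi, hi', h0, ih with
          | [], hi, hi', h0, ih =>
            rw [hE.1.2.goodProb_other_risky_of_view (Ne.symm hi) rfl]
            · exact Or.inr ⟨0, by simp, goodProb_nil hE.1.2 i⟩
            · intro x hx
              have := length_of_mem_infoSet hx
              simp only [unsuccessful_nil, List.length_nil, List.length_eq_zero_iff] at this
              rw [this]
              rfl
          | [a], hi, hi', h0, ih =>
            rw [hE.1.2.goodProb_other_risky_of_view (Ne.symm hi) rfl]
            · rcases ih with ih | ⟨n, hn, ih⟩
              · exact Or.inl ih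
              · exact Or.inr ⟨n, hn.trans (by simp), ih⟩
            · intro x hx
              by_contra hne
              have hx' : x ≠ failing [a] := by
                rintro rfl
                exact hne (view_failing _ _ _)
              have hinf := informed_of_ne_failing (Ne.symm hi) hx hx'
              have hlen := length_of_mem_infoSet hx
              simp only [length_unsuccessful] at hlen
              obtain ⟨s, rfl⟩ := List.length_eq_one_iff.1 hlen
              cases s <;> simp [Informed, view, observe, Step.arm, mover] at hinf
          | a :: Arm.safe :: h, hi, hi', h0, ih =>
            right
            refine ⟨numExperiments (a :: Arm.safe :: h), by simp, ?_⟩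
            have := hE.2.2 h a
            rwa [hi'] at this
          | a :: Arm.risky :: h, hi, hi', h0, ih =>
            left
            have hm : mover (a :: Arm.risky :: h).length = mover h.length := by
              simp [mover_add_two]
            by_cases h1 : π.goodProb .isPrivate i (unsuccessful (a :: Arm.risky :: h)) = 1
            · exact hE.1.goodProb_risky_eq_one hp (Ne.symm hi) rfl h1
            · exact hE.1.goodProb_of_unprescribed (Ne.symm hi) rfl h0
                (hE.1.2.informedProb_ne_zero (Ne.symm hi) hm.symm h1)
        · rw [hE.1.goodProb_of_prescribed (Ne.symm hi) rfl h1, numExperiments_risky]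
          rcases ih with ih | ⟨n, hn, ih⟩
          · exact Or.inl ih
          · exact Or.inr ⟨n, by omega, ih⟩

end Model

/-! ### Private outcomes: no experiments below `p̂` -/

namespace Model

variable {M : Model} {σ : Profile} {π : BeliefSystem} {i j : Player}

theorem IsSequentialEq.unsuccessful_value_le (hE : M.IsSequentialEq .isPrivate σ π)
    {h : List Arm} (hi : mover h.length = i) (τ : Strategy) :
    ∑ x ∈ infoSet .isPrivate i (unsuccessful h), π i (unsuccessful h) .good x *
        M.value .isPrivate (Function.update σ i τ) i .good x +
      π i (unsuccessful h) .bad (failing h) *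
        M.value .isPrivate (Function.update σ i τ) i .bad (failing h) ≤
    ∑ x ∈ infoSet .isPrivate i (unsuccessful h), π i (unsuccessful h) .good x *
        M.value .isPrivate σ i .good x +
      π i (unsuccessful h) .bad (failing h) * M.value .isPrivate σ i .bad (failing h) := by
  have h1 := hE.1.value_le (l := failing h) (by rw [length_failing, hi]) τ
  rwa [view_failing, sum_state, sum_state, hE.2.sum_bad, hE.2.sum_bad] at h1

theorem Consistent.sum_good_le (hC : M.Consistent .isPrivate σ π) {h : List Arm}
    {f : List Step → ℝ} {v w : ℝ} (hv : f (failing h) ≤ v)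
    (hw : ∀ x ∈ infoSet .isPrivate i (unsuccessful h), x ≠ failing h → f x ≤ w) :
    ∑ x ∈ infoSet .isPrivate i (unsuccessful h), π i (unsuccessful h) .good x * f x ≤
      π i (unsuccessful h) .good (failing h) * v + π.informedProb i h * w := by
  rw [← Finset.add_sum_erase _ _ (failing_mem_infoSet .isPrivate i h),
    BeliefSystem.informedProb, Finset.sum_mul]
  refine add_le_add (mul_le_mul_of_nonneg_left hv (hC.failing_nonneg i h .good))
    (Finset.sum_le_sum fun x hx => ?_)
  have h1 := Finset.mem_erase.1 hx
  have h2 := hC.nonneg (i := i) (l := failing h) (x := x) (θ := .good)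
  rw [view_failing] at h2
  exact mul_le_mul_of_nonneg_left (hw x h1.2 h1.1) (h2 h1.2)

theorem Consistent.le_sum_good (hC : M.Consistent .isPrivate σ π) {h : List Arm}
    {f : List Step → ℝ} {v w : ℝ} (hv : v ≤ f (failing h))
    (hw : ∀ x ∈ infoSet .isPrivate i (unsuccessful h), x ≠ failing h → w ≤ f x) :
    π i (unsuccessful h) .good (failing h) * v + π.informedProb i h * w ≤
      ∑ x ∈ infoSet .isPrivate i (unsuccessful h), π i (unsuccessful h) .good x * f x := by
  have := hC.sum_good_le (i := i) (h := h) (f := fun x => -f x) (neg_le_neg hv)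
    fun x hx hne => neg_le_neg (hw x hx hne)
  simp only [mul_neg, Finset.sum_neg_distrib] at this
  linarith

/-- An upper bound for the payoff from a prescribed experiment, in terms of bounds `v` and `w` on
the payoffs after a failure when the opponent was not, respectively was, successful. -/
theorem IsSequentialEq.le_of_experiment (hE : M.IsSequentialEq .isPrivate σ π)
    {h : List Arm} (hi : mover h.length = i) (hσ : σ i (unsuccessful h) = 1) {d v w : ℝ}
    (hv : M.value .isPrivate σ i .good (failing (Arm.risky :: h)) ≤ v * M.annuity i h.length)
    (hw : ∀ x ∈ infoSet .isPrivate i (unsuccessful h), x ≠ failing h →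
      M.value .isPrivate σ i .good (Step.failure :: x) ≤ w * M.annuity i h.length)
    (τ : Strategy)
    (hd : d * M.annuity i h.length ≤
      ∑ x ∈ infoSet .isPrivate i (unsuccessful h), π i (unsuccessful h) .good x *
        M.value .isPrivate (Function.update σ i τ) i .good x +
      π i (unsuccessful h) .bad (failing h) *
        M.value .isPrivate (Function.update σ i τ) i .bad (failing h)) :
    d ≤ π.goodProb .isPrivate i (unsuccessful h) * (M.g * (1 - M.δ * (1 - M.lam))) +
      (1 - M.lam) * (π i (unsuccessful h) .good (failing h) * v + π.informedProb i h * w) -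
      (1 - π.goodProb .isPrivate i (unsuccessful h)) * (M.c * (1 - M.δ)) := by
  have hval : ∀ θ, ∀ x ∈ infoSet .isPrivate i (unsuccessful h),
      M.value .isPrivate σ i θ x = M.riskyValue .isPrivate σ i θ x := by
    intro θ x hx
    rw [value_eq_mix (by rw [length_of_mem_infoSet hx, length_unsuccessful, hi]),
      mem_infoSet.1 hx, hσ]
    simp
  have h1 := hd.trans (hE.unsuccessful_value_le hi τ)
  have h2 := hE.2.sum_good_le (i := i) (h := h) (f := M.value .isPrivate σ i .good)
    (v := (M.g * (1 - M.δ * (1 - M.lam)) + (1 - M.lam) * v) * M.annuity i h.length)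
    (w := (M.g * (1 - M.δ * (1 - M.lam)) + (1 - M.lam) * w) * M.annuity i h.length)
    (by
      rw [hval _ _ (failing_mem_infoSet _ i h)]
      have := riskyValue_good_le (M := M) (mon := .isPrivate) (σ := σ) (i := i) (l := failing h)
        (v := v) (by rw [length_failing, hi]) (by rw [length_failing, ← failing_risky]; exact hv)
      rwa [length_failing] at this)
    (by
      intro x hx hne
      have hlen : x.length = h.length := by rw [length_of_mem_infoSet hx, length_unsuccessful]
      rw [hval _ _ hx]
      have := riskyValue_good_le (M := M) (mon := .isPrivate) (σ := σ) (i := i) (l := x)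
        (v := w) (by rw [hlen, hi]) (by rw [hlen]; exact hw x hx hne)
      rwa [hlen] at this)
  have h3 := riskyValue_bad_le M .isPrivate σ i (failing h)
  rw [← hval _ _ (failing_mem_infoSet _ i h), length_failing] at h3
  have h4 := mul_le_mul_of_nonneg_left h3 (hE.2.failing_nonneg i h .bad)
  have h5 := hE.2.goodProb_add_bad i h
  have h6 := goodProb_eq_add π i h
  set a := π i (unsuccessful h) .good (failing h)
  set b := π i (unsuccessful h) .bad (failing h)
  set s := π.informedProb i h
  have h7 : 1 - π.goodProb .isPrivate i (unsuccessful h) = b := by linarith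
  rw [h7, h6]
  refine le_of_mul_le_mul_right ?_ (M.annuity_pos i h.length)
  linarith

/-- Abstaining for ever is worth `0`, and the payoff after a failure is at most `g δ`. The resulting
crude bound makes a lowest belief with an experiment exist. -/
theorem IsSequentialEq.belief_bound (hE : M.IsSequentialEq .isPrivate σ π)
    {h : List Arm} (hi : mover h.length = i) (hσ : σ i (unsuccessful h) = 1) :
    M.c * (1 - M.δ) / (M.c * (1 - M.δ) + M.g) ≤ π.goodProb .isPrivate i (unsuccessful h) := by
  have hc : 0 < M.c * (1 - M.δ) := mul_pos M.c_pos (sub_pos.2 M.δ_lt_one)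
  have hg := M.g_pos
  have hlen : M.annuity i (h.length + 1) = M.δ * M.annuity i h.length :=
    M.annuity_succ_of_mover hi
  have h1 := hE.le_of_experiment hi hσ (d := 0) (v := M.g * M.δ) (w := M.g * M.δ)
    (by
      have := M.value_le (mon := .isPrivate) (σ := σ) (i := i) (θ := .good)
        (failing (Arm.risky :: h))
      rwa [length_failing, List.length_cons, hlen, ← mul_assoc] at this)
    (by
      intro x hx _
      have := M.value_le (mon := .isPrivate) (σ := σ) (i := i) (θ := .good) (Step.failure :: x)
      rwa [List.length_cons, length_of_mem_infoSet hx, length_unsuccessful, hlen,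
        ← mul_assoc] at this)
    0
    (by
      have h0 : ∀ θ x, M.value .isPrivate (Function.update σ i 0) i θ x = 0 := fun θ x =>
        M.value_eq_zero_of_abstains fun y _ => by
          rw [Function.update_self]
          rfl
      simp [h0])
  have h6 := goodProb_eq_add π i h
  rw [div_le_iff₀ (by positivity)]
  have h7 : π i (unsuccessful h) .good (failing h) * (M.g * M.δ) +
      π.informedProb i h * (M.g * M.δ) =
      π.goodProb .isPrivate i (unsuccessful h) * (M.g * M.δ) := by
    rw [h6]
    ring
  rw [h7] at h1
  linarith

/-- Play the safe arm until the opponent has moved after `n + 1` moves, and then copy for ever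
the choice that he made at that move. -/
def copyAt (n : ℕ) : Strategy := fun o =>
  if (o.reverse[n + 1]?.map Prod.fst) = some Arm.risky then 1 else 0

theorem copyAt_of_length_le {n : ℕ} {o : List Obs} (h : o.length ≤ n + 1) : copyAt n o = 0 := by
  -- Counted from zero, the own safe move has number `n` and the reaction to be copied number `n +
  -- 1`; histories of length at most `n + 1` do not contain it yet, and the default is the safe arm.
  rw [copyAt, List.getElem?_eq_none (by simpa using h)]
  simp

theorem copyAt_append {n : ℕ} {o o' : List Obs} {a : Arm} {b : Bool} (h : o.length = n + 1) :
    copyAt n (o' ++ (a, b) :: o) = if a = Arm.risky then 1 else 0 := by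
  rw [copyAt]
  simp [h]

theorem copyAt_view {n : ℕ} {mon : Monitoring} {x : List Step} (h : x.length = n + 1) (y : List Step)
    (s : Step) : copyAt n (view mon i (y ++ s :: x)) = if s.arm = Arm.risky then 1 else 0 := by
  obtain ⟨o, -, ho⟩ := view_append mon i y (s :: x)
  rw [ho, view, observe]
  exact copyAt_append (by simpa using h)

/-- If the opponent experiments for sure after a choice of the safe arm, then copying him yields the
payoff of experimenting for ever from the next period on. -/
theorem value_copyAt_of_informed {n : ℕ} (hij : i ≠ j) {x : List Step} {σ' : Profile}
    (hσ' : ∀ y : List Step, σ' i (view .isPrivate i (y ++ Step.safe :: x)) =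
      copyAt n (view .isPrivate i (y ++ Step.safe :: x)))
    (h0 : σ' i (view .isPrivate i x) = 0)
    (hx : x.length = n) (hi : mover x.length = i)
    (hj : σ' j (view .isPrivate j (Step.safe :: x)) = 1) :
    M.value .isPrivate σ' i .good x = M.g * M.δ * M.annuity i n := by
  have hm : mover (Step.safe :: x).length = j := mover_succ_eq (hi ▸ hij)
  rw [M.value_of_safe (by rw [hi]; exact h0), M.value_of_risky (by rw [hm]; exact hj),
    if_neg (by rw [hm]; exact hij.symm)]
  have key : ∀ s : Step, s.arm = Arm.risky →
      M.value .isPrivate σ' i .good (s :: Step.safe :: x) = M.g * (M.δ * M.annuity i n) := by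
    intro s hs
    rw [M.value_eq_of_experiments, List.length_cons, List.length_cons, hx, M.annuity_add_two]
    intro y _
    have := hσ' (y ++ [s])
    rw [List.append_assoc, List.singleton_append] at this
    rw [this, copyAt_view (by simp [hx]), if_pos hs]
  rw [key _ rfl, key _ rfl]
  simp only [successProb]
  ring

theorem value_copyAt_of_safe {n : ℕ} (hij : i ≠ j) {x : List Step} {σ' : Profile} (θ : State)
    (hσ' : ∀ y : List Step, σ' i (view .isPrivate i (y ++ Step.safe :: x)) =
      copyAt n (view .isPrivate i (y ++ Step.safe :: x)))
    (h0 : σ' i (view .isPrivate i x) = 0)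
    (hx : x.length = n) (hi : mover x.length = i)
    (hj : σ' j (view .isPrivate j (Step.safe :: x)) = 0) :
    M.value .isPrivate σ' i θ x = 0 := by
  have hm : mover (Step.safe :: x).length = j := mover_succ_eq (hi ▸ hij)
  rw [M.value_of_safe (by rw [hi]; exact h0), M.value_of_safe (by rw [hm]; exact hj)]
  refine M.value_eq_zero_of_abstains fun y _ => ?_
  have := hσ' (y ++ [Step.safe])
  rw [List.append_assoc, List.singleton_append] at this
  rw [this, copyAt_view (by simp [hx]), if_neg (by simp [Step.arm])]

theorem exists_ne_player (i : Player) : ∃ j, i ≠ j := by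
  fin_cases i
  · exact ⟨1, by simp⟩
  · exact ⟨0, by simp⟩

/-- The belief `φ^{n_e(h)}(p₀)` is what results when all experiments are known to have failed; with
`good_failing` and total mass one, no weight is left for a hidden success. -/
theorem Consistent.informedProb_eq_zero (hC : M.Consistent .isPrivate σ π) (hp : M.p0 < 1)
    {h : List Arm}
    (hbel : π.goodProb .isPrivate i (unsuccessful h) = M.phi^[numExperiments h] M.p0) :
    π.informedProb i h = 0 ∧ π i (unsuccessful h) .good (failing h) =
      M.phi^[numExperiments h] M.p0 := by
  have h1 := hC.good_failing i h
  have h2 := hC.goodProb_add_bad i h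
  have h3 := goodProb_eq_add π i h
  have hD := M.phi_iterate_denom_pos hp (numExperiments h)
  rw [hbel, M.phi_iterate hp] at h2 h3
  have h4 : π i (unsuccessful h) .bad (failing h) =
      (1 - M.p0) / (M.p0 * (1 - M.lam) ^ numExperiments h + (1 - M.p0)) := by
    rw [← eq_sub_iff_add_eq'] at h2
    rw [h2]
    field_simp
    ring
  have h5 : π i (unsuccessful h) .good (failing h) = M.p0 * (1 - M.lam) ^ numExperiments h /
      (M.p0 * (1 - M.lam) ^ numExperiments h + (1 - M.p0)) := by
    rw [h4] at h1
    refine mul_left_cancel₀ (sub_pos.2 hp).ne' (h1.trans ?_)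
    ring
  refine ⟨?_, by rw [h5, M.phi_iterate hp]⟩
  rw [h5] at h3
  linarith

theorem IsReasonableSE.experiments_bounded (hE : M.IsReasonableSE σ π) (hp : M.p0 < 1) :
    ∃ k, ∀ (h : List Arm) (n : ℕ), σ (mover h.length) (unsuccessful h) = 1 →
      π.goodProb .isPrivate (mover h.length) (unsuccessful h) = M.phi^[n] M.p0 → n < k := by
  have hc : 0 < M.c * (1 - M.δ) := mul_pos M.c_pos (sub_pos.2 M.δ_lt_one)
  have hg := M.g_pos
  obtain ⟨k, hk⟩ := M.exists_phi_iterate_lt hp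
    (q := M.c * (1 - M.δ) / (M.c * (1 - M.δ) + M.g)) (by positivity)
  refine ⟨k, fun h n hσ hn => ?_⟩
  by_contra hlt
  have h1 := hE.1.belief_bound rfl hσ
  rw [hn] at h1
  exact absurd (hk n (not_lt.1 hlt)) h1.not_gt

/-- If nobody experiments at beliefs below `φ^k(p₀)`, then nobody does so after a choice of `S` that
reveals more than `k` failures. -/
theorem IsReasonableSE.safe_path (hE : M.IsReasonableSE σ π) {k : ℕ}
    (hk : ∀ (h : List Arm) (n : ℕ), k < n →
      π.goodProb .isPrivate (mover h.length) (unsuccessful h) = M.phi^[n] M.p0 →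
      σ (mover h.length) (unsuccessful h) = 0)
    {h : List Arm} (hh : k < numExperiments h) (i : Player) (θ : State) :
    M.value .isPrivate σ i θ (failing (Arm.safe :: h)) = 0 := by
  refine M.value_eq_zero_of_safe_path fun m => ?_
  -- The most recent choice has to be displayed as `S`, for reasonableness to fix the belief after
  -- it.
  have hrep : List.replicate m Arm.safe ++ Arm.safe :: h =
      Arm.safe :: (List.replicate m Arm.safe ++ h) := by
    rw [← List.cons_append, ← List.replicate_succ, List.replicate_succ', List.append_assoc]
    rfl
  rw [← failing_replicate_append, length_failing, view_failing, hrep]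
  refine hk _ (numExperiments h) hh ?_
  rw [hE.goodProb_safe rfl, numExperiments_replicate_append]

/-- The least belief at which an unsuccessful player experiments is at least `p̂`. -/
theorem IsReasonableSE.pHat_le_of_least (hE : M.IsReasonableSE σ π) (hσ : σ.Pure)
    (hp : M.p0 < 1) {h : List Arm} {k : ℕ} (hrisky : σ (mover h.length) (unsuccessful h) = 1)
    (hbel : π.goodProb .isPrivate (mover h.length) (unsuccessful h) = M.phi^[k] M.p0)
    (hk : ∀ (h : List Arm) (n : ℕ), k < n →
      π.goodProb .isPrivate (mover h.length) (unsuccessful h) = M.phi^[n] M.p0 →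
      σ (mover h.length) (unsuccessful h) = 0) :
    M.pHat ≤ M.phi^[k] M.p0 := by
  obtain ⟨i, hi⟩ : ∃ i, mover h.length = i := ⟨_, rfl⟩
  obtain ⟨j, hij⟩ := exists_ne_player i
  rw [hi] at hrisky hbel
  have hj1 : mover (h.length + 1) = j := mover_succ_eq (hi ▸ hij)
  have hi2 : mover (h.length + 2) = i := by rw [mover_add_two, hi]
  have hA1 : M.annuity i (h.length + 1) = M.δ * M.annuity i h.length :=
    M.annuity_succ_of_mover hi
  have hA2 := M.annuity_add_two (i := i) h.length
  have hA3 : M.annuity i (h.length + 3) = M.δ * (M.δ * M.annuity i h.length) := by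
    rw [← hA1, ← M.annuity_add_two]
  have hkle : k ≤ numExperiments h := by
    rcases hE.belief_cases hσ hp i h with h1 | ⟨n, hn, h1⟩
    · rw [hbel] at h1
      exact absurd h1 (M.phi_iterate_lt_one hp k).ne
    · rw [hbel] at h1
      rw [(M.phi_iterate_strictAnti hp).injective h1]
      exact hn
  have hlen : ∀ x ∈ infoSet .isPrivate i (unsuccessful h), x.length = h.length := fun x hx => by
    rw [length_of_mem_infoSet hx, length_unsuccessful]
  have hinf : ∀ x ∈ infoSet .isPrivate i (unsuccessful h), x ≠ failing h → ∀ s,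
      σ j (view .isPrivate j (s :: x)) = 1 := fun x hx hne s =>
    hE.1.eq_one_of_informed ((informed_of_ne_failing hij hx hne).cons s)
      (by rw [List.length_cons, hlen x hx, hj1])
  -- the payoff from a deviation to the safe arm
  obtain ⟨τ, hτ⟩ : ∃ τ : Strategy, π.informedProb i h * (M.g * M.δ) * M.annuity i h.length ≤
      ∑ x ∈ infoSet .isPrivate i (unsuccessful h), π i (unsuccessful h) .good x *
        M.value .isPrivate (Function.update σ i τ) i .good x +
      π i (unsuccessful h) .bad (failing h) *
        M.value .isPrivate (Function.update σ i τ) i .bad (failing h) := by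
    -- If the belief already counts every experiment as failed, then `informedProb` vanishes and
    -- abstaining will do. Otherwise `S` reveals more than `k` failures: an unsuccessful opponent
    -- then stops, a successful one experiments, and copying him earns `g δ` in the event of his
    -- success.
    rcases hkle.eq_or_lt with hkeq | hklt
    · refine ⟨0, ?_⟩
      have h0 : ∀ θ x, M.value .isPrivate (Function.update σ i 0) i θ x = 0 := fun θ x =>
        M.value_eq_zero_of_abstains fun y _ => by
          rw [Function.update_self]
          rfl
      have h6 := (hE.1.2.informedProb_eq_zero hp (hkeq ▸ hbel)).1
      simp [h0, h6]
    · refine ⟨copyAt h.length, ?_⟩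
      have hupd : ∀ o, Function.update σ i (copyAt h.length) i o = copyAt h.length o := fun o => by
        rw [Function.update_self]
      have hj0 : σ j (view .isPrivate j (Step.safe :: failing h)) = 0 := by
        rw [← failing_safe, view_failing, ← hj1]
        refine hk (Arm.safe :: h) (numExperiments h) hklt ?_
        exact hE.goodProb_safe rfl
      have hz : ∀ θ, M.value .isPrivate (Function.update σ i (copyAt h.length)) i θ
          (failing h) = 0 := fun θ =>
        value_copyAt_of_safe (n := h.length) hij θ (fun y => hupd _)
          (by rw [hupd]; exact copyAt_of_length_le (by simp)) (by simp) (by simp [hi])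
          (by rw [Function.update_of_ne hij.symm]; exact hj0)
      have hs := hE.1.2.le_sum_good (i := i) (h := h)
        (f := M.value .isPrivate (Function.update σ i (copyAt h.length)) i .good)
        (v := 0) (w := M.g * M.δ * M.annuity i h.length) (hz _).ge
        (by
          intro x hx hne
          rw [value_copyAt_of_informed (n := h.length) hij (fun y => hupd _)
            (by rw [hupd]; exact copyAt_of_length_le (by simp [hlen x hx])) (hlen x hx)
            (by rw [hlen x hx, hi])
            (by rw [Function.update_of_ne hij.symm]; exact hinf x hx hne _)])
      rw [hz .bad]
      linarith
  -- the payoff from the prescribed experiment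
  have hp1 : π.goodProb .isPrivate i (unsuccessful (Arm.risky :: h)) = M.phi^[k + 1] M.p0 := by
    rw [hE.1.2.goodProb_own_risky hi, hbel, Function.iterate_succ_apply']
  -- If `j` is prescribed to experiment, his `R` is not informative. The belief of `i` stays at
  -- `φ^{k+1}(p₀)`, where by maximality of `k` he plays `S`, whatever the hidden outcome was.
  have hsafe : ∀ x ∈ infoSet .isPrivate i (unsuccessful h),
      σ j (unsuccessful (Arm.risky :: h)) = 1 → ∀ s : Step,
      view .isPrivate i (s :: Step.failure :: x) = unsuccessful (Arm.risky :: Arm.risky :: h) →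
      M.value .isPrivate σ i .good (s :: Step.failure :: x) =
        M.value .isPrivate σ i .good (Step.safe :: s :: Step.failure :: x) := by
    intro x hx hκ s hv
    have hm : mover (s :: Step.failure :: x).length = i := by
      rw [List.length_cons, List.length_cons, hlen x hx, hi2]
    refine M.value_of_safe ?_
    rw [hm, hv]
    have := hk (Arm.risky :: Arm.risky :: h) (k + 1) (Nat.lt_succ_self k)
    simp only [List.length_cons, hi2] at this
    refine this ?_
    rw [hE.1.goodProb_of_prescribed (h := Arm.risky :: h) hij hj1 hκ, hp1]
  have hview : ∀ x ∈ infoSet .isPrivate i (unsuccessful h), ∀ s : Step, s.arm = Arm.risky →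
      view .isPrivate i (s :: Step.failure :: x) =
        unsuccessful (Arm.risky :: Arm.risky :: h) := by
    intro x hx s hs
    rw [view, view, mem_infoSet.1 hx]
    cases s
    · simp [Step.arm] at hs
    · simp [observe, Step.arm]
    · simp [observe, hlen x hx, hj1, hij.symm, Step.arm]
  have hpi : 0 ≤ π.informedProb i h := hE.1.2.informedProb_nonneg i h
  have hpa := hE.1.2.failing_nonneg i h .good
  have hadd := goodProb_eq_add π i h
  have hg := M.g_pos
  have hδ := M.δ_pos
  have hδ1 := M.δ_lt_one
  have hl := M.lam_pos
  have hl1 := M.one_sub_lam_pos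
  rw [hbel] at hadd
  rw [← not_lt, lt_pHat_iff, not_lt]
  -- The prescribed reaction of the opponent to the experiment matters. If it is `S`, then after a
  -- failure with an unsuccessful opponent all experimentation ends, hence `v = 0`.
  rcases hσ (Arm.risky :: h) with hκ | hκ
  · rw [List.length_cons, hj1] at hκ
    have hb := hE.1.le_of_experiment hi hrisky (d := π.informedProb i h * (M.g * M.δ)) (v := 0)
      (w := M.g * M.δ)
      (by
        rw [M.value_of_safe, ← failing_safe, hE.safe_path hk, zero_mul]
        · rw [numExperiments_risky]
          omega
        · rw [length_failing, List.length_cons, hj1, view_failing]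
          exact hκ)
      (by
        intro x hx _
        have := M.value_le (mon := .isPrivate) (σ := σ) (i := i) (θ := .good) (Step.failure :: x)
        rwa [List.length_cons, hlen x hx, hA1, ← mul_assoc] at this)
      τ hτ
    rw [hbel] at hb
    have h1 : 0 ≤ M.phi^[k] M.p0 * M.g * (M.lam * M.δ * (M.δ * (1 - M.lam))) := by
      have := (M.phi_iterate_pos hp k).le
      positivity
    have h2 : 0 ≤ π.informedProb i h * (M.g * M.δ) * M.lam := by positivity
    linarith
  · rw [List.length_cons, hj1] at hκ
    -- The encouragement effect: an unsuccessful opponent experiments too. If he fails, play ends;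
    -- if he succeeds, with probability `λ`, then `i` still plays `S` at his next move and gains at
    -- most `g` from the period after it, hence `δ²`.
    have hb := hE.1.le_of_experiment hi hrisky (d := π.informedProb i h * (M.g * M.δ))
      (v := M.lam * (M.g * M.δ * M.δ)) (w := M.g * M.δ * M.δ)
      (by
        rw [M.value_of_risky, if_neg]
        · have hF := failing_mem_infoSet .isPrivate i h
          rw [failing_risky, hsafe _ hF hκ _ (hview _ hF _ rfl),
            hsafe _ hF hκ _ (hview _ hF _ rfl)]
          have h1 : M.value .isPrivate σ i .good
              (Step.safe :: Step.failure :: Step.failure :: failing h) = 0 := by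
            rw [← failing_risky, ← failing_risky, ← failing_safe]
            refine hE.safe_path hk ?_ i .good
            rw [numExperiments_risky, numExperiments_risky]
            omega
          rw [h1]
          have h2 := M.value_le (mon := .isPrivate) (σ := σ) (i := i) (θ := .good)
            (Step.safe :: Step.success :: Step.failure :: failing h)
          simp only [List.length_cons, length_failing] at h2
          rw [hA3] at h2
          simp only [successProb]
          have := mul_le_mul_of_nonneg_left h2 hl.le
          linarith
        · rw [length_failing, List.length_cons, hj1]
          exact hij.symm
        · rw [length_failing, List.length_cons, hj1, view_failing]
          exact hκ)
      (by
        intro x hx hne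
        have hm : mover (Step.failure :: x).length = j := by rw [List.length_cons, hlen x hx, hj1]
        rw [M.value_of_risky (by rw [hm]; exact hinf x hx hne _), hm, if_neg hij.symm,
          hsafe x hx hκ _ (hview x hx _ rfl), hsafe x hx hκ _ (hview x hx _ rfl)]
        have h2 := fun s => M.value_le (mon := .isPrivate) (σ := σ) (i := i) (θ := .good)
            (Step.safe :: s :: Step.failure :: x)
        simp only [List.length_cons, hlen x hx] at h2
        rw [hA3] at h2
        simp only [successProb]
        have h3 := mul_le_mul_of_nonneg_left (h2 Step.success) hl.le
        have h4 := mul_le_mul_of_nonneg_left (h2 Step.failure) hl1.le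
        linarith)
      τ hτ
    rw [hbel] at hb
    -- The remaining terms in `informedProb` have the favourable sign and can be dropped: a success
    -- already obtained by the opponent speaks for waiting.
    have h2 : 0 ≤ π.informedProb i h * (M.g * M.δ) * (1 - M.δ * (1 - M.lam)) := by
      have : 0 ≤ 1 - M.δ * (1 - M.lam) := by nlinarith
      positivity
    have h3 : 0 ≤ π.informedProb i h * (M.g * M.δ * M.δ) * (1 - M.lam) * M.lam := by positivity
    rw [hadd] at hb ⊢
    linarith

/-- With private outcomes, a player whose belief is below `p̂` does not experiment. -/
theorem IsReasonableSE.eq_zero_of_lt_pHat (hE : M.IsReasonableSE σ π) (hσ : σ.Pure)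
    {l : List Step} (hl : mover l.length = i)
    (hlt : π.goodProb .isPrivate i (view .isPrivate i l) < M.pHat) :
    σ i (view .isPrivate i l) = 0 := by
  have hp : M.p0 < 1 := lt_of_le_of_ne M.p0_le_one fun hp => by
    rw [hE.1.2.goodProb_eq_one_of_prior hp] at hlt
    exact absurd hlt M.pHat_lt_one.not_gt
  have hinf : ¬ Informed i l := fun h => by
    rw [hE.1.2.goodProb_of_informed h] at hlt
    exact absurd hlt M.pHat_lt_one.not_gt
  obtain ⟨h, hh⟩ : ∃ h, h = l.map Step.arm := ⟨_, rfl⟩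
  have hlen : h.length = l.length := by simp [hh]
  rw [eq_unsuccessful_of_not_informed hinf, ← hh] at hlt ⊢
  rw [← hlen] at hl
  subst hl
  rcases hσ h with h0 | h1
  · exact h0
  exfalso
  -- Exponents of the beliefs, on or off path, at which some unsuccessful player experiments. The
  -- greatest exponent is the lowest such belief, to which `pHat_le_of_least` applies.
  let S : Set ℕ := {n | ∃ h : List Arm, σ (mover h.length) (unsuccessful h) = 1 ∧
    π.goodProb .isPrivate (mover h.length) (unsuccessful h) = M.phi^[n] M.p0}
  obtain ⟨k, hk⟩ := hE.experiments_bounded hp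
  have hbdd : BddAbove S := ⟨k, by
    rintro n ⟨h, h1, h2⟩
    exact (hk h n h1 h2).le⟩
  obtain ⟨n, hn⟩ : ∃ n, π.goodProb .isPrivate (mover h.length) (unsuccessful h) =
      M.phi^[n] M.p0 := by
    rcases hE.belief_cases hσ hp (mover h.length) h with h2 | ⟨n, -, h2⟩
    · rw [h2] at hlt
      exact absurd hlt M.pHat_lt_one.not_gt
    · exact ⟨n, h2⟩
  have hmem : n ∈ S := ⟨h, h1, hn⟩
  obtain ⟨h', hr, hb⟩ := Nat.sSup_mem ⟨_, hmem⟩ hbdd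
  have hle := hE.pHat_le_of_least hσ hp hr hb fun h n hlt hn => by
    rcases hσ h with h0 | h1
    · exact h0
    · exact absurd (le_csSup hbdd (⟨h, h1, hn⟩ : n ∈ S)) (by omega)
  have h3 := (M.phi_iterate_strictAnti hp).antitone (le_csSup hbdd hmem)
  rw [hn] at hlt
  exact absurd hlt (hle.trans h3).not_gt

end Model

/-! ### Private outcomes: pretending to be successful -/

/-- The sequence of choices `h`, followed by `t` rounds in which both players experiment. -/
def experimentRounds (h : List Arm) : ℕ → List Arm
  | 0 => h
  | t + 1 => Arm.risky :: Arm.risky :: experimentRounds h t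

@[simp] theorem length_experimentRounds (h : List Arm) (t : ℕ) :
    (experimentRounds h t).length = h.length + 2 * t := by
  induction t with
  | zero => rfl
  | succ t ih =>
    rw [experimentRounds, List.length_cons, List.length_cons, ih]
    ring

@[simp] theorem numExperiments_experimentRounds (h : List Arm) (t : ℕ) :
    numExperiments (experimentRounds h t) = numExperiments h + 2 * t := by
  induction t with
  | zero => rfl
  | succ t ih =>
    rw [experimentRounds, numExperiments_risky, numExperiments_risky, ih]
    ring

theorem mover_add_two_mul (n t : ℕ) : mover (n + 2 * t) = mover n := by
  simp [mover]

/-- With `x = 1 - λ` and `d = δ`, the right side is the payoff of `probe` in the good state over `m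
+ 1` rounds, in units of `g`. The left side charges each round with the bracket from `p̂`, weighted
by the likelihood `x ^ m` of the failures before the last round, so a condition on the last belief
covers all rounds. -/
theorem rounds_payoff_bound {x d : ℝ} (hx0 : 0 ≤ x) (hx1 : x ≤ 1) (hd0 : 0 ≤ d) (hd1 : d ≤ 1)
    (m : ℕ) : x ^ m * (1 - d * x + x * d ^ 2 * (1 - x)) * ∑ t ∈ Finset.range (m + 1), d ^ t ≤
      1 - (d * x) ^ (m + 1) + x ^ (m + 1) * d ^ (m + 2) * (1 - x ^ (m + 1)) := by
  induction m with
  | zero =>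
    rw [zero_add, Finset.sum_range_one]
    apply le_of_eq
    ring
  | succ m ih =>
    have hz := mul_neg_geom_sum (d * x) (m + 1)
    have hw := mul_neg_geom_sum x (m + 1)
    have hD := Finset.sum_range_succ (fun t => d ^ t) (m + 1)
    have hdx : d * x ≤ 1 := mul_le_one₀ hd1 hx0 hx1
    have hS : (d * x) ^ (m + 1) * (x * d) * ∑ t ∈ Finset.range (m + 1), x ^ t ≤
        ∑ t ∈ Finset.range (m + 1), (d * x) ^ t := by
      rw [Finset.mul_sum]
      refine Finset.sum_le_sum fun t ht => ?_
      have ht' : t ≤ m + 1 := (Finset.mem_range.1 ht).le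
      have h1 : (d * x) ^ (m + 1) ≤ d ^ t := by
        calc (d * x) ^ (m + 1) ≤ d ^ (m + 1) :=
              pow_le_pow_left₀ (mul_nonneg hd0 hx0) (mul_le_of_le_one_right hd0 hx1) _
          _ ≤ d ^ t := pow_le_pow_of_le_one hd0 hd1 ht'
      have h2 : (d * x) ^ (m + 1) * (x * d) ≤ d ^ t * 1 :=
        mul_le_mul h1 (by linarith) (mul_nonneg hx0 hd0) (pow_nonneg hd0 t)
      rw [mul_one] at h2
      rw [mul_pow d x t]
      exact mul_le_mul_of_nonneg_right h2 (pow_nonneg hx0 t)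
    -- This is what remains of the claim after subtracting `x` times the induction hypothesis.
    -- Written with geometric sums it is `(1 - x)(1 - d x)` times the slack in `hS`.
    have hE : 0 ≤ (1 - x) * (1 - (d * x) ^ (m + 1)) -
        (d * x) ^ (m + 1) * (x * d) * (1 - d * x) * (1 - x ^ (m + 1)) := by
      rw [← hz, ← hw]
      have := mul_nonneg (mul_nonneg (sub_nonneg.2 hx1) (sub_nonneg.2 hdx)) (sub_nonneg.2 hS)
      linarith
    have hx := mul_le_mul_of_nonneg_left ih hx0
    rw [hD]
    simp only [mul_pow, pow_succ'] at hE hx ⊢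
    linarith

namespace Model

variable {M : Model} {σ : Profile} {π : BeliefSystem} {i j : Player}

theorem Consistent.sum_good_eq (hC : M.Consistent .isPrivate σ π) (hp : M.p0 < 1)
    {h : List Arm}
    (hbel : π.goodProb .isPrivate i (unsuccessful h) = M.phi^[numExperiments h] M.p0)
    (f : List Step → ℝ) :
    ∑ x ∈ infoSet .isPrivate i (unsuccessful h), π i (unsuccessful h) .good x * f x =
      M.phi^[numExperiments h] M.p0 * f (failing h) := by
  obtain ⟨h0, h1⟩ := hC.informedProb_eq_zero hp hbel
  rw [← Finset.add_sum_erase _ _ (failing_mem_infoSet .isPrivate i h), h1, add_eq_left]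
  refine Finset.sum_eq_zero fun x hx => ?_
  have hnn : ∀ x ∈ (infoSet .isPrivate i (unsuccessful h)).erase (failing h),
      0 ≤ π i (unsuccessful h) .good x := fun x hx => by
    have h2 := hC.nonneg (i := i) (l := failing h) (x := x) (θ := .good)
    rw [view_failing] at h2
    exact h2 (Finset.mem_of_mem_erase hx)
  rw [(Finset.sum_eq_zero_iff_of_nonneg hnn).1 h0 x hx, zero_mul]

/-- Experiment at the move number `n`, and then always or never, according to the outcome. -/
def persist (n : ℕ) : Strategy := fun o =>
  open Classical in
  if o.length = n ∨ o.reverse[n]? = some (Arm.risky, true) then 1 else 0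

open Classical in
theorem persist_view {n : ℕ} {mon : Monitoring} {x : List Step} (hx : x.length = n)
    (y : List Step) (s : Step) : persist n (view mon i (y ++ s :: x)) =
      if observe mon i n s = (Arm.risky, true) then 1 else 0 := by
  obtain ⟨o, ho, hv⟩ := view_append mon i y (s :: x)
  rw [hv, view, persist]
  have h1 : (o ++ observe mon i x.length s :: view mon i x).length ≠ n := by
    simp [hx]
    omega
  have h2 : (o ++ observe mon i x.length s :: view mon i x).reverse[n]? =
      some (observe mon i n s) := by
    simp [hx]
  rw [h2]
  simp only [h1, false_or, Option.some.injEq]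

/-- If everybody plays the safe arm from `h` on, and the active player thinks that all experiments
along `h` failed, then no deviation of his has a positive expected payoff. -/
theorem IsSequentialEq.deviation_nonpos (hE : M.IsSequentialEq .isPrivate σ π) (hp : M.p0 < 1)
    {h : List Arm} (hi : mover h.length = i)
    (hbel : π.goodProb .isPrivate i (unsuccessful h) = M.phi^[numExperiments h] M.p0)
    (hsafe : ∀ k, σ (mover (List.replicate k Arm.safe ++ h).length)
      (unsuccessful (List.replicate k Arm.safe ++ h)) = 0) (τ : Strategy) :
    M.p0 * (1 - M.lam) ^ numExperiments h *
        M.value .isPrivate (Function.update σ i τ) i .good (failing h) +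
      (1 - M.p0) * M.value .isPrivate (Function.update σ i τ) i .bad (failing h) ≤ 0 := by
  have h0 : ∀ θ, M.value .isPrivate σ i θ (failing h) = 0 := fun θ =>
    M.value_eq_zero_of_safe_path fun k => by
      rw [← failing_replicate_append, length_failing, view_failing]
      exact hsafe k
  have h1 := hE.unsuccessful_value_le hi τ
  rw [hE.2.sum_good_eq hp hbel, hE.2.sum_good_eq hp hbel, h0, h0, mul_zero,
    mul_zero, add_zero] at h1
  have h2 := hE.2.goodProb_add_bad i h
  have hD := M.phi_iterate_denom_pos hp (numExperiments h)
  rw [hbel, ← eq_sub_iff_add_eq'] at h2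
  rw [h2, M.phi_iterate hp, one_sub_div hD.ne'] at h1
  have h3 := mul_le_mul_of_nonneg_right h1 hD.le
  rw [zero_mul] at h3
  refine le_of_eq_of_le ?_ h3
  field_simp
  ring

/-- Above `p*` it would pay to experiment once and to continue only after a success, which is what
`persist` does. -/
theorem IsSequentialEq.le_pStar_of_quit (hE : M.IsSequentialEq .isPrivate σ π) (hp : M.p0 < 1)
    {h : List Arm} (hi : mover h.length = i)
    (hbel : π.goodProb .isPrivate i (unsuccessful h) = M.phi^[numExperiments h] M.p0)
    (hsafe : ∀ k, σ (mover (List.replicate k Arm.safe ++ h).length)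
      (unsuccessful (List.replicate k Arm.safe ++ h)) = 0) :
    M.phi^[numExperiments h] M.p0 ≤ M.pStar := by
  have hm : mover (failing h).length = i := by rw [length_failing, hi]
  have hτ : ∀ o, Function.update σ i (persist h.length) i o = persist h.length o := fun o => by
    rw [Function.update_self]
  have h0 : Function.update σ i (persist h.length) (mover (failing h).length)
      (view .isPrivate (mover (failing h).length) (failing h)) = 1 := by
    rw [hm, hτ, persist, if_pos (Or.inl (by simp))]
  have hfail : ∀ θ, M.value .isPrivate (Function.update σ i (persist h.length)) i θ
      (Step.failure :: failing h) = 0 := fun θ =>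
    M.value_eq_zero_of_abstains fun y _ => by
      rw [hτ, persist_view (length_failing h), if_neg (by simp [observe])]
  have hsucc : M.value .isPrivate (Function.update σ i (persist h.length)) i .good
      (Step.success :: failing h) = M.g * (M.δ * M.annuity i h.length) := by
    rw [M.value_eq_of_experiments, List.length_cons, length_failing, M.annuity_succ_of_mover hi]
    intro y _
    rw [hτ, persist_view (length_failing h), if_pos (by simp [observe, Step.arm, hi])]
  have h1 := hE.deviation_nonpos hp hi hbel hsafe (persist h.length)
  rw [M.value_of_risky h0, M.value_of_risky h0, if_pos hm, if_pos hm, hfail, hfail, hsucc,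
    length_failing] at h1
  simp only [successProb, experimentFlow_good, experimentFlow_bad] at h1
  rw [← not_lt, pStar_lt_iff, not_lt]
  have hD := M.phi_iterate_denom_pos hp (numExperiments h)
  have h2 : (M.p0 * (1 - M.lam) ^ numExperiments h * M.g * (1 - M.δ * (1 - M.lam)) -
      M.c * (1 - M.δ) * (1 - M.p0)) * M.annuity i h.length ≤ 0 := by linarith
  have h3 := nonpos_of_mul_nonpos_left h2 (M.annuity_pos i h.length)
  rw [M.phi_iterate hp, one_sub_div hD.ne', mul_div_assoc', div_mul_eq_mul_div, div_mul_eq_mul_div,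
    div_le_div_iff_of_pos_right hD]
  linarith

/-- Beliefs of the opponent `j` of a player `i` who experiments although he should have stopped: he
is taken to be successful, and this does not change as long as he goes on experimenting. -/
theorem IsSequentialEq.goodProb_experimentRounds (hE : M.IsSequentialEq .isPrivate σ π)
    (hp : M.p0 < 1) {h : List Arm} (hij : i ≠ j) (hi : mover h.length = i)
    (h1 : π.goodProb .isPrivate j (unsuccessful (Arm.risky :: h)) = 1) (t : ℕ) :
    π.goodProb .isPrivate j (unsuccessful (Arm.risky :: experimentRounds h t)) = 1 := by
  have hj : mover (h.length + 1) = j := mover_succ_eq (hi ▸ hij)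
  induction t with
  | zero => exact h1
  | succ t ih =>
    refine hE.goodProb_risky_eq_one hp hij.symm (j := i) ?_ ?_
    · rw [length_experimentRounds, mover_add_two_mul, hi]
    · rw [experimentRounds, hE.2.goodProb_own_risky, ih, phi_one]
      rw [List.length_cons, length_experimentRounds, add_right_comm, mover_add_two_mul, hj]

/-- Experiment in the moves before the move number `n`; then go on for ever if there was a success,
and otherwise play the safe arm once, to copy for ever the reaction of the opponent. -/
def probe (n : ℕ) : Strategy := fun o =>
  open Classical in
  if o.length < n ∨ (Arm.risky, true) ∈ o.reverse.take n then 1 else copyAt n o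

theorem probe_of_length_lt {n : ℕ} {o : List Obs} (h : o.length < n) : probe n o = 1 :=
  if_pos (Or.inl h)

theorem probe_of_informed {n : ℕ} {x : List Step} (hx : x.length ≤ n) (hinf : Informed i x)
    (y : List Step) : probe n (view .isPrivate i (y ++ x)) = 1 := by
  refine if_pos (Or.inr ?_)
  obtain ⟨o, -, ho⟩ := view_append .isPrivate i y x
  rw [ho, List.reverse_append]
  refine List.mem_of_mem_take (i := x.length) ?_
  rw [List.take_take, min_eq_left hx, List.take_append_of_le_length (by simp),
    List.take_of_length_le (by simp)]
  exact List.mem_reverse.2 hinf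

theorem probe_eq_copyAt {n : ℕ} {x : List Step} (hx : x.length = n) (hinf : ¬ Informed i x)
    (y : List Step) : probe n (view .isPrivate i (y ++ x)) =
      copyAt n (view .isPrivate i (y ++ x)) := by
  refine if_neg ?_
  obtain ⟨o, -, ho⟩ := view_append .isPrivate i y x
  rw [ho, List.reverse_append, List.take_append_of_le_length (by simp [hx]),
    List.take_of_length_le (by simp [hx]), not_or]
  exact ⟨by simp [hx], fun h => hinf (List.mem_reverse.1 h)⟩

end Model

namespace Model

variable {M : Model} {σ : Profile} {π : BeliefSystem} {i j : Player}

theorem value_probe_success {n : ℕ} {x : List Step} (hx : x.length < n) (hi : mover x.length = i) :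
    M.value .isPrivate (Function.update σ i (probe n)) i .good (Step.success :: x) =
      M.g * (M.δ * M.annuity i x.length) := by
  rw [M.value_eq_of_experiments, List.length_cons, M.annuity_succ_of_mover hi]
  intro y _
  rw [Function.update_self]
  exact probe_of_informed hx (informed_cons_success hi) y

theorem value_probe_round {n : ℕ} {x : List Step} (hij : i ≠ j) (hx : x.length < n)
    (hi : mover x.length = i) (θ : State)
    (hj : σ j (view .isPrivate j (Step.failure :: x)) = 1) :
    M.value .isPrivate (Function.update σ i (probe n)) i θ x =
      (1 - M.δ) * M.annuity i x.length * M.experimentFlow θ +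
      ((1 - M.successProb θ) *
        ((1 - M.successProb θ) * M.value .isPrivate (Function.update σ i (probe n)) i θ
          (Step.failure :: Step.failure :: x) +
        M.successProb θ * M.value .isPrivate (Function.update σ i (probe n)) i θ
          (Step.success :: Step.failure :: x)) +
      M.successProb θ * M.value .isPrivate (Function.update σ i (probe n)) i θ
        (Step.success :: x)) := by
  have hm : mover (Step.failure :: x).length = j := mover_succ_eq (hi ▸ hij)
  rw [M.value_of_risky (l := x), if_pos hi, M.value_of_risky (l := Step.failure :: x),
    if_neg (by rw [hm]; exact hij.symm), zero_add]
  · rw [hm, Function.update_of_ne hij.symm, hj]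
  · rw [hi, Function.update_self]
    exact probe_of_length_lt (by simpa using hx)

theorem annuity_add_two_mul (i : Player) (n t : ℕ) :
    M.annuity i (n + 2 * t) = M.δ ^ t * M.annuity i n := by
  induction t with
  | zero => simp
  | succ t ih =>
    rw [mul_add, mul_one, ← add_assoc, annuity_add_two, ih]
    ring

theorem view_round {x : List Step} {h : List Arm} (hij : i ≠ j) (hi : mover x.length = i)
    (hv : view .isPrivate i x = unsuccessful h) (s : Step) (hs : s.arm = Arm.risky) :
    view .isPrivate i (s :: Step.failure :: x) = unsuccessful (Arm.risky :: Arm.risky :: h) := by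
  have hm : mover (x.length + 1) = j := mover_succ_eq (hi ▸ hij)
  rw [view, view, hv]
  cases s
  · simp [Step.arm] at hs
  · simp [observe, Step.arm]
  · simp [observe, Step.arm, hm, hij.symm]

/-- The payoffs from probing, when the opponent experiments in each of `t + r` rounds and then
reveals whether he was successful. -/
theorem IsSequentialEq.value_probe (hE : M.IsSequentialEq .isPrivate σ π) {h : List Arm}
    (hij : i ≠ j) (hi : mover h.length = i) {T : ℕ}
    (hrisky : ∀ t, σ j (unsuccessful (Arm.risky :: experimentRounds h t)) = 1)
    (hreveal : σ j (unsuccessful (Arm.safe :: experimentRounds h T)) = 0)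
    (r t : ℕ) (htr : t + r = T) :
    (∀ x, view .isPrivate i x = unsuccessful (experimentRounds h t) → Informed j x →
      M.value .isPrivate (Function.update σ i (probe (h.length + 2 * T))) i .good x =
        M.g * (M.δ ^ t * M.annuity i h.length) *
          (1 - (M.δ * (1 - M.lam)) ^ r + (1 - M.lam) ^ r * M.δ ^ (r + 1))) ∧
    M.value .isPrivate (Function.update σ i (probe (h.length + 2 * T))) i .good
        (failing (experimentRounds h t)) =
      M.g * (M.δ ^ t * M.annuity i h.length) *
        (1 - (M.δ * (1 - M.lam)) ^ r +
          (1 - M.lam) ^ r * M.δ ^ (r + 1) * (1 - (1 - M.lam) ^ r)) ∧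
    M.value .isPrivate (Function.update σ i (probe (h.length + 2 * T))) i .bad
        (failing (experimentRounds h t)) =
      -(M.c * (M.δ ^ t * M.annuity i h.length) * (1 - M.δ ^ r)) := by
  -- Origin of the formulas: in the good state the player fails in all `r` rounds with probability
  -- `(1 - λ) ^ r` and then loses what comes from `δ ^ r` on, but regains it from `δ ^ (r + 1)` on
  -- if the opponent was successful. That is certain if the opponent is already informed, and
  -- otherwise has probability `1 - (1 - λ) ^ r`. In the bad state the cost is paid in `r` rounds.
  have hlen : ∀ t x, view .isPrivate i x = unsuccessful (experimentRounds h t) →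
      x.length = h.length + 2 * t := fun t x hv => by
    rw [← length_view .isPrivate i x, hv, length_unsuccessful, length_experimentRounds]
  have hmi : ∀ t x, view .isPrivate i x = unsuccessful (experimentRounds h t) →
      mover x.length = i := fun t x hv => by rw [hlen t x hv, mover_add_two_mul, hi]
  have hupd : ∀ o, Function.update σ i (probe (h.length + 2 * T)) i o =
      probe (h.length + 2 * T) o := fun o => by rw [Function.update_self]
  have hninf : ∀ t x, view .isPrivate i x = unsuccessful (experimentRounds h t) →
      ¬ Informed i x := fun t x hv => not_informed_of_mem_infoSet (mem_infoSet.2 hv)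
  have hjm : ∀ t x s, view .isPrivate i x = unsuccessful (experimentRounds h t) →
      mover (List.length (s :: x)) = j := fun t x s hv =>
    mover_succ_eq (by rw [hmi t x hv]; exact hij)
  induction r generalizing t with
  | zero =>
    rw [add_zero] at htr
    subst htr
    have hend : ∀ x, view .isPrivate i x = unsuccessful (experimentRounds h t) →
        (∀ y : List Step, Function.update σ i (probe (h.length + 2 * t)) i
          (view .isPrivate i (y ++ Step.safe :: x)) =
          copyAt (h.length + 2 * t) (view .isPrivate i (y ++ Step.safe :: x))) ∧
        Function.update σ i (probe (h.length + 2 * t)) i (view .isPrivate i x) = 0 := by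
      intro x hv
      constructor
      · intro y
        have := probe_eq_copyAt (hlen t x hv) (hninf t x hv) (y ++ [Step.safe])
        rw [List.append_assoc, List.singleton_append] at this
        rw [hupd, this]
      · have := probe_eq_copyAt (hlen t x hv) (hninf t x hv) []
        rw [List.nil_append] at this
        rw [hupd, this]
        exact copyAt_of_length_le (by rw [length_view, hlen t x hv]; omega)
    have hF := view_failing .isPrivate i (experimentRounds h t)
    have hz : ∀ θ, M.value .isPrivate (Function.update σ i (probe (h.length + 2 * t))) i θ
        (failing (experimentRounds h t)) = 0 := fun θ =>
      value_copyAt_of_safe hij θ (hend _ hF).1 (hend _ hF).2 (hlen t _ hF) (hmi t _ hF)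
        (by rw [Function.update_of_ne hij.symm, ← failing_safe, view_failing, hreveal])
    refine ⟨fun x hv hinf => ?_, ?_, ?_⟩
    · rw [value_copyAt_of_informed hij (hend x hv).1 (hend x hv).2 (hlen t x hv) (hmi t x hv),
        annuity_add_two_mul]
      · ring
      · rw [Function.update_of_ne hij.symm]
        exact hE.eq_one_of_informed (hinf.cons _) (hjm t x _ hv)
    · rw [hz]
      ring
    · rw [hz]
      ring
  | succ r ih =>
    obtain ⟨ih1, ih2, ih3⟩ := ih (t + 1) (by omega)
    have hlt : ∀ x, view .isPrivate i x = unsuccessful (experimentRounds h t) →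
        x.length < h.length + 2 * T := fun x hv => by
      rw [hlen t x hv]
      omega
    have hF := view_failing .isPrivate i (experimentRounds h t)
    have hFj : σ j (view .isPrivate j (Step.failure :: failing (experimentRounds h t))) = 1 := by
      rw [← failing_risky, view_failing, hrisky]
    have hFF : Step.failure :: Step.failure :: failing (experimentRounds h t) =
        failing (experimentRounds h (t + 1)) := by
      rw [experimentRounds, failing_risky, failing_risky]
    refine ⟨fun x hv hinf => ?_, ?_, ?_⟩
    · rw [value_probe_round hij (hlt x hv) (hmi t x hv) .good
        (hE.eq_one_of_informed (hinf.cons _) (hjm t x _ hv)),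
        value_probe_success (hlt x hv) (hmi t x hv),
        ih1 _ (view_round hij (hmi t x hv) hv _ rfl) ((hinf.cons _).cons _),
        ih1 _ (view_round hij (hmi t x hv) hv _ rfl) ((hinf.cons _).cons _), hlen t x hv,
        annuity_add_two_mul]
      simp only [experimentFlow_good, successProb]
      ring
    · rw [value_probe_round hij (hlt _ hF) (hmi t _ hF) .good hFj,
        value_probe_success (hlt _ hF) (hmi t _ hF), hFF, ih2,
        ih1 _ (view_round hij (hmi t _ hF) hF _ rfl)
          (informed_cons_success (hjm t _ _ hF)), hlen t _ hF, annuity_add_two_mul]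
      simp only [experimentFlow_good, successProb]
      ring
    · rw [value_probe_round hij (hlt _ hF) (hmi t _ hF) .bad hFj, hFF, ih3, hlen t _ hF,
        annuity_add_two_mul]
      simp only [experimentFlow_bad, successProb]
      ring

/-- A player whose last experiment was followed by safe choices of both players for ever has a
belief of at most `p̂`: otherwise he would pretend to be successful. -/
theorem IsReasonableSE.le_pHat_of_quit (hE : M.IsReasonableSE σ π) (hσ : σ.Pure)
    (hp : M.p0 < 1) {h : List Arm} (hij : i ≠ j) (hi : mover h.length = i)
    (hbel : π.goodProb .isPrivate i (unsuccessful h) = M.phi^[numExperiments h] M.p0)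
    (hsafe : ∀ k, σ (mover (List.replicate k Arm.safe ++ h).length)
      (unsuccessful (List.replicate k Arm.safe ++ h)) = 0)
    (hj : π.goodProb .isPrivate j (unsuccessful (Arm.risky :: h)) = 1) :
    M.phi^[numExperiments h] M.p0 ≤ M.pHat := by
  by_contra hlt
  rw [not_le] at hlt
  have hmj : mover (h.length + 1) = j := mover_succ_eq (hi ▸ hij)
  have hmj' : ∀ t a, mover (a :: experimentRounds h t).length = j := fun t a => by
    rw [List.length_cons, length_experimentRounds, add_right_comm, mover_add_two_mul, hmj]
  -- The probing lasts `m + 1` rounds: the own belief, which counts only own failures from `h` on,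
  -- is above `p̂` before each of them and no longer afterwards.
  obtain ⟨m, hm1, hm2⟩ : ∃ m, M.pHat < M.phi^[numExperiments h + m] M.p0 ∧
      M.phi^[numExperiments h + (m + 1)] M.p0 ≤ M.pHat := by
    by_contra hc
    push Not at hc
    have hall : ∀ m, M.pHat < M.phi^[numExperiments h + m] M.p0 := fun m => by
      induction m with
      | zero => exact hlt
      | succ m ih => exact hc m ih
    obtain ⟨n, hn⟩ := M.exists_phi_iterate_lt hp M.pHat_pos
    exact absurd (hn (numExperiments h + n) (by omega)) (hall n).not_gt
  have hrisky : ∀ t, σ j (unsuccessful (Arm.risky :: experimentRounds h t)) = 1 := fun t => by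
    have := hE.1.eq_one_of_goodProb_eq_one (i := j)
      (l := failing (Arm.risky :: experimentRounds h t))
      (by rw [length_failing]; exact hmj' t _)
    rw [view_failing] at this
    exact this (hE.1.goodProb_experimentRounds hp hij hi hj t)
  -- The `S` after the probing lets `j` count the failures of both players. As `2(m + 1) > m + 1`,
  -- his belief is strictly below `p̂` even if `φ^{n_e(h)+m+1}(p₀) = p̂`, so part (b) makes him stop
  -- unless he was successful.
  have hreveal : σ j (unsuccessful (Arm.safe :: experimentRounds h (m + 1))) = 0 := by
    have := hE.eq_zero_of_lt_pHat hσ (i := j)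
      (l := failing (Arm.safe :: experimentRounds h (m + 1)))
      (by rw [length_failing]; exact hmj' _ _)
    rw [view_failing, hE.goodProb_safe (hmj' _ _), numExperiments_experimentRounds] at this
    exact this (((M.phi_iterate_strictAnti hp) (by omega)).trans_le hm2)
  obtain ⟨-, hG, hB⟩ := hE.1.value_probe hij hi hrisky hreveal (m + 1) 0 (by omega)
  have hdev := hE.1.deviation_nonpos hp hi hbel hsafe (probe (h.length + 2 * (m + 1)))
  rw [experimentRounds] at hG hB
  rw [hG, hB] at hdev
  have hbound := rounds_payoff_bound M.one_sub_lam_pos.le (by linarith [M.lam_pos]) M.δ_pos.le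
    M.δ_lt_one.le m
  have hgeom := mul_neg_geom_sum M.δ (m + 1)
  have hS : 0 < ∑ t ∈ Finset.range (m + 1), M.δ ^ t :=
    Finset.sum_pos (fun t _ => pow_pos M.δ_pos t) ⟨0, by simp⟩
  have hD := M.phi_iterate_denom_pos hp (numExperiments h + m)
  rw [pHat_lt_iff, M.phi_iterate hp, one_sub_div hD.ne', mul_div_assoc', div_mul_eq_mul_div,
    div_mul_eq_mul_div, div_lt_div_iff_of_pos_right hD, pow_add] at hm1
  have hpos : 0 < M.p0 * (1 - M.lam) ^ numExperiments h * M.g :=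
    mul_pos (mul_pos M.p0_pos (pow_pos M.one_sub_lam_pos _)) M.g_pos
  rw [← hgeom] at hdev
  set S := ∑ t ∈ Finset.range (m + 1), M.δ ^ t
  set W := 1 - (M.δ * (1 - M.lam)) ^ (m + 1) +
    (1 - M.lam) ^ (m + 1) * M.δ ^ (m + 1 + 1) * (1 - (1 - M.lam) ^ (m + 1))
  have h1 : (M.p0 * (1 - M.lam) ^ numExperiments h * M.g * W -
      (1 - M.p0) * (M.c * (1 - M.δ)) * S) * M.annuity i h.length ≤ 0 := by
    rw [pow_zero] at hdev
    linarith
  have h2 := nonpos_of_mul_nonpos_left h1 (M.annuity_pos i h.length)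
  have h3 := mul_le_mul_of_nonneg_left hbound hpos.le
  have h4 := mul_lt_mul_of_pos_right hm1 hS
  linarith

/-! ### Private outcomes: the play in the bad state -/

open MeasureTheory Filter

/-- The number of own experiments of player `i` along a sequence of choices. -/
def ownExperiments (i : Player) : List Arm → ℕ
  | [] => 0
  | a :: h => ownExperiments i h + if a = Arm.risky ∧ mover h.length = i then 1 else 0

theorem numExperiments_eq_add (hij : i ≠ j) (h : List Arm) :
    numExperiments h = ownExperiments i h + ownExperiments j h := by
  induction h with
  | nil => rfl
  | cons a h ih =>
    cases a
    · simp [ownExperiments, ih]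
    · rw [numExperiments_risky, ih]
      by_cases hi : mover h.length = i
      · simp [ownExperiments, hi, hij]
        ring
      · have hj : mover h.length = j := eq_of_ne_of_ne (Ne.symm hi) hij
        simp [ownExperiments, hj, hij.symm]
        ring

/-- `a` is the choice prescribed by the pure profile `σ` to the unsuccessful player after `h`. -/
def Prescribed (σ : Profile) (h : List Arm) (a : Arm) : Prop :=
  (a = Arm.safe ∧ σ (mover h.length) (unsuccessful h) = 0) ∨
    (a = Arm.risky ∧ σ (mover h.length) (unsuccessful h) = 1)

/-- Nothing unprescribed happens on this path, so belief `1` by inference does not arise. Every own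
failure is counted, and `S` by the opponent adds the failures of his that were not counted yet. -/
theorem IsReasonableSE.belief_on_path (hE : M.IsReasonableSE σ π)
    {h : ℕ → List Arm} (h0 : h 0 = [])
    (hstep : ∀ t, ∃ a, h (t + 1) = a :: h t ∧ Prescribed σ (h t) a) (i : Player) (t : ℕ) :
    ∃ n, ownExperiments i (h t) ≤ n ∧ n ≤ numExperiments (h t) ∧
      π.goodProb .isPrivate i (unsuccessful (h t)) = M.phi^[n] M.p0 := by
  obtain ⟨j, hij⟩ := exists_ne_player i
  induction t with
  | zero => exact ⟨0, by simp [h0, ownExperiments], by simp, by rw [h0]; exact goodProb_nil hE.1.2 i⟩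
  | succ t ih =>
    obtain ⟨n, hn1, hn2, hn3⟩ := ih
    obtain ⟨a, ha, hpr⟩ := hstep t
    rw [ha]
    by_cases hi : mover (h t).length = i
    · cases a
      · exact ⟨n, by simpa [ownExperiments] using hn1, by simpa using hn2,
          (hE.1.2.goodProb_own_safe hi).trans hn3⟩
      · refine ⟨n + 1, by simpa [ownExperiments, hi] using hn1, by simpa using hn2, ?_⟩
        rw [hE.1.2.goodProb_own_risky hi, hn3, Function.iterate_succ_apply']
    · have hj : mover (h t).length = j := eq_of_ne_of_ne (Ne.symm hi) hij
      cases a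
      · refine ⟨numExperiments (h t), ?_, by simp, hE.goodProb_safe (mover_succ_eq hi)⟩
        simp [ownExperiments, numExperiments_eq_add hij]
      · refine ⟨n, by simpa [ownExperiments, hi] using hn1, by simp; omega, ?_⟩
        rw [hE.1.goodProb_of_prescribed hij hj, hn3]
        rcases hpr with hpr | hpr
        · simp at hpr
        · rw [← hj]
          exact hpr.2

/-- The play in the bad state: both players stop, at a common belief of at most `p̂`. -/
theorem IsReasonableSE.exists_quit (hE : M.IsReasonableSE σ π) (hσ : σ.Pure)
    (hp : M.p0 < 1) (hstar : M.pStar < M.p0) {h : ℕ → List Arm} (h0 : h 0 = [])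
    (hstep : ∀ t, ∃ a, h (t + 1) = a :: h t ∧ Prescribed σ (h t) a) :
    ∃ t, (∀ k, h (t + k) = List.replicate k Arm.safe ++ h t) ∧
      M.phi^[numExperiments (h t)] M.p0 ≤ M.pHat := by
  classical
  -- With infinitely many experiments some player would experiment without bound. But his belief
  -- counts at least his own failures, so it would fall below `p̂`, where part (b) forbids
  -- experiments.
  have hquit : ∃ t, ∀ k, h (t + k) = List.replicate k Arm.safe ++ h t := by
    rcases exists_numExperiments_eq_or_tendsto
      (fun t => (hstep t).imp fun a ha => ha.1) with hs | hs
    · exact hs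
    exfalso
    obtain ⟨n, hn⟩ := M.exists_phi_iterate_lt hp M.pHat_pos
    have hown : ∀ i t, ownExperiments i (h t) ≤ n := by
      intro i t
      induction t with
      | zero => simp [h0, ownExperiments]
      | succ t ih =>
        obtain ⟨a, ha, hpr⟩ := hstep t
        rw [ha, ownExperiments]
        split_ifs with hc
        · obtain ⟨rfl, hi⟩ := hc
          rcases hpr with hpr | hpr
          · simp at hpr
          obtain ⟨k, hk1, -, hk2⟩ := hE.belief_on_path h0 hstep i t
          by_contra hlt
          have := hE.eq_zero_of_lt_pHat hσ (i := i) (l := failing (h t))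
            (by rw [length_failing, hi])
          rw [view_failing, hk2, ← hi, hpr.2] at this
          exact one_ne_zero (this (hn k (by omega)))
        · exact ih
    obtain ⟨t, ht⟩ := (hs.eventually (eventually_gt_atTop (n + n))).exists
    have h1 := numExperiments_eq_add (i := 0) (j := 1) (by simp) (h t)
    have h2 := hown 0 t
    have h3 := hown 1 t
    omega
  -- At the first time from which all choices are safe, either nobody ever experimented, which `p₀ >
  -- p*` excludes, or the choice just before was `R`.
  refine ⟨Nat.find hquit, Nat.find_spec hquit, ?_⟩
  have hspec := Nat.find_spec hquit
  have hmin := fun k hk => Nat.find_min hquit (m := k) hk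
  generalize Nat.find hquit = T at hspec hmin
  have hzero : ∀ k, σ (mover (List.replicate k Arm.safe ++ h T).length)
      (unsuccessful (List.replicate k Arm.safe ++ h T)) = 0 := by
    intro k
    obtain ⟨a, ha, hpr⟩ := hstep (T + k)
    have h1 := hspec (k + 1)
    rw [← add_assoc, ha, hspec k, List.replicate_succ, List.cons_append,
      List.cons.injEq] at h1
    rw [hspec k] at hpr
    rcases hpr with hpr | hpr
    · exact hpr.2
    · rw [h1.1] at hpr
      simp at hpr
  rcases T with _ | T
  · have h1 := hE.1.le_pStar_of_quit hp rfl (h := h 0)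
      (by rw [h0]; exact goodProb_nil hE.1.2 _) hzero
    rw [h0] at h1
    exact absurd hstar h1.not_gt
  · obtain ⟨a, ha, hpr⟩ := hstep T
    cases a
    · exfalso
      refine hmin T (Nat.lt_succ_self T) fun k => ?_
      cases k with
      | zero => rfl
      | succ k =>
        rw [add_comm k 1, ← add_assoc, hspec k, ha, add_comm 1 k, List.replicate_succ',
          List.append_assoc]
        rfl
    -- The last experimenter deviates after the first `S` of `j`. His `R` would be unprescribed
    -- there, and since his previous choice was `R`, a success is possible in the eyes of `j`, who
    -- becomes certain of `G`.
    · obtain ⟨j, hij⟩ := exists_ne_player (mover (h T).length)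
      have hmj : mover (Arm.risky :: h T).length = j := mover_succ_eq hij
      have hmi : mover (Arm.safe :: Arm.risky :: h T).length = mover (h T).length := by
        simp [mover_add_two]
      have hS : h (T + 1 + 1) = Arm.safe :: Arm.risky :: h T := by
        rw [hspec 1, ha]
        rfl
      have hz1 := hzero 1
      rw [ha] at hz1 ⊢
      rw [List.replicate_one, List.singleton_append, hmi] at hz1
      refine le_of_eq_of_le ?_ (hE.le_pHat_of_quit hσ hp (h := Arm.safe :: Arm.risky :: h T)
        hij hmi ?_ ?_ ?_)
      · rw [numExperiments_safe]
      · rw [numExperiments_safe]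
        exact hE.goodProb_safe hmi
      · intro k
        have := hzero (k + 1)
        rwa [ha, List.replicate_succ', List.append_assoc, List.singleton_append] at this
      · refine hE.1.goodProb_of_unprescribed hij.symm hmi hz1 ?_
        refine hE.1.2.informedProb_ne_zero hij.symm rfl ?_
        obtain ⟨n, -, -, hn⟩ := hE.belief_on_path h0 hstep j (T + 1 + 1)
        rw [hS] at hn
        rw [hn]
        exact (M.phi_iterate_lt_one hp n).ne

theorem IsReasonableSE.ae_tendsto (hE : M.IsReasonableSE σ π) (hσ : σ.Pure)
    (hstar : M.pStar < M.p0) :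
    ∀ᵐ ω ∂(M.law .isPrivate σ), (ω 0).1 = State.bad →
      ∀ i : Player, ∃ q : ℝ, q ≤ M.pHat ∧
        Tendsto (fun t => π.goodProb .isPrivate i (view .isPrivate i (ω t).2)) atTop
          (nhds q) := by
  filter_upwards [M.ae_law_path .isPrivate σ, M.ae_law_step .isPrivate σ, M.ae_law_zero .isPrivate σ]
    with ω hpath hstep hzero hbad i
  have hst : ∀ t, (ω t).1 = State.bad := fun t => (hpath t).1.trans hbad
  have hjoint : ∀ t, 0 < M.joint .isPrivate σ State.bad (ω t).2 := fun t => by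
    have := (hpath t).2.2
    rwa [hst t] at this
  have hp : M.p0 < 1 :=
    sub_pos.1 (pos_of_mul_pos_left (hjoint 0) (M.pathProb_nonneg _ _ _ _))
  have hsucc : ∀ t, Step.success ∉ (ω t).2 := fun t hs => by
    have := hjoint t
    rw [joint, M.pathProb_bad_of_success hs, mul_zero] at this
    exact this.false
  set h : ℕ → List Arm := fun t => (ω t).2.map Step.arm with hdef
  have hfail : ∀ t, failing (h t) = (ω t).2 := fun t => exists_failing_eq (hsucc t)
  have hview : ∀ i t, view .isPrivate i (ω t).2 = unsuccessful (h t) := fun i t => by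
    rw [← hfail t, view_failing]
  have hlen : ∀ t, (ω t).2.length = (h t).length := fun t => by simp [hdef]
  have hcons : ∀ t, ∃ a, h (t + 1) = a :: h t ∧ Prescribed σ (h t) a := fun t => by
    obtain ⟨s, hs, hpos⟩ := hstep t
    refine ⟨s.arm, by simp [hdef, hs], ?_⟩
    rw [hst t] at hpos
    cases s
    · refine Or.inl ⟨rfl, ?_⟩
      simp only [stepProb, hview, hlen] at hpos
      rcases hσ (h t) with h0 | h1
      · exact h0
      · simp [h1] at hpos
    · refine Or.inr ⟨rfl, ?_⟩
      simp only [stepProb, hview, hlen] at hpos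
      rcases hσ (h t) with h0 | h1
      · simp [h0] at hpos
      · exact h1
    · simp [stepProb, successProb] at hpos
  have hnil : h 0 = [] := by simp [hdef, hzero.1]
  obtain ⟨t, ht, hle⟩ := hE.exists_quit hσ hp hstar hnil hcons
  refine ⟨_, hle, tendsto_const_nhds.congr' ?_⟩
  have hone : ∀ k, mover (h (t + (k + 1))).length = i →
      π.goodProb .isPrivate i (unsuccessful (h (t + (k + 1)))) =
        M.phi^[numExperiments (h t)] M.p0 := by
    intro k hi
    rw [ht (k + 1), List.replicate_succ, List.cons_append] at hi ⊢
    rw [hE.goodProb_safe hi, numExperiments_replicate_append]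
  -- From `t + 2` on, each player has already been active after an `S` that followed the stopping
  -- time, which fixed his belief; his own `S` does not change it.
  filter_upwards [eventually_ge_atTop (t + 2)] with s hs
  obtain ⟨k, rfl⟩ := Nat.exists_eq_add_of_le hs
  rw [hview]
  by_cases hi : mover (h (t + (k + 1 + 1))).length = i
  · have := hone (k + 1) hi
    rw [show t + 2 + k = t + (k + 1 + 1) by ring, this]
  · have h2 : h (t + (k + 1 + 1)) = Arm.safe :: h (t + (k + 1)) := by
      rw [ht (k + 1 + 1), ht (k + 1), List.replicate_succ, List.cons_append]
    have hi' : mover (h (t + (k + 1))).length = i := by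
      by_contra hne
      rw [h2] at hi
      exact hi (mover_succ_eq hne)
    rw [show t + 2 + k = t + (k + 1 + 1) by ring, h2, hE.1.2.goodProb_own_safe hi', hone k hi']

end Model

end Experimentation

end

theorem mainTheorem8 (M : Experimentation.Model) :
    (M.pStar < M.p0 →
      ∀ (σ : Experimentation.Profile) (π : Experimentation.BeliefSystem),
        M.IsReasonableSE σ π → σ.Pure →
        (∀ᵐ ω ∂(M.law Experimentation.Monitoring.isPrivate σ),
          (ω 0).1 = Experimentation.State.bad →
            ∀ i : Experimentation.Player, ∃ q : ℝ, q ≤ M.pHat ∧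
              Filter.Tendsto
                (fun t => π.goodProb Experimentation.Monitoring.isPrivate i
                  (Experimentation.view Experimentation.Monitoring.isPrivate i (ω t).2))
                Filter.atTop (nhds q)) ∧
        (∀ (i : Experimentation.Player) (l : List Experimentation.Step),
          Experimentation.mover l.length = i →
          π.goodProb Experimentation.Monitoring.isPrivate i
              (Experimentation.view Experimentation.Monitoring.isPrivate i l) < M.pHat →
          σ i (Experimentation.view Experimentation.Monitoring.isPrivate i l) = 0)) ∧
    (∀ σ : Experimentation.Profile,
      M.IsNash Experimentation.Monitoring.isPublic σ →
        (∀ᵐ ω ∂(M.law Experimentation.Monitoring.isPublic σ),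
          (ω 0).1 = Experimentation.State.bad →
            ∀ i : Experimentation.Player, ∃ q : ℝ, q ≤ M.pStar ∧
              Filter.Tendsto
                (fun t => (M.bayes Experimentation.Monitoring.isPublic σ).goodProb
                  Experimentation.Monitoring.isPublic i
                  (Experimentation.view Experimentation.Monitoring.isPublic i (ω t).2))
                Filter.atTop (nhds q)) ∧
        (∀ (i : Experimentation.Player) (l : List Experimentation.Step),
          Experimentation.mover l.length = i →
          0 < M.obsProb Experimentation.Monitoring.isPublic σ i
              (Experimentation.view Experimentation.Monitoring.isPublic i l) →
          (M.bayes Experimentation.Monitoring.isPublic σ).goodProb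
              Experimentation.Monitoring.isPublic i
              (Experimentation.view Experimentation.Monitoring.isPublic i l) < M.pStar →
          σ i (Experimentation.view Experimentation.Monitoring.isPublic i l) = 0)) :=
  ⟨fun hstar _ _ hE hσ => ⟨hE.ae_tendsto hσ hstar, fun _ _ => hE.eq_zero_of_lt_pHat hσ⟩,
    fun _ hσ => ⟨hσ.ae_tendsto, fun _ _ => hσ.eq_zero_of_lt_pStar⟩⟩
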